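/- **Definitions.** For a sequence $T=(t_0,\dots,t_k)$ of positive integers, $k\ge 1$, a *$T$-layered graph* $G$ has layers $V_0,\dots,V_k$ with $V_i=[t_i]$ and edge set $E_1\sqcup\dots\sqcup E_k$, where $E_i$ is a matching of size $\min(t_{i-1},t_i)$ between $V_{i-1}$ and $V_i$. For $i<j$ and $v\in V_i$, $G_{i\to j}(v)$ is the unique vertex of $V_j$ connected to $v$, or $\bot$ if there is none. $G$ is *nice* if $|\{v\in V_i: G_{i\to j}(v)\ne\bot\}|=\min_{i\le h\le j}t_h$ for all $0\le i<j\le k$. Let $c\ge 1$ be an integer and $S=(s_1,\dots,s_k)$ a non-decreasing sequence of positive integers. Set $\mathsf{nest}(c,(s_1))=(s_1,s_1)$, and for $k>1$ let $\mathsf{nest}(c,S)$ be obtained from $\mathsf{nest}(c,(s_1,\dots,s_{k-1}))$ by inserting $2c-1$ copies of $s_k$ between any two consecutive elements. A *$(c,S)$-nested block graph* is a nice $\mathsf{nest}(c,S)$-layered graph; its last layer has index $\ell=(2c)^{k-1}$, and its first and last layers both have size $s_1$. Let $\mathcal D_{c,S}$ be the uniform distribution over $(c,S)$-nested block graphs and,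 for a permutation $\mathsf Z$ of $[s_1]$, let $\mathcal D_{c,S}^{\mathsf Z}$ be $\mathcal D_{c,S}$ conditioned on $G_{0\to\ell}=\mathsf Z$. In a *randomized $r$-round $(c,S)$-protocol* $\Pi$ the input is a $\mathsf{nest}(c,S)$-layered graph $G$; Alice gets $E_i$ for all even $i$ and Bob gets $E_i$ for all odd $i$. They may use public and private coins. There are $r$ rounds; Alice sends a message (a bit string) to Bob in every odd round, and Bob sends one to Alice in every even round. After the $r$ rounds Alice (if $r$ is even) or Bob (if $r$ is odd) computes the output $\Pi(G)$ from her or his input, the transcript and the coins. The cost $\|\Pi\|$ is the largest total number of bits communicated over all inputs and coin outcomes, not including the output. The total variation distance of two distributions is the supremum over all events of the difference of their probabilities. **Theorem.** There are absolute constants $K$ and $m_0$ such that the following holds. Let $r,m,c\ge 1$ be integers with $m$ odd and $m\ge m_0$, and let $$S=\Big(m,\; m+\Big\lfloor\frac{m}{r}\Big\rfloor,\; m+\Big\lfloor\frac{2m}{r}\Big\rfloor,\;\dots,\;2m\Big),$$ a sequence of length $r+1$. Then for all permutations $\mathsf Y,\mathsf N$ of $[m]$ and every randomized $r$-round $(c,S)$-protocol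 $\Pi$ with $$\|\Pi\|\le 2^{-K r}\cdot m^{1-\frac{200}{c}},$$ the total variation distance between the distribution of $\Pi(G)$ for $G\sim\mathcal D_{c,S}^{\mathsf Y}$ and the distribution of $\Pi(G)$ for $G\sim\mathcal D_{c,S}^{\mathsf N}$ is at most $\dfrac{1}{m^3}$. -/

import Mathlib

open MeasureTheory ProbabilityTheory

namespace NestedBlock

/-! ### Layered graphs -/

/-- The size of the `i`-th layer (indices start at `0`) prescribed by a sequence `T`. -/
def layer (T : List ℕ) (i : ℕ) : ℕ := T.getD i 0

/-- The number of edges of a matching between `Fin a` and `Fin b`. A matching is given as a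
partial bijection `f`; its edges are the pairs `(v, w)` with `f v = some w`. -/
def matchingSize {a b : ℕ} (f : Fin a ≃. Fin b) : ℕ :=
  (Finset.univ.filter fun v => (f v).isSome).card

/-- Matchings of size `min a b` between `Fin a` and `Fin b`. -/
def Matching (a b : ℕ) : Type := {f : Fin a ≃. Fin b // matchingSize f = min a b}

/-- A `T`-layered graph, for `T = (t₀, …, t_k)`: the layers are `V_i = Fin t_i`, `0 ≤ i ≤ k`, and
for `i < k` the entry with index `i` is the matching `E_{i+1}` between `V_i` and `V_{i+1}`. -/
def LayeredGraph (T : List ℕ) : Type :=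
  ∀ i : Fin (T.length - 1), Matching (layer T i) (layer T (i + 1))

/-- All sets of layered graphs are events (there are finitely many layered graphs). -/
instance (T : List ℕ) : MeasurableSpace (LayeredGraph T) := ⊤

/-- The map `G_{i → j}` for `i ≤ j`: it sends a vertex of layer `i` to the vertex of layer `j`
that it is connected to, and to `none` if there is no such vertex.
(For `j < i` the value is the empty map, and it is never used.) -/
def LayeredGraph.path {T : List ℕ} (G : LayeredGraph T) (i : ℕ) :
    (j : ℕ) → Fin (layer T i) ≃. Fin (layer T j)
  | 0 => if h : i = 0 then (finCongr (congrArg (layer T) h)).toPEquiv else ⊥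
  | j + 1 =>
    if h : i = j + 1 then (finCongr (congrArg (layer T) h)).toPEquiv
    else if hj : j < T.length - 1 then (G.path i j).trans (G ⟨j, hj⟩).1
    else ⊥

/-- `G` is nice: for all `i < j`, the number of vertices of layer `i` that are connected to layer
`j` is the minimum of the sizes of the layers `i, …, j`. -/
def LayeredGraph.Nice {T : List ℕ} (G : LayeredGraph T) : Prop :=
  ∀ i j : ℕ, ∀ hij : i < j, j ≤ T.length - 1 →
    matchingSize (G.path i j) =
      (Finset.Icc i j).inf' ⟨i, Finset.mem_Icc.2 ⟨le_rfl, hij.le⟩⟩ (layer T)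

/-! ### Nested block graphs -/

/-- `plug T c s` is `T` with `c` copies of `s` plugged between any two consecutive elements. -/
def plug : List ℕ → ℕ → ℕ → List ℕ
  | [], _, _ => []
  | [t], _, _ => [t]
  | t :: t' :: T, c, s => t :: (List.replicate c s ++ plug (t' :: T) c s)

/-- The sequence `nest(c, S)` for `S = (S 0, …, S k)`. -/
def nest (c : ℕ) : {k : ℕ} → (Fin (k + 1) → ℕ) → List ℕ
  | 0, S => [S 0, S 0]
  | k + 1, S => plug (nest c fun i : Fin (k + 1) => S i.castSucc) (2 * c - 1) (S (Fin.last (k + 1)))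

theorem plug_ne_nil {T : List ℕ} (hT : T ≠ []) (c s : ℕ) : plug T c s ≠ [] := by
  match T with
  | [] => exact absurd rfl hT
  | [t] => simp [plug]
  | t :: t' :: T => simp [plug]

theorem head?_plug (T : List ℕ) (c s : ℕ) : (plug T c s).head? = T.head? := by
  match T with
  | [] => rfl
  | [t] => rfl
  | t :: t' :: T => rfl

theorem getLast?_plug (T : List ℕ) (c s : ℕ) : (plug T c s).getLast? = T.getLast? := by
  match T with
  | [] => rfl
  | [t] => rfl
  | t :: t' :: T =>
    have ih := getLast?_plug (t' :: T) c s
    have hne : plug (t' :: T) c s ≠ [] := plug_ne_nil (by simp) c s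
    have hne' : List.replicate c s ++ plug (t' :: T) c s ≠ [] := by simp [hne]
    rw [plug, List.getLast?_cons_of_ne_nil hne', List.getLast?_append_of_ne_nil _ hne, ih,
      List.getLast?_cons_of_ne_nil (xs := t' :: T) (by simp)]

theorem head?_nest (c : ℕ) {k : ℕ} (S : Fin (k + 1) → ℕ) : (nest c S).head? = some (S 0) := by
  induction k with
  | zero => rfl
  | succ k ih => rw [nest, head?_plug, ih]; rfl

theorem getLast?_nest (c : ℕ) {k : ℕ} (S : Fin (k + 1) → ℕ) :
    (nest c S).getLast? = some (S 0) := by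
  induction k with
  | zero => rfl
  | succ k ih => rw [nest, getLast?_plug, ih]; rfl

/-- The index `ℓ` of the last layer of a `(c, S)`-nested block graph. -/
def lastLayer (c : ℕ) {k : ℕ} (S : Fin (k + 1) → ℕ) : ℕ := (nest c S).length - 1

theorem layer_nest_zero (c : ℕ) {k : ℕ} (S : Fin (k + 1) → ℕ) : layer (nest c S) 0 = S 0 := by
  have h := head?_nest c S
  rw [List.head?_eq_getElem?] at h
  simp [layer, List.getD_eq_getElem?_getD, h]

theorem layer_nest_last (c : ℕ) {k : ℕ} (S : Fin (k + 1) → ℕ) :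
    layer (nest c S) (lastLayer c S) = S 0 := by
  have h := getLast?_nest c S
  rw [List.getLast?_eq_getElem?] at h
  simp [layer, lastLayer, List.getD_eq_getElem?_getD, h]

/-- The final matching `G_{0 → ℓ}`, where the first and the last layer, which both have size
`s₁ = n`, are identified with `Fin n`. -/
def finalMatching {c k n : ℕ} {S : Fin (k + 1) → ℕ} (h : S 0 = n) (G : LayeredGraph (nest c S)) :
    Fin n ≃. Fin n :=
  (finCongr ((layer_nest_zero c S).trans h)).symm.toPEquiv.trans
    ((G.path 0 (lastLayer c S)).trans (finCongr ((layer_nest_last c S).trans h)).toPEquiv)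

/-- The distribution `D_{c,S}`: uniform over the `(c, S)`-nested block graphs, that is, over the
nice `nest(c, S)`-layered graphs. -/
noncomputable def nestedDist (c : ℕ) {k : ℕ} (S : Fin (k + 1) → ℕ) :
    Measure (LayeredGraph (nest c S)) :=
  uniformOn {G | G.Nice}

/-- The distribution `D_{c,S}^Z`: the distribution `D_{c,S}` conditioned on `G_{0 → ℓ} = Z`. -/
noncomputable def nestedDistCond (c : ℕ) {k n : ℕ} (S : Fin (k + 1) → ℕ) (h : S 0 = n)
    (Z : Equiv.Perm (Fin n)) : Measure (LayeredGraph (nest c S)) :=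
  (nestedDist c S)[|{G | finalMatching h G = Z.toPEquiv}]

/-- The sequence `m, m + ⌊m/r⌋, m + ⌊2m/r⌋, …, 2m`. -/
def fmtSeq (m r : ℕ) : Fin (r + 1) → ℕ := fun i => m + i * m / r

theorem fmtSeq_zero (m r : ℕ) : fmtSeq m r 0 = m := by simp [fmtSeq]

/-! ### Communication protocols -/

/-- The two players. -/
inductive Player
  | alice
  | bob

/-- Alice gets the matchings `E_i` with `i` even and Bob those with `i` odd. -/
def edgeOwner (i : ℕ) : Player := if Even i then .alice else .bob

/-- Alice sends the message of the odd rounds `1, 3, …` and Bob that of the even rounds. -/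
def speaker (j : ℕ) : Player := if Odd j then .alice else .bob

/-- After `r` rounds, Alice computes the output if `r` is even and Bob does if `r` is odd. -/
def outputPlayer (r : ℕ) : Player := if Even r then .alice else .bob

/-- The inputs of a player `p`: the matchings `E_{i+1}` that `p` owns. -/
def Input (T : List ℕ) (p : Player) : Type :=
  ∀ i : {i : Fin (T.length - 1) // edgeOwner (i + 1) = p},
    Matching (layer T i.1) (layer T (i.1 + 1))

/-- The part of a layered graph that a player sees. -/
def LayeredGraph.view {T : List ℕ} (G : LayeredGraph T) (p : Player) : Input T p := fun i => G i.1

/-- A deterministic `r`-round `T`-protocol with outputs in `O`. A message is a finite bit string,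
and a transcript is the list of all messages sent so far. The next message depends only on the
input of its sender and on the transcript so far, and the output depends only on the input of the
player who computes it and on the final transcript. -/
structure Protocol (T : List ℕ) (r : ℕ) (O : Type*) where
  msg : (p : Player) → Input T p → List (List Bool) → List Bool
  out : Input T (outputPlayer r) → List (List Bool) → O

namespace Protocol

variable {T : List ℕ} {r : ℕ} {O : Type*}

/-- The transcript after a given number of rounds. -/
def transcript (P : Protocol T r O) (G : LayeredGraph T) : ℕ → List (List Bool)
  | 0 => []
  | j + 1 => P.transcript G j ++ [P.msg (speaker (j + 1)) (G.view _) (P.transcript G j)]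

/-- The output `π(G)`. -/
def output (P : Protocol T r O) (G : LayeredGraph T) : O :=
  P.out (G.view _) (P.transcript G r)

/-- The total number of bits communicated in the `r` rounds on input `G`. -/
def bits (P : Protocol T r O) (G : LayeredGraph T) : ℕ :=
  ((P.transcript G r).map List.length).sum

end Protocol

/-- A randomized `r`-round `T`-protocol: a deterministic protocol for every outcome `ω` of the
coins, which are drawn from a probability space. An outcome may comprise public coins and private
coins of either player. -/
structure RandProtocol (T : List ℕ) (r : ℕ) (O Ω : Type*) [MeasurableSpace O]
    [MeasurableSpace Ω] where
  coins : Measure Ω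
  isProb : IsProbabilityMeasure coins
  det : Ω → Protocol T r O
  measurable_output : ∀ G, Measurable fun ω => (det ω).output G

namespace RandProtocol

variable {T : List ℕ} {r : ℕ} {O Ω : Type*} [MeasurableSpace O] [MeasurableSpace Ω]

/-- The communication cost, which is the worst-case number of bits communicated over all inputs
and all outcomes of the coins, is at most `B`. -/
def CostAtMost (P : RandProtocol T r O Ω) (B : ℝ) : Prop :=
  ∀ (ω : Ω) (G : LayeredGraph T), ((P.det ω).bits G : ℝ) ≤ B

/-- The distribution of the output on a random graph `G ∼ D` that is independent of the coins. -/
noncomputable def outputDist (P : RandProtocol T r O Ω) (D : Measure (LayeredGraph T)) :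
    Measure O :=
  (D.prod P.coins).map fun x => (P.det x.2).output x.1

end RandProtocol

/-- The total variation distance of two probability measures: the supremum of `μ(A) - ν(A)` over
all events `A`. -/
noncomputable def tvDist {O : Type*} [MeasurableSpace O] (μ ν : Measure O) : ℝ :=
  ⨆ A : {A : Set O // MeasurableSet A}, (μ.real A.1 - ν.real A.1)

end NestedBlock

open NestedBlock

namespace NestedBlock

open Finset
open scoped BigOperators

/-! Edge layers are represented by permutations. A graph with final matching `Z` grows out of the
single permutation `Z`: at each nesting, every permutation `h` of level `k` is replaced by `2c`
permutations of the larger set `Fin (S (k + 1))`, uniform among those whose product agrees with `h`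
at the points where `h` stands for an edge (`levelDist`). Inside every block the players alternate:
Bob owns the factors `α`, Alice the factors `β`.

Hiding. The constrained points of a block miss at least `g = ⌊m/r⌋` points of the larger set.
Therefore a short message about `α`, even seen together with all of `β`, is distributed almost as if
`α` and `β` were independent, whatever `h` is. The core is `single_walker`, which follows one point
through the block. For independent `α`, `α'` and a common random `β`, the probability that the two
walkers meet exceeds `1/n` by at most a product of terms `|agree - 1| / (n - 1)`
(`expect_collision`). The number of agreements of two random permutations has `p`-th moments of
order `(4p)^p`, so for messages of about `p` bits a second-moment argument gives an error governed
by `(4p/n)^k`. `hiding_word` adds the constrained points one at a time, passing each time to the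
symmetric group of the remaining points.

Round elimination (`indist_step`). By hiding, the first message and the listener's halves of the
blocks of the speaker's layers can be drawn publicly, without knowing those layers; the speaker
completes these blocks by sampling from a posterior. In the blocks of the listener's layers, the
speaker's halves are uniform and public, and the listener completes them. So a protocol on level `k
+ 1` yields one on level `k` with one round less, in which the other player starts. `level_indist`
iterates this down to a single layer, where no round is left and the player who must answer sees
nothing.

Transfer to graphs. `levelDist` is constant on the tuples that represent nice graphs with final
matching `Z` (`exists_levelDist_eq`, based on `niceMaps_contract`), and all graphs have equally many
representatives (`exists_card_fiber`). Hence it induces the required conditional distribution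
(`nestedDistCond_spec`), and `sum_error_le` adds up the errors. -/

/-! ### Abstract communication games -/

/-- `F` is computed by `ρ` rounds of communication with messages in `Λ`. The player holding the
first argument speaks first, and the player whose turn it would be after `ρ` rounds outputs a
number in `[0, 1]`. -/
def Prot (Λ : Type) : ℕ → ∀ {X Y : Type}, (X → Y → ℝ) → Prop
  | 0, X, _, F => ∃ φ : X → ℝ, (∀ x, 0 ≤ φ x ∧ φ x ≤ 1) ∧ ∀ x y, F x y = φ x
  | ρ + 1, X, Y, F => ∃ (M : X → Λ) (F' : Λ → Y → X → ℝ),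
      (∀ μ, Prot Λ ρ (F' μ)) ∧ ∀ x y, F x y = F' (M x) y x

theorem Prot.mem_Icc {Λ : Type} {ρ : ℕ} {X Y : Type} {F : X → Y → ℝ} (hF : Prot Λ ρ F)
    (x : X) (y : Y) : 0 ≤ F x y ∧ F x y ≤ 1 := by
  induction ρ generalizing X Y with
  | zero => obtain ⟨φ, h, h'⟩ := hF; rw [h']; exact h x
  | succ ρ ih => obtain ⟨M, F', h, h'⟩ := hF; rw [h']; exact ih (h _) y x

theorem Prot.comp {Λ : Type} {ρ : ℕ} {X Y X' Y' : Type} {F : X → Y → ℝ} (hF : Prot Λ ρ F)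
    (f : X' → X) (g : Y' → Y) : Prot Λ ρ fun x y => F (f x) (g y) := by
  induction ρ generalizing X Y X' Y' with
  | zero =>
    obtain ⟨φ, h, h'⟩ := hF
    exact ⟨fun x => φ (f x), fun x => h _, fun x y => h' _ _⟩
  | succ ρ ih =>
    obtain ⟨M, F', h, hFM⟩ := hF
    exact ⟨fun x => M (f x), fun μ y x => F' μ (g y) (f x), fun μ => ih (h μ) g f,
      fun x y => hFM _ _⟩

/-- No `ρ`-round function has a large correlation with the signed weight `W`. -/
def Indist (Λ : Type) (ρ : ℕ) {X Y : Type} [Fintype X] [Fintype Y] (W : X → Y → ℝ) (δ : ℝ) :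
    Prop :=
  ∀ F : X → Y → ℝ, Prot Λ ρ F → ∑ x, ∑ y, W x y * F x y ≤ δ

/-- Given `h`, the pair `(x, y)` has the law `K h`. A message computed from `x` together with `y`
is nearly distributed as if `x` and `y` were independent and uniform, whatever `h` is. -/
def Hides (Λ : Type) {A X Y : Type} [Fintype X] [Fintype Y] (K : A → X → Y → ℝ) (δ : ℝ) : Prop :=
  ∀ (h : A) (M : X → Λ) (φ : Λ → Y → ℝ), (∀ μ y, 0 ≤ φ μ y ∧ φ μ y ≤ 1) →
    |∑ x, ∑ y, K h x y * φ (M x) y - 𝔼 x, 𝔼 y, φ (M x) y| ≤ δ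

/-- Derandomisation: replacing a random choice by the best one for each input can only increase the
average. -/
theorem exists_sum_kernel_le {A X : Type} [Fintype A] [Fintype X] [Nonempty X]
    (κ : A → X → ℝ) (h0 : ∀ a x, 0 ≤ κ a x) (h1 : ∀ a, ∑ x, κ a x = 1) (c : A → X → ℝ) :
    ∃ f : A → X, ∑ a, ∑ x, κ a x * c a x ≤ ∑ a, c a (f a) := by
  choose f hf using fun a => Finite.exists_max (c a)
  refine ⟨f, sum_le_sum fun a _ => ?_⟩
  calc ∑ x, κ a x * c a x ≤ ∑ x, κ a x * c a (f a) :=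
        sum_le_sum fun x _ => mul_le_mul_of_nonneg_left (hf a x) (h0 a x)
    _ = c a (f a) := by rw [← sum_mul, h1, one_mul]

-- `κ μ` is the conditional law of `x` given the message `μ` under the weight `k`, and resampling
-- `x` from it does not change joint sums with the message. For messages of weight zero it is set to
-- the uniform law, only to keep it a probability law.
open Classical in
theorem exists_posterior {X Λ : Type} [Fintype X] [Nonempty X] (k : X → ℝ)
    (hk : ∀ x, 0 ≤ k x) (M : X → Λ) :
    ∃ κ : Λ → X → ℝ, (∀ μ x, 0 ≤ κ μ x) ∧ (∀ μ, ∑ x, κ μ x = 1) ∧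
      ∀ g : Λ → X → ℝ, ∑ x, k x * ∑ x', κ (M x) x' * g (M x) x' = ∑ x, k x * g (M x) x := by
  set P : Λ → ℝ := fun μ => ∑ x, if M x = μ then k x else 0 with hP
  have hnn : ∀ μ x, 0 ≤ if M x = μ then k x else 0 := fun μ x => by
    split_ifs; exacts [hk x, le_rfl]
  set κ : Λ → X → ℝ := fun μ x => if P μ = 0 then (Fintype.card X : ℝ)⁻¹
    else (if M x = μ then k x else 0) / P μ with hκ
  have key : ∀ μ x, P μ * κ μ x = if M x = μ then k x else 0 := by
    intro μ x
    by_cases h : P μ = 0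
    · have := (sum_eq_zero_iff_of_nonneg fun x _ => hnn μ x).1 h x (mem_univ x)
      rw [h, this, zero_mul]
    · simp only [hκ, if_neg h]; field_simp
  refine ⟨κ, fun μ x => ?_, fun μ => ?_, fun g => ?_⟩
  · simp only [hκ]
    split_ifs
    · positivity
    · exact div_nonneg (hk x) (sum_nonneg fun x _ => hnn μ x)
    · simp
  · by_cases h : P μ = 0
    · simp [hκ, h]
    · simp only [hκ, if_neg h, ← sum_div]; exact div_self h
  · have hfin : ∀ f : Λ → X → ℝ, ∑ x, k x * f (M x) x
        = ∑ μ ∈ univ.image M, ∑ x, (if M x = μ then k x else 0) * f μ x := by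
      intro f
      rw [sum_comm]
      refine sum_congr rfl fun x _ => ?_
      rw [sum_eq_single (M x)]
      · simp
      · intro b _ hb; simp [Ne.symm hb]
      · simp
    rw [hfin g, hfin fun μ _ => ∑ x', κ μ x' * g μ x']
    refine sum_congr rfl fun μ _ => ?_
    rw [← sum_mul]
    change P μ * _ = _
    rw [mul_sum]
    exact sum_congr rfl fun x _ => by rw [← mul_assoc, key]

theorem abs_expect_le_of_forall {ι : Type} (s : Finset ι) {f : ι → ℝ} {δ : ℝ} (hδ : 0 ≤ δ)
    (h : ∀ i ∈ s, |f i| ≤ δ) : |𝔼 i ∈ s, f i| ≤ δ := by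
  rcases s.eq_empty_or_nonempty with rfl | hs
  · simpa
  · refine (Finset.abs_expect_le _ _).trans (expect_le hs h)

theorem expect_mem_Icc {ι : Type} (s : Finset ι) {f : ι → ℝ}
    (h : ∀ i ∈ s, 0 ≤ f i ∧ f i ≤ 1) : 0 ≤ 𝔼 i ∈ s, f i ∧ 𝔼 i ∈ s, f i ≤ 1 := by
  rcases s.eq_empty_or_nonempty with rfl | hs
  · simp
  · exact ⟨expect_nonneg fun i hi => (h i hi).1, expect_le hs fun i hi => (h i hi).2⟩

theorem kernel_mem_Icc {X : Type} [Fintype X] {κ f : X → ℝ} (h0 : ∀ x, 0 ≤ κ x)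
    (h1 : ∑ x, κ x = 1) (hf : ∀ x, 0 ≤ f x ∧ f x ≤ 1) :
    0 ≤ ∑ x, κ x * f x ∧ ∑ x, κ x * f x ≤ 1 := by
  refine ⟨sum_nonneg fun x _ => mul_nonneg (h0 x) (hf x).1, ?_⟩
  calc ∑ x, κ x * f x ≤ ∑ x, κ x :=
        sum_le_sum fun x _ => mul_le_of_le_one_right (h0 x) (hf x).2
    _ = 1 := h1

/-- Elimination of the first round. -/
theorem indist_step {Λ A B X₁ X₂ Y₁ Y₂ : Type} [Fintype A] [Fintype B] [Fintype X₁]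
    [Fintype X₂] [Fintype Y₁] [Fintype Y₂] [Nonempty X₁] [Nonempty X₂] [Nonempty Y₁]
    [Nonempty Y₂] {ρ : ℕ} {D D' : A → B → ℝ} {δ ε : ℝ}
    (hD0 : ∀ h h', 0 ≤ D h h') (hD1 : ∑ h, ∑ h', D h h' = 1)
    (hD0' : ∀ h h', 0 ≤ D' h h') (hD1' : ∑ h, ∑ h', D' h h' = 1)
    (K₁ : A → X₁ → Y₁ → ℝ) (hK₁ : ∀ h x y, 0 ≤ K₁ h x y) (hide : Hides Λ K₁ ε)
    (K₂ : B → X₂ → Y₂ → ℝ) (hK₂ : ∀ h x y, 0 ≤ K₂ h x y)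
    (hK₂' : ∀ h x, ∑ y, K₂ h x y = (Fintype.card X₂ : ℝ)⁻¹)
    (hI : Indist Λ ρ (fun h' h => D h h' - D' h h') δ)
    (F : X₁ × X₂ → Y₁ × Y₂ → ℝ) (hF : Prot Λ (ρ + 1) F) :
    ∑ h, ∑ h', (D h h' - D' h h') * ∑ x₁, ∑ y₁, K₁ h x₁ y₁ * ∑ x₂, ∑ y₂, K₂ h' x₂ y₂ *
      F (x₁, x₂) (y₁, y₂) ≤ δ + 2 * ε := by
  obtain ⟨M, F', hF', hFF⟩ := hF
  -- How the holder of `h` resamples `x₁` from the public `y₁`, `x₂` and the message.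
  choose κ κ0 κ1 κg using fun (h : A) (y₁ : Y₁) (x₂ : X₂) =>
    exists_posterior (fun x₁ => K₁ h x₁ y₁) (fun x₁ => hK₁ h x₁ y₁) (fun x₁ => M (x₁, x₂))
  -- Under `K₂ h'` the marginal of `x₂` is uniform, so this is the conditional law of `y₂` given
  -- `x₂`.
  set κ₂ : B → X₂ → Y₂ → ℝ := fun h' x₂ y₂ => Fintype.card X₂ * K₂ h' x₂ y₂ with hκ₂
  have hcard : (Fintype.card X₂ : ℝ) ≠ 0 := by simp
  have κ₂0 : ∀ h' x y, 0 ≤ κ₂ h' x y := fun h' x y => mul_nonneg (by positivity) (hK₂ _ _ _)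
  have κ₂1 : ∀ h' x, ∑ y, κ₂ h' x y = 1 := fun h' x => by
    simp only [hκ₂]; rw [← mul_sum, hK₂', mul_inv_cancel₀ hcard]
  -- the simulated value
  let φ : A → B → X₂ → Λ → Y₁ → ℝ := fun h h' x₂ μ y₁ =>
    ∑ x₁, κ h y₁ x₂ μ x₁ * ∑ y₂, κ₂ h' x₂ y₂ * F' μ (y₁, y₂) (x₁, x₂)
  have hφ : ∀ h h' x₂ μ y₁, 0 ≤ φ h h' x₂ μ y₁ ∧ φ h h' x₂ μ y₁ ≤ 1 := fun h h' x₂ μ y₁ =>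
    kernel_mem_Icc (κ0 h y₁ x₂ μ) (κ1 h y₁ x₂ μ) fun x₁ =>
      kernel_mem_Icc (κ₂0 h' x₂) (κ₂1 h' x₂) fun y₂ => (hF' μ).mem_Icc _ _
  let G : A → B → ℝ := fun h h' => ∑ x₁, ∑ y₁, K₁ h x₁ y₁ * ∑ x₂, ∑ y₂, K₂ h' x₂ y₂ *
      F (x₁, x₂) (y₁, y₂)
  -- `G` is the value of the real game. In `G'` the public data `x₂`, `y₁` and the message, computed
  -- from a fresh uniform `x₁`, are drawn without regard to `h` and `h'`.
  let G' : A → B → ℝ := fun h h' => 𝔼 x₂, 𝔼 x₁, 𝔼 y₁, φ h h' x₂ (M (x₁, x₂)) y₁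
  have hG : ∀ h h', G h h' = 𝔼 x₂, ∑ x₁, ∑ y₁, K₁ h x₁ y₁ * φ h h' x₂ (M (x₁, x₂)) y₁ := by
    intro h h'
    have e1 : ∀ x₂, ∑ x₁, ∑ y₁, K₁ h x₁ y₁ * φ h h' x₂ (M (x₁, x₂)) y₁
        = ∑ x₁, ∑ y₁, K₁ h x₁ y₁ * ∑ y₂, κ₂ h' x₂ y₂ * F (x₁, x₂) (y₁, y₂) := by
      intro x₂
      rw [sum_comm]
      conv_rhs => rw [sum_comm]
      refine sum_congr rfl fun y₁ _ => ?_
      simp only [hFF]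
      exact κg h y₁ x₂ fun μ x₁ => ∑ y₂, κ₂ h' x₂ y₂ * F' μ (y₁, y₂) (x₁, x₂)
    simp only [e1]
    rw [expect_sum_comm]
    refine sum_congr rfl fun x₁ _ => ?_
    rw [expect_sum_comm]
    refine sum_congr rfl fun y₁ _ => ?_
    rw [← mul_expect, Fintype.expect_eq_sum_div_card, sum_div]
    congr 1
    refine sum_congr rfl fun x₂ _ => ?_
    rw [sum_div]
    refine sum_congr rfl fun y₂ _ => ?_
    simp only [hκ₂]
    field_simp
  have hε : 0 ≤ ε := by
    rcases isEmpty_or_nonempty A with hA | ⟨⟨h⟩⟩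
    · simp at hD1
    · obtain ⟨x₂⟩ := ‹Nonempty X₂›
      exact (abs_nonneg _).trans (hide h (fun x => M (x, x₂)) (fun _ _ => 0) (by simp))
  have hGG : ∀ h h', |G h h' - G' h h'| ≤ ε := by
    intro h h'
    rw [hG, ← expect_sub_distrib]
    exact abs_expect_le_of_forall _ hε fun x₂ _ => hide h _ _ (hφ h h' x₂)
  have hG' : ∑ h, ∑ h', (D h h' - D' h h') * G' h h' ≤ δ := by
    have e : ∑ h, ∑ h', (D h h' - D' h h') * G' h h'
        = 𝔼 x₂, 𝔼 x₁, 𝔼 y₁, ∑ h, ∑ h', (D h h' - D' h h') * φ h h' x₂ (M (x₁, x₂)) y₁ := by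
      simp only [G', mul_expect, expect_sum_comm]
    rw [e]
    refine expect_le univ_nonempty fun x₂ _ => expect_le univ_nonempty fun x₁ _ =>
      expect_le univ_nonempty fun y₁ _ => ?_
    set μ := M (x₁, x₂)
    -- With the public data frozen, the private resampling of the two players is derandomised in
    -- turn. What remains is a `ρ`-round game in which the holder of `h'` speaks first.
    obtain ⟨f, hf⟩ := exists_sum_kernel_le (fun h x₁ => κ h y₁ x₂ μ x₁)
      (fun h => κ0 h y₁ x₂ μ) (fun h => κ1 h y₁ x₂ μ)
      (fun h x₁ => ∑ h', (D h h' - D' h h') * ∑ y₂, κ₂ h' x₂ y₂ * F' μ (y₁, y₂) (x₁, x₂))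
    obtain ⟨g, hg⟩ := exists_sum_kernel_le (fun h' y₂ => κ₂ h' x₂ y₂)
      (fun h' => κ₂0 h' x₂) (fun h' => κ₂1 h' x₂)
      (fun h' y₂ => ∑ h, (D h h' - D' h h') * F' μ (y₁, y₂) (f h, x₂))
    refine le_trans (le_of_eq ?_) (hf.trans (le_trans (le_of_eq ?_) (hg.trans ?_)))
    · refine sum_congr rfl fun h _ => ?_
      simp only [φ, mul_sum]
      rw [sum_comm]
      refine sum_congr rfl fun x₁ _ => sum_congr rfl fun h' _ => sum_congr rfl fun y₂ _ => ?_
      ring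
    · rw [sum_comm]
      refine sum_congr rfl fun h' _ => ?_
      simp only [mul_sum]
      rw [sum_comm]
      refine sum_congr rfl fun y₂ _ => sum_congr rfl fun h _ => ?_
      ring
    · exact hI _ ((hF' μ).comp (fun h' => (y₁, g h')) (fun h => (f h, x₂)))
  -- The error of passing from `G` to `G'` is paid once under `D` and once under `D'`, whence `2 *
  -- ε`.
  have hsplit : ∀ h h', (D h h' - D' h h') * G h h'
      ≤ (D h h' - D' h h') * G' h h' + ε * D h h' + ε * D' h h' := by
    intro h h'
    have := abs_le.1 (hGG h h')
    nlinarith [hD0 h h', hD0' h h']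
  calc ∑ h, ∑ h', (D h h' - D' h h') * G h h'
      ≤ ∑ h, ∑ h', ((D h h' - D' h h') * G' h h' + ε * D h h' + ε * D' h h') :=
        sum_le_sum fun h _ => sum_le_sum fun h' _ => hsplit h h'
    _ = ∑ h, ∑ h', (D h h' - D' h h') * G' h h' + ε * 1 + ε * 1 := by
        simp only [sum_add_distrib, ← mul_sum, hD1, hD1']
    _ ≤ δ + 2 * ε := by linarith

theorem sum_sum_prod_pi {ι X Y : Type} [Fintype ι] [DecidableEq ι] [Fintype X] [Fintype Y]
    (g : ι → X → Y → ℝ) :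
    ∑ x : ι → X, ∑ y : ι → Y, ∏ i, g i (x i) (y i) = ∏ i, ∑ x, ∑ y, g i x y := by
  rw [prod_univ_sum, Fintype.piFinset_univ]
  refine sum_congr rfl fun x _ => ?_
  rw [prod_univ_sum, Fintype.piFinset_univ]

theorem sum_prod_pi {ι Y : Type} [Fintype ι] [DecidableEq ι] [Fintype Y] (g : ι → Y → ℝ) :
    ∑ y : ι → Y, ∏ i, g i (y i) = ∏ i, ∑ y, g i y := by
  rw [prod_univ_sum, Fintype.piFinset_univ]

theorem sum_funSplitAt {ι X : Type} [Fintype ι] [DecidableEq ι] [Fintype X] (i : ι)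
    (f : (ι → X) → ℝ) :
    ∑ x, f x = ∑ t : X, ∑ u : ({j // j ≠ i} → X), f ((Equiv.funSplitAt i X).symm (t, u)) := by
  rw [← Fintype.sum_prod_type', ← (Equiv.funSplitAt i X).symm.sum_comp]

/-- Hybrid argument: the kernels are replaced by the uniform law one coordinate at a time (`J s` is
uniform on `s`). With the other coordinates frozen, each replacement is an instance of `hide`. -/
theorem hides_pi {Λ ι A X Y : Type} [Fintype ι] [DecidableEq ι] [Fintype X] [Fintype Y] [Nonempty X]
    [Nonempty Y]
    (K : ι → A → X → Y → ℝ) (hK0 : ∀ i h x y, 0 ≤ K i h x y)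
    (hK1 : ∀ i h, ∑ x, ∑ y, K i h x y = 1) {δ : ℝ} (hide : ∀ i, Hides Λ (K i) δ) :
    Hides Λ (fun (h : ι → A) (x : ι → X) (y : ι → Y) => ∏ i, K i (h i) (x i) (y i))
      (Fintype.card ι * δ) := by
  intro h M φ hφ
  set u : ℝ := (Fintype.card X : ℝ)⁻¹ * (Fintype.card Y : ℝ)⁻¹ with hu
  have hu0 : 0 ≤ u := by positivity
  have hX : (Fintype.card X : ℝ) ≠ 0 := by simp
  have hY : (Fintype.card Y : ℝ) ≠ 0 := by simp
  let J : Finset ι → ι → X → Y → ℝ := fun s i x y => if i ∈ s then u else K i (h i) x y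
  have hJ0 : ∀ s i x y, 0 ≤ J s i x y := fun s i x y => by
    simp only [J]; split_ifs; exacts [hu0, hK0 _ _ _ _]
  have hJ1 : ∀ s i, ∑ x, ∑ y, J s i x y = 1 := fun s i => by
    simp only [J]; split_ifs
    · simp only [sum_const, card_univ, nsmul_eq_mul, hu]; field_simp
    · exact hK1 _ _
  let V : Finset ι → ℝ := fun s => ∑ x : ι → X, ∑ y : ι → Y, (∏ i, J s i (x i) (y i)) * φ (M x) y
  have hstep : ∀ s i, i ∉ s → |V s - V (insert i s)| ≤ δ := by
    intro s i hi
    let R : ({j // j ≠ i} → X) → ({j // j ≠ i} → Y) → ℝ := fun x y =>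
      ∏ j : {j // j ≠ i}, J s j (x j) (y j)
    have hR0 : ∀ x y, 0 ≤ R x y := fun x y => prod_nonneg fun j _ => hJ0 _ _ _ _
    have hR1 : ∑ x, ∑ y, R x y = 1 := by
      simp only [R]
      rw [sum_sum_prod_pi (fun (j : {j // j ≠ i}) => J s j)]
      simp [hJ1]
    have hprod : ∀ s' : Finset ι, (∀ j, j ≠ i → (j ∈ s' ↔ j ∈ s)) → ∀ t x' v y',
        ∏ j, J s' j ((Equiv.funSplitAt i X).symm (t, x') j) ((Equiv.funSplitAt i Y).symm (v, y') j)
          = J s' i t v * R x' y' := by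
      intro s' hs' t x' v y'
      rw [← mul_prod_erase univ _ (mem_univ i)]
      congr 1
      · simp [Equiv.funSplitAt, Equiv.piSplitAt]
      · simp only [R]
        rw [prod_subtype (univ.erase i) (p := fun j => j ≠ i) (by simp)]
        refine prod_congr rfl fun j _ => ?_
        have : J s' j = J s j := by
          ext x y
          simp only [J, hs' j j.2]
        rw [this]
        simp [Equiv.funSplitAt, Equiv.piSplitAt, j.2]
    have hV : ∀ s' : Finset ι, (∀ j, j ≠ i → (j ∈ s' ↔ j ∈ s)) → V s' = ∑ x', ∑ y', R x' y' *
        ∑ t, ∑ v, J s' i t v * φ (M ((Equiv.funSplitAt i X).symm (t, x')))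
          ((Equiv.funSplitAt i Y).symm (v, y')) := by
      intro s' hs'
      simp only [V]
      rw [sum_funSplitAt i, sum_comm]
      refine sum_congr rfl fun x' _ => ?_
      rw [sum_congr rfl fun t _ => sum_funSplitAt (X := Y) i _]
      simp only [hprod s' hs', mul_sum]
      rw [sum_congr rfl fun t _ => sum_comm, sum_comm]
      refine sum_congr rfl fun y' _ => sum_congr rfl fun t _ => sum_congr rfl fun v _ => by ring
    rw [hV s (fun _ _ => Iff.rfl), hV (insert i s) (fun j hj => by simp [hj]), ← sum_sub_distrib]
    calc |∑ x', (∑ y', R x' y' * _ - ∑ y', R x' y' * _)|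
        ≤ ∑ x', ∑ y', R x' y' * δ := by
          refine (abs_sum_le_sum_abs _ _).trans (sum_le_sum fun x' _ => ?_)
          rw [← sum_sub_distrib]
          refine (abs_sum_le_sum_abs _ _).trans (sum_le_sum fun y' _ => ?_)
          rw [← mul_sub, abs_mul, abs_of_nonneg (hR0 _ _)]
          refine mul_le_mul_of_nonneg_left ?_ (hR0 _ _)
          have := hide i (h i) (fun t => M ((Equiv.funSplitAt i X).symm (t, x')))
            (fun μ v => φ μ ((Equiv.funSplitAt i Y).symm (v, y'))) (fun μ v => hφ _ _)
          have e1 : J s i = K i (h i) := by ext x y; simp [J, hi]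
          have e2 : J (insert i s) i = fun _ _ => u := by ext x y; simp [J]
          rw [e1, e2]
          refine le_of_eq_of_le (congrArg _ (congrArg _ ?_)) this
          simp only [Fintype.expect_eq_sum_div_card, sum_div, hu]
          refine sum_congr rfl fun x _ => sum_congr rfl fun y _ => ?_
          field_simp
      _ = δ := by simp only [← sum_mul, hR1, one_mul]
  have hall : ∀ s : Finset ι, |V ∅ - V s| ≤ s.card * δ := by
    intro s
    induction s using Finset.induction_on with
    | empty => simp
    | insert i s hi ih =>
      rw [card_insert_of_notMem hi]
      push_cast
      have := hstep s i hi
      calc |V ∅ - V (insert i s)| ≤ |V ∅ - V s| + |V s - V (insert i s)| := abs_sub_le _ _ _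
        _ ≤ _ := by linarith
  have := hall univ
  have e1 : J ∅ = fun i => K i (h i) := by ext i x y; simp [J]
  have e2 : J univ = fun _ _ _ => u := by ext i x y; simp [J]
  rw [card_univ] at this
  simp only [V, e1, e2] at this
  refine le_of_eq_of_le (congrArg _ (congrArg _ ?_)) this
  · simp only [prod_const, hu, Fintype.expect_eq_sum_div_card, sum_div,
      card_univ, Fintype.card_fun]
    refine sum_congr rfl fun x _ => sum_congr rfl fun y _ => ?_
    push_cast
    rw [mul_pow, inv_pow, inv_pow]
    field_simp

/-! ### Alternating words in permutations -/

section Words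

variable {G : Type} [Group G]

/-- The product `β_{k-1} α_{k-1} ⋯ β_0 α_0`. -/
def altWord : (k : ℕ) → (Fin k → G) → (Fin k → G) → G
  | 0, _, _ => 1
  | k + 1, α, β => β (Fin.last k) * α (Fin.last k) *
      altWord k (fun j => α j.castSucc) (fun j => β j.castSucc)

/-- The product `α_k β_{k-1} α_{k-1} ⋯ β_0 α_0`. -/
def oddWord (k : ℕ) (α : Fin (k + 1) → G) (β : Fin k → G) : G :=
  α (Fin.last k) * altWord k (fun j => α j.castSucc) β

theorem oddWord_zero (α : Fin 1 → G) (β : Fin 0 → G) : oddWord 0 α β = α 0 := by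
  simp [oddWord, altWord]

theorem oddWord_succ (k : ℕ) (α : Fin (k + 2) → G) (β : Fin (k + 1) → G) :
    oddWord (k + 1) α β = α (Fin.last (k + 1)) * β (Fin.last k) *
      oddWord k (fun j => α j.castSucc) (fun j => β j.castSucc) := by
  simp [oddWord, altWord, mul_assoc]

theorem altWord_succ (k : ℕ) (α β : Fin (k + 1) → G) :
    altWord (k + 1) α β = β (Fin.last k) * oddWord k α fun j => β j.castSucc := by
  simp [oddWord, altWord, mul_assoc]

theorem altWord_succ_left (k : ℕ) (α β : Fin (k + 1) → G) :
    altWord (k + 1) α β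
      = altWord k (fun j => α j.succ) (fun j => β j.succ) * (β 0 * α 0) := by
  induction k with
  | zero => simp [altWord]
  | succ k ih =>
    rw [altWord, ih, altWord]
    simp [mul_assoc]

theorem inv_altWord (k : ℕ) (α β : Fin k → G) :
    (altWord k α β)⁻¹ = altWord k (fun j => (β j.rev)⁻¹) (fun j => (α j.rev)⁻¹) := by
  induction k with
  | zero => simp [altWord]
  | succ k ih =>
    rw [altWord, altWord_succ_left, mul_inv_rev, ih]
    simp [Fin.rev_succ]

theorem map_oddWord {H : Type} [Group H] (f : G →* H) (k : ℕ) (α : Fin (k + 1) → G)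
    (β : Fin k → G) :
    f (oddWord k α β) = oddWord k (fun j => f (α j)) (fun j => f (β j)) := by
  induction k with
  | zero => simp [oddWord_zero]
  | succ k ih => rw [oddWord_succ, oddWord_succ, map_mul, map_mul, ih]

/-- Change of variables in the letters `α`. -/
def twistα {k : ℕ} (P : Fin (k + 1) → G) (Q : Fin k → G) (a : Fin (k + 1) → G) : Fin (k + 1) → G :=
  Fin.cases (P 0 * a 0) fun j => P j.succ * a j.succ * (Q j)⁻¹

/-- Change of variables in the letters `β`. -/
def twistβ {k : ℕ} (P : Fin (k + 1) → G) (Q : Fin k → G) (b : Fin k → G) : Fin k → G :=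
  fun j => Q j * b j * (P j.castSucc)⁻¹

/-- The factors `P j` and `Q j` meet their inverses in neighbouring letters, so the word telescopes
and only the last `P` survives. -/
theorem oddWord_twist (k : ℕ) (P : Fin (k + 1) → G) (Q : Fin k → G) (a : Fin (k + 1) → G)
    (b : Fin k → G) :
    oddWord k (twistα P Q a) (twistβ P Q b) = P (Fin.last k) * oddWord k a b := by
  induction k with
  | zero => simp [oddWord_zero, twistα]
  | succ k ih =>
    have e1 : (fun j : Fin (k + 1) => twistα P Q a j.castSucc)
        = twistα (fun j => P j.castSucc) (fun j => Q j.castSucc) (fun j => a j.castSucc) := by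
      funext j
      refine Fin.cases ?_ (fun j => ?_) j
      · simp [twistα]
      · rw [← Fin.succ_castSucc]; simp [twistα]
    have e2 : (fun j : Fin k => twistβ P Q b j.castSucc)
        = twistβ (fun j => P j.castSucc) (fun j => Q j.castSucc) (fun j => b j.castSucc) := rfl
    rw [oddWord_succ, e1, e2, ih, oddWord_succ, ← Fin.succ_last]
    simp only [twistα, twistβ, Fin.cases_succ]
    group

/-- For fixed `a` and `b` one recovers `P 0`, `Q 0`, `P 1`, … in this order. -/
theorem twist_bijective [Finite G] {k : ℕ} (a : Fin (k + 1) → G) (b : Fin k → G) :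
    Function.Bijective fun PQ : (Fin (k + 1) → G) × (Fin k → G) =>
      (twistα PQ.1 PQ.2 a, twistβ PQ.1 PQ.2 b) := by
  refine Function.Injective.bijective_of_finite ?_
  rintro ⟨P, Q⟩ ⟨P', Q'⟩ h
  simp only [Prod.mk.injEq] at h
  obtain ⟨h1, h2⟩ := h
  have hQ : ∀ j : Fin k, P j.castSucc = P' j.castSucc → Q j = Q' j := by
    intro j hj
    have := congrFun h2 j
    simp only [twistβ, hj] at this
    exact mul_right_cancel (mul_right_cancel this)
  have hP : ∀ j, P j = P' j := by
    intro j
    induction j using Fin.induction with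
    | zero =>
      have := congrFun h1 0
      simp only [twistα, Fin.cases_zero] at this
      exact mul_right_cancel this
    | succ j ih =>
      have := congrFun h1 j.succ
      simp only [twistα, Fin.cases_succ, hQ j ih] at this
      exact mul_right_cancel (mul_right_cancel this)
  exact Prod.ext (funext hP) (funext fun j => hQ j (hP _))

/-- Any fixed `a`, `b` can be planted inside uniform letters. Averaging over `a`, `b` from a
subgroup then exhibits a walk in that subgroup. -/
theorem expect_twist [Fintype G] {k : ℕ} (a : Fin (k + 1) → G) (b : Fin k → G)
    (F : (Fin (k + 1) → G) → (Fin k → G) → ℝ) :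
    𝔼 α, 𝔼 β, F α β = 𝔼 P, 𝔼 Q, F (twistα P Q a) (twistβ P Q b) := by
  have h := Fintype.expect_bijective _ (twist_bijective a b)
    (fun PQ => F (twistα PQ.1 PQ.2 a) (twistβ PQ.1 PQ.2 b)) (fun x => F x.1 x.2) fun _ => rfl
  rw [← univ_product_univ, expect_product, expect_product] at h
  exact h.symm

end Words

/-! ### Two walkers -/

section Walkers

variable {Ω : Type} [Fintype Ω] [DecidableEq Ω]

/-- The number of points where two permutations agree. -/
def agree (a a' : Equiv.Perm Ω) : ℕ := (univ.filter fun z => a z = a' z).card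

/-- The permutations that fix `T` pointwise. -/
def stab (T : Finset Ω) : Finset (Equiv.Perm Ω) := univ.filter fun σ => ∀ x ∈ T, σ x = x

theorem mem_stab {T : Finset Ω} {σ : Equiv.Perm Ω} : σ ∈ stab T ↔ ∀ x ∈ T, σ x = x := by
  simp [stab]

theorem one_mem_stab (T : Finset Ω) : (1 : Equiv.Perm Ω) ∈ stab T := by simp [mem_stab]

theorem card_stab (T : Finset Ω) : (stab T).card = (Fintype.card Ω - T.card).factorial := by
  have e := Fintype.card_congr (Equiv.Perm.subtypeEquivSubtypePerm fun x : Ω => x ∉ T)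
  rw [Fintype.card_perm, Fintype.card_subtype_compl, Fintype.card_coe] at e
  rw [e, Fintype.card_subtype]
  congr 1
  ext σ
  simp [mem_stab]

/-- A simultaneous relabelling of `x` and `x'` is absorbed by `b`, so there is one value on the
diagonal and one off it. They are determined by the diagonal sum `agree a a'` and the row sums 1. -/
theorem expect_walk (hn : 2 ≤ Fintype.card Ω) (a a' : Equiv.Perm Ω) (x x' : Ω) :
    𝔼 b : Equiv.Perm Ω, (if a (b x) = a' (b x') then (1 : ℝ) else 0)
      = (Fintype.card Ω : ℝ)⁻¹ + ((if x = x' then 1 else 0) - (Fintype.card Ω : ℝ)⁻¹) *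
        ((agree a a' - 1) / (Fintype.card Ω - 1)) := by
  set n := Fintype.card Ω with hndef
  set H : Ω → Ω → ℝ := fun x x' => 𝔼 b : Equiv.Perm Ω, (if a (b x) = a' (b x') then (1 : ℝ) else 0)
    with hH
  have hinv : ∀ (π : Equiv.Perm Ω) x x', H (π x) (π x') = H x x' := fun π x x' =>
    Fintype.expect_equiv (Equiv.mulRight π) _ _ fun b => rfl
  have hdiag : ∀ x y, H x x = H y y := fun x y => by
    have := hinv (Equiv.swap x y) x x
    simpa using this.symm
  have hoff : ∀ x y z, y ≠ x → z ≠ x → H x y = H x z := fun x y z hy hz => by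
    have := hinv (Equiv.swap y z) x y
    rwa [Equiv.swap_apply_left, Equiv.swap_apply_of_ne_of_ne hy.symm hz.symm, eq_comm] at this
  have hn0 : (n : ℝ) ≠ 0 := by positivity
  have hn1 : (n : ℝ) - 1 ≠ 0 := by
    have : (2 : ℝ) ≤ n := by exact_mod_cast hn
    linarith
  have hsd : n * H x x = agree a a' := by
    have : ∑ y, H y y = agree a a' := by
      simp only [hH]
      rw [← expect_sum_comm]
      have : ∀ b : Equiv.Perm Ω, ∑ y, (if a (b y) = a' (b y) then (1 : ℝ) else 0)
          = agree a a' := fun b => by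
        rw [Equiv.sum_comp b fun z => if a z = a' z then (1 : ℝ) else 0]
        simp [agree]
      simp [this]
    rw [← this, sum_congr rfl fun y _ => hdiag y x]
    simp [hndef]
  have hrow : ∑ y, H x y = 1 := by
    simp only [hH]
    rw [← expect_sum_comm]
    have : ∀ b : Equiv.Perm Ω, ∑ y, (if a (b x) = a' (b y) then (1 : ℝ) else 0) = 1 := fun b => by
      rw [Equiv.sum_comp b fun z => if a (b x) = a' z then (1 : ℝ) else 0]
      rw [Equiv.sum_comp a' fun z => if a (b x) = z then (1 : ℝ) else 0]
      simp
    simp [this]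
  by_cases hxx : x = x'
  · subst hxx
    change H x x = _
    rw [if_pos rfl]
    rw [show H x x = agree a a' / n by rw [← hsd]; field_simp]
    field_simp
    ring
  · have hx' : H x x + (n - 1) * H x x' = 1 := by
      rw [← add_sum_erase univ _ (mem_univ x)] at hrow
      rw [sum_congr rfl fun y hy => hoff x y x' (ne_of_mem_erase hy) (Ne.symm hxx)] at hrow
      simp only [sum_const, card_erase_of_mem (mem_univ x), card_univ, nsmul_eq_mul] at hrow
      rwa [Nat.cast_sub (by omega), Nat.cast_one] at hrow
    change H x x' = _
    rw [if_neg hxx, show H x x' = (1 - agree a a' / n) / (n - 1) by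
      rw [← hsd]; field_simp; linear_combination hx']
    field_simp
    ring

theorem expect_fin_succ {Y : Type} [Fintype Y] {k : ℕ} (F : (Fin (k + 1) → Y) → ℝ) :
    𝔼 β, F β = 𝔼 β : Fin k → Y, 𝔼 b : Y, F (Fin.snoc (α := fun _ => Y) β b) := by
  rw [Fintype.expect_equiv (Fin.snocEquiv fun _ : Fin (k + 1) => Y).symm F
    (fun x => F (Fin.snoc (α := fun _ => Y) x.2 x.1)) (fun β => by simp [Fin.snocEquiv]),
    ← univ_product_univ, expect_product, expect_comm]

/-- Each random `β j` multiplies the excess over `1/n` by the factor from `expect_walk`. The letter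
`α 0` acts before any `β` and only sets the initial excess. -/
theorem expect_collision (hn : 2 ≤ Fintype.card Ω) (k : ℕ) (α α' : Fin (k + 1) → Equiv.Perm Ω)
    (v : Ω) :
    𝔼 β : Fin k → Equiv.Perm Ω,
        (if oddWord k α β v = oddWord k α' β v then (1 : ℝ) else 0) - (Fintype.card Ω : ℝ)⁻¹
      = ((if α 0 v = α' 0 v then 1 else 0) - (Fintype.card Ω : ℝ)⁻¹) *
        ∏ j : Fin k, (((agree (α j.succ) (α' j.succ) : ℝ) - 1) / (Fintype.card Ω - 1)) := by
  induction k with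
  | zero => simp [oddWord_zero]
  | succ k ih =>
    rw [expect_fin_succ]
    simp only [oddWord_succ, Fin.snoc_last, Fin.snoc_castSucc, Equiv.Perm.mul_apply]
    simp only [expect_walk hn]
    rw [expect_add_distrib, Fintype.expect_const, ← expect_mul, expect_sub_distrib,
      Fintype.expect_const, ih, Fin.prod_univ_castSucc]
    simp only [Fin.succ_castSucc, Fin.castSucc_zero, Fin.succ_last, Nat.succ_eq_add_one]
    rw [add_sub_cancel_left, mul_assoc]
    rfl

/-- The power of 2 counts the sets of fixed points. Exchanging the sums gives `n!` times a partial
sum of the series of `e`. -/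
theorem expect_two_pow_fix_le :
    𝔼 σ : Equiv.Perm Ω, (2 : ℝ) ^ (agree σ 1) ≤ 3 := by
  have h1 : ∀ σ : Equiv.Perm Ω, (2 : ℝ) ^ agree σ 1
      = ∑ A : Finset Ω, if σ ∈ stab A then (1 : ℝ) else 0 := by
    intro σ
    rw [sum_boole]
    have : univ.filter (fun A : Finset Ω => σ ∈ stab A)
        = (univ.filter fun z => σ z = (1 : Equiv.Perm Ω) z).powerset := by
      ext A
      rw [mem_filter, mem_stab, mem_powerset]
      exact ⟨fun h x hx => mem_filter.2 ⟨mem_univ _, h.2 x hx⟩,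
        fun h => ⟨mem_univ _, fun x hx => (mem_filter.1 (h hx)).2⟩⟩
    rw [this, card_powerset]
    simp [agree]
  have h2 : ∑ σ : Equiv.Perm Ω, (2 : ℝ) ^ (agree σ 1)
      = ∑ k ∈ range (Fintype.card Ω + 1), ((Fintype.card Ω).choose k : ℝ) *
          (Fintype.card Ω - k).factorial := by
    simp only [h1]
    rw [sum_comm]
    have : ∀ A : Finset Ω, ∑ σ : Equiv.Perm Ω, (if σ ∈ stab A then (1 : ℝ) else 0)
        = ((Fintype.card Ω - A.card).factorial : ℝ) := by
      intro A
      rw [sum_boole, ← card_stab]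
      simp
    simp only [this]
    have := sum_powerset_apply_card (x := (univ : Finset Ω))
      (fun k => ((Fintype.card Ω - k).factorial : ℝ))
    rw [powerset_univ, card_univ] at this
    rw [this]
    simp [nsmul_eq_mul]
  rw [Fintype.expect_eq_sum_div_card, h2, Fintype.card_perm, div_le_iff₀ (by positivity)]
  have h3 : ∑ k ∈ range (Fintype.card Ω + 1), (1 : ℝ) ^ k / k.factorial ≤ 3 := by
    refine (Real.sum_le_exp_of_nonneg zero_le_one _).trans ?_
    linarith [Real.exp_one_lt_d9]
  calc _ = ∑ k ∈ range (Fintype.card Ω + 1), (1 : ℝ) ^ k / k.factorial *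
        (Fintype.card Ω).factorial := by
        refine sum_congr rfl fun k hk => ?_
        have hk' : k ≤ Fintype.card Ω := by simpa [Nat.lt_succ_iff] using hk
        have := Nat.choose_mul_factorial_mul_factorial hk'
        have h' : ((Fintype.card Ω).choose k : ℝ) * k.factorial * (Fintype.card Ω - k).factorial
            = (Fintype.card Ω).factorial := by exact_mod_cast this
        rw [← h', one_pow]
        field_simp
    _ ≤ _ := by
        rw [← sum_mul]
        exact mul_le_mul_of_nonneg_right h3 (by positivity)

/-- Turns the exponential moment of the number of agreements into `p`-th moments. -/
theorem pow_le_pow_mul_two_pow (p x : ℕ) (hp : 1 ≤ p) : x ^ p ≤ p ^ p * 2 ^ x := by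
  have h1 : x ≤ p * 2 ^ (x / p) := by
    have h2 : x / p + 1 ≤ 2 ^ (x / p) := Nat.lt_two_pow_self
    calc x ≤ p * (x / p + 1) := (Nat.lt_mul_div_succ x (by omega)).le
      _ ≤ _ := Nat.mul_le_mul_left _ h2
  calc x ^ p ≤ (p * 2 ^ (x / p)) ^ p := Nat.pow_le_pow_left h1 p
    _ = p ^ p * 2 ^ (x / p * p) := by rw [mul_pow, ← pow_mul]
    _ ≤ _ := Nat.mul_le_mul_left _ (Nat.pow_le_pow_right (by norm_num) (Nat.div_mul_le_self x p))

theorem expect_agree_pow_le (p : ℕ) (hp : 1 ≤ p) :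
    𝔼 a : Equiv.Perm Ω, 𝔼 a' : Equiv.Perm Ω, |(agree a a' : ℝ) - 1| ^ p ≤ (4 * p) ^ p := by
  have hx : ∀ x : ℕ, |(x : ℝ) - 1| ^ p ≤ (p : ℝ) ^ p * 2 ^ x := by
    intro x
    rcases Nat.eq_zero_or_pos x with rfl | hx
    · simp only [Nat.cast_zero, zero_sub, abs_neg, abs_one, one_pow, pow_zero, mul_one]
      exact one_le_pow₀ (by exact_mod_cast hp)
    · have h1 : (1 : ℝ) ≤ x := by exact_mod_cast hx
      rw [abs_of_nonneg (by linarith)]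
      calc ((x : ℝ) - 1) ^ p ≤ (x : ℝ) ^ p := pow_le_pow_left₀ (by linarith) (by linarith) _
        _ ≤ _ := by exact_mod_cast pow_le_pow_mul_two_pow p x hp
  have hre : ∀ a : Equiv.Perm Ω, 𝔼 a' : Equiv.Perm Ω, (2 : ℝ) ^ agree a a'
      = 𝔼 σ : Equiv.Perm Ω, (2 : ℝ) ^ agree σ 1 := by
    intro a
    refine Fintype.expect_equiv ((Equiv.inv (Equiv.Perm Ω)).trans (Equiv.mulRight a)) _ _
      fun a' => ?_
    congr 1
    simp only [agree]
    congr 1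
    ext z
    simp [Equiv.symm_apply_eq]
  calc _ ≤ 𝔼 a : Equiv.Perm Ω, 𝔼 a' : Equiv.Perm Ω, (p : ℝ) ^ p * 2 ^ agree a a' :=
        expect_le_expect fun a _ => expect_le_expect fun a' _ => hx _
    _ = (p : ℝ) ^ p * 𝔼 σ : Equiv.Perm Ω, (2 : ℝ) ^ agree σ 1 := by
        simp only [← mul_expect, hre, Fintype.expect_const]
    _ ≤ (p : ℝ) ^ p * 4 ^ p := by
        refine mul_le_mul_of_nonneg_left (expect_two_pow_fix_le.trans ?_) (by positivity)
        calc (3 : ℝ) ≤ 4 ^ 1 := by norm_num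
          _ ≤ 4 ^ p := pow_le_pow_right₀ (by norm_num) hp
    _ = _ := by rw [mul_pow, mul_comm]

end Walkers

/-! ### Hiding of alternating words from short messages -/

section Hiding

variable {Ω : Type} [Fintype Ω] [DecidableEq Ω]

theorem expect_expect_prod_pi {ι X : Type} [Fintype ι] [DecidableEq ι] [Fintype X]
    (g : ι → X → X → ℝ) :
    𝔼 x : ι → X, 𝔼 y : ι → X, ∏ i, g i (x i) (y i) = ∏ i, 𝔼 x, 𝔼 y, g i x y := by
  simp only [Fintype.expect_eq_sum_div_card, ← sum_div]
  rw [sum_sum_prod_pi, Fintype.card_fun, prod_div_distrib, prod_div_distrib, prod_const, card_univ]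
  push_cast
  rfl

theorem expect_prod_agree_pow_le (hn : 2 ≤ Fintype.card Ω) (p : ℕ) (hp : 1 ≤ p) (k : ℕ) :
    𝔼 α : Fin (k + 1) → Equiv.Perm Ω, 𝔼 α' : Fin (k + 1) → Equiv.Perm Ω,
      (∏ j : Fin k, (|(agree (α j.succ) (α' j.succ) : ℝ) - 1| / (Fintype.card Ω - 1))) ^ p
      ≤ ((4 * p / (Fintype.card Ω - 1 : ℝ)) ^ k) ^ p := by
  have hn1 : (0 : ℝ) < Fintype.card Ω - 1 := by
    have : (2 : ℝ) ≤ Fintype.card Ω := by exact_mod_cast hn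
    linarith
  -- The letters with index 0 do not occur in the product, hence the dummy factor 1.
  let g : Fin (k + 1) → Equiv.Perm Ω → Equiv.Perm Ω → ℝ := Fin.cases (fun _ _ => 1)
    fun _ a a' => (|(agree a a' : ℝ) - 1| / (Fintype.card Ω - 1)) ^ p
  have e : ∀ α α' : Fin (k + 1) → Equiv.Perm Ω,
      (∏ j : Fin k, (|(agree (α j.succ) (α' j.succ) : ℝ) - 1| / (Fintype.card Ω - 1))) ^ p
        = ∏ j, g j (α j) (α' j) := by
    intro α α'
    rw [Fin.prod_univ_succ, ← prod_pow]
    simp [g]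
  simp only [e]
  rw [expect_expect_prod_pi, Fin.prod_univ_succ]
  simp only [g, Fin.cases_zero, Fin.cases_succ, Fintype.expect_const, one_mul, prod_const,
    card_univ, Fintype.card_fin]
  rw [← pow_mul, mul_comm k p, pow_mul]
  refine pow_le_pow_left₀ (expect_nonneg fun a _ => expect_nonneg fun a' _ => by positivity) ?_ k
  simp only [div_pow, ← expect_div]
  gcongr
  exact expect_agree_pow_le p hp

/-- Cauchy–Schwarz twice, in `b` and in `z`; the test function enters only through its bound 1. -/
theorem abs_expect_sum_le {B Z : Type} [Fintype B] [Fintype Z] [Nonempty B] (g Ψ : B → Z → ℝ)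
    (hΨ : ∀ b z, 0 ≤ Ψ b z ∧ Ψ b z ≤ 1) :
    |𝔼 b, ∑ z, g b z * Ψ b z| ≤ √(Fintype.card Z * 𝔼 b, ∑ z, g b z ^ 2) := by
  refine Real.abs_le_sqrt ?_
  have h1 := expect_mul_sq_le_sq_mul_sq univ (fun b => ∑ z, g b z * Ψ b z) fun _ => (1 : ℝ)
  simp only [mul_one, one_pow, Fintype.expect_const] at h1
  refine h1.trans ?_
  rw [mul_expect]
  refine expect_le_expect fun b _ => ?_
  refine (sum_mul_sq_le_sq_mul_sq _ _ _).trans ?_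
  rw [mul_comm]
  refine mul_le_mul_of_nonneg_right ?_ (sum_nonneg fun z _ => sq_nonneg _)
  calc ∑ z, Ψ b z ^ 2 ≤ ∑ _z : Z, (1 : ℝ) :=
        sum_le_sum fun z _ => pow_le_one₀ (hΨ b z).1 (hΨ b z).2
    _ = _ := by simp

theorem sum_centered (w w' : Ω) (hn : 0 < Fintype.card Ω) :
    ∑ z, ((if w = z then (1 : ℝ) else 0) - (Fintype.card Ω : ℝ)⁻¹) *
      ((if w' = z then (1 : ℝ) else 0) - (Fintype.card Ω : ℝ)⁻¹)
      = (if w = w' then 1 else 0) - (Fintype.card Ω : ℝ)⁻¹ := by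
  have hn0 : (Fintype.card Ω : ℝ) ≠ 0 := by positivity
  simp only [sub_mul, mul_sub, sum_sub_distrib, ← mul_sum, ← sum_mul, sum_const, card_univ,
    nsmul_eq_mul]
  have : ∑ z, (if w = z then (1 : ℝ) else 0) * (if w' = z then (1 : ℝ) else 0)
      = if w = w' then 1 else 0 := by
    rw [sum_eq_single w]
    · simp [eq_comm]
    · intro b _ hb; simp [Ne.symm hb]
    · simp
  rw [this]
  simp
  field_simp
  ring

/-- The position of a single walker is hidden. -/
theorem single_walker {Λ : Type} [Fintype Λ] (p : ℕ) (hp : 1 ≤ p)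
    (hΛ : Fintype.card Λ ≤ 2 ^ p) (hn : 2 ≤ Fintype.card Ω) (k : ℕ) (v : Ω)
    (M : (Fin (k + 1) → Equiv.Perm Ω) → Λ) (Ψ : Λ → (Fin k → Equiv.Perm Ω) → Ω → ℝ)
    (hΨ : ∀ μ β z, 0 ≤ Ψ μ β z ∧ Ψ μ β z ≤ 1) :
    |𝔼 α, 𝔼 β, (Ψ (M α) β (oddWord k α β v) - 𝔼 z, Ψ (M α) β z)|
      ≤ 4 * √(Fintype.card Ω * (4 * p / (Fintype.card Ω - 1 : ℝ)) ^ k) := by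
  classical
  have hn1 : (0 : ℝ) < Fintype.card Ω - 1 := by
    have : (2 : ℝ) ≤ Fintype.card Ω := by exact_mod_cast hn
    linarith
  set N : ℝ := (Fintype.card Ω : ℝ) with hN
  set θ : ℝ := 4 * p / (N - 1) with hθ
  have hp0 : (0 : ℝ) < p := by exact_mod_cast hp
  have hθ0 : 0 < θ := by positivity
  have hN0 : 0 < N := by linarith
  let ind : Λ → (Fin (k + 1) → Equiv.Perm Ω) → ℝ := fun μ α => if M α = μ then 1 else 0
  let cen : (Fin (k + 1) → Equiv.Perm Ω) → (Fin k → Equiv.Perm Ω) → Ω → ℝ := fun α β z =>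
    (if oddWord k α β v = z then (1 : ℝ) else 0) - N⁻¹
  -- For given `β`, this is the signed excess of the event that the message is `μ` and the walker
  -- ends at `z`. Its square brings in the second copy `α'`.
  let g : Λ → (Fin k → Equiv.Perm Ω) → Ω → ℝ := fun μ β z => 𝔼 α, ind μ α * cen α β z
  let W : (Fin (k + 1) → Equiv.Perm Ω) → (Fin (k + 1) → Equiv.Perm Ω) → ℝ := fun α α' =>
    ∏ j : Fin k, (|(agree (α j.succ) (α' j.succ) : ℝ) - 1| / (N - 1))
  have hind : ∀ μ α, 0 ≤ ind μ α ∧ ind μ α ≤ 1 := fun μ α => by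
    simp only [ind]; split_ifs <;> simp
  have hW0 : ∀ α α', 0 ≤ W α α' := fun α α' => prod_nonneg fun j _ => by positivity
  have hLHS : 𝔼 α, 𝔼 β, (Ψ (M α) β (oddWord k α β v) - 𝔼 z, Ψ (M α) β z)
      = ∑ μ, 𝔼 β, ∑ z, g μ β z * Ψ μ β z := by
    have e1 : ∀ α β, Ψ (M α) β (oddWord k α β v) - 𝔼 z, Ψ (M α) β z
        = ∑ μ, ∑ z, ind μ α * cen α β z * Ψ μ β z := by
      intro α β
      rw [sum_eq_single (M α)]
      · simp [ind, cen, sub_mul, sum_sub_distrib, ← mul_sum, Fintype.expect_eq_sum_div_card,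
          hN, div_eq_inv_mul]
      · intro b _ hb; simp [ind, Ne.symm hb]
      · simp
    simp only [e1]
    simp only [g, expect_mul, expect_sum_comm]
    refine sum_congr rfl fun μ _ => ?_
    refine sum_congr rfl fun z _ => ?_
    rw [expect_comm]
  have hV : ∀ μ, 𝔼 β, ∑ z, g μ β z ^ 2 ≤ 𝔼 α, 𝔼 α', ind μ α * ind μ α' * W α α' := by
    intro μ
    have e1 : 𝔼 β, ∑ z, g μ β z ^ 2
        = 𝔼 α, 𝔼 α', ind μ α * ind μ α' * 𝔼 β, ∑ z, cen α β z * cen α' β z := by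
      have e0 : ∀ β z, g μ β z ^ 2
          = 𝔼 α, 𝔼 α', (ind μ α * cen α β z) * (ind μ α' * cen α' β z) := fun β z => by
        simp only [g]
        rw [sq, expect_mul_expect]
      simp only [e0, mul_expect, mul_sum, expect_sum_comm]
      refine sum_congr rfl fun z _ => ?_
      rw [expect_comm]
      refine expect_congr rfl fun α _ => ?_
      rw [expect_comm]
      refine expect_congr rfl fun α' _ => expect_congr rfl fun β _ => ?_
      ring
    rw [e1]
    refine expect_le_expect fun α _ => expect_le_expect fun α' _ => ?_
    refine mul_le_mul_of_nonneg_left ?_ (mul_nonneg (hind _ _).1 (hind _ _).1)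
    simp only [cen, hN, sum_centered _ _ (by omega : 0 < Fintype.card Ω)]
    rw [expect_sub_distrib, Fintype.expect_const, expect_collision hn]
    refine (le_abs_self _).trans ?_
    rw [abs_mul, abs_prod]
    have e2 : |(if α 0 v = α' 0 v then (1 : ℝ) else 0) - (Fintype.card Ω : ℝ)⁻¹| ≤ 1 := by
      have h1 : 0 ≤ (Fintype.card Ω : ℝ)⁻¹ := by positivity
      have h2 : (Fintype.card Ω : ℝ)⁻¹ ≤ 1 := inv_le_one_of_one_le₀ (by rw [← hN]; linarith)
      split_ifs <;> rw [abs_le] <;> constructor <;> linarith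
    refine (mul_le_of_le_one_left (prod_nonneg fun _ _ => abs_nonneg _) e2).trans (le_of_eq ?_)
    refine prod_congr rfl fun j _ => ?_
    rw [abs_div, abs_of_pos hn1]
  -- The extra 4 makes the `p`-th moment of `W / l` at most `4⁻¹ ^ p`, small enough for a union over
  -- `2 ^ p` messages after a square root.
  set l : ℝ := 4 * θ ^ k with hl
  have hl0 : 0 < l := by positivity
  have hWp : 𝔼 α, 𝔼 α', (W α α' / l) ^ p ≤ ((4 : ℝ)⁻¹) ^ p := by
    simp only [div_pow, ← expect_div]
    rw [div_le_iff₀ (by positivity), ← mul_pow, hl, inv_mul_cancel_left₀ (by norm_num)]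
    exact expect_prod_agree_pow_le hn p hp k
  let q : Λ → ℝ := fun μ => 𝔼 α, ind μ α
  have hq0 : ∀ μ, 0 ≤ q μ := fun μ => expect_nonneg fun α _ => (hind μ α).1
  have hq1 : ∑ μ, q μ = 1 := by
    simp only [q]
    rw [← expect_sum_comm]
    simp [ind]
  have hV' : ∀ μ, 𝔼 β, ∑ z, g μ β z ^ 2 ≤ l * (q μ + (2⁻¹ : ℝ) ^ p) ^ 2 := by
    intro μ
    have hy : ∀ α α', ind μ α * ind μ α' * W α α'
        ≤ l * (ind μ α * ind μ α') + l * (W α α' / l) ^ p := by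
      intro α α'
      -- Truncation at `l`: above it, the ratio is bounded by its `p`-th power.
      have h1 : W α α' ≤ l + l * (W α α' / l) ^ p := by
        have hpos : 0 ≤ l * (W α α' / l) ^ p := by have := hW0 α α'; positivity
        rcases le_total (W α α') l with h | h
        · linarith
        · have h2 : 1 ≤ W α α' / l := by rwa [le_div_iff₀ hl0, one_mul]
          have h3 : W α α' / l ≤ (W α α' / l) ^ p := le_self_pow₀ h2 (by omega)
          have h4 : W α α' = l * (W α α' / l) := by field_simp
          have h5 := mul_le_mul_of_nonneg_left h3 hl0.le
          linarith
      have hi0 := mul_nonneg (hind μ α).1 (hind μ α').1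
      have hi1 := mul_le_one₀ (hind μ α).2 (hind μ α').1 (hind μ α').2
      have hpos : 0 ≤ l * (W α α' / l) ^ p := by have := hW0 α α'; positivity
      nlinarith
    calc _ ≤ _ := hV μ
      _ ≤ 𝔼 α, 𝔼 α', (l * (ind μ α * ind μ α') + l * (W α α' / l) ^ p) :=
          expect_le_expect fun α _ => expect_le_expect fun α' _ => hy α α'
      _ = l * (q μ * q μ) + l * 𝔼 α, 𝔼 α', (W α α' / l) ^ p := by
          simp only [expect_add_distrib, ← mul_expect, q, ← expect_mul]
      _ ≤ l * (q μ * q μ) + l * ((4 : ℝ)⁻¹) ^ p := by gcongr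
      _ ≤ _ := by
          rw [show ((4 : ℝ)⁻¹) ^ p = (2⁻¹ ^ p) * (2⁻¹ ^ p) by rw [← mul_pow]; norm_num]
          have : 0 ≤ l * (q μ * (2⁻¹ : ℝ) ^ p) := by have := hq0 μ; positivity
          nlinarith
  rw [hLHS]
  calc |∑ μ, 𝔼 β, ∑ z, g μ β z * Ψ μ β z| ≤ ∑ μ, |𝔼 β, ∑ z, g μ β z * Ψ μ β z| :=
        abs_sum_le_sum_abs _ _
    _ ≤ ∑ μ, √(N * l) * (q μ + (2⁻¹ : ℝ) ^ p) := by
        refine sum_le_sum fun μ _ => (abs_expect_sum_le _ _ (hΨ μ)).trans ?_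
        rw [← hN]
        have hb : 0 ≤ q μ + (2⁻¹ : ℝ) ^ p := by have := hq0 μ; positivity
        calc √(N * 𝔼 β, ∑ z, g μ β z ^ 2) ≤ √(N * (l * (q μ + (2⁻¹ : ℝ) ^ p) ^ 2)) :=
              Real.sqrt_le_sqrt (mul_le_mul_of_nonneg_left (hV' μ) hN0.le)
          _ = _ := by rw [← mul_assoc, Real.sqrt_mul (by positivity), Real.sqrt_sq hb]
    -- The masses `q μ` of the messages add up to 1, and the tails of at most `2 ^ p` messages to at
    -- most another 1.
    _ = √(N * l) * (1 + Fintype.card Λ * (2⁻¹ : ℝ) ^ p) := by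
        rw [← mul_sum, sum_add_distrib, hq1]; simp
    _ ≤ √(N * l) * 2 := by
        refine mul_le_mul_of_nonneg_left ?_ (Real.sqrt_nonneg _)
        have : (Fintype.card Λ : ℝ) ≤ 2 ^ p := by exact_mod_cast hΛ
        have h2 : (2 : ℝ) ^ p * (2⁻¹ : ℝ) ^ p = 1 := by rw [← mul_pow]; norm_num
        have h3 : (Fintype.card Λ : ℝ) * (2⁻¹ : ℝ) ^ p ≤ 2 ^ p * (2⁻¹ : ℝ) ^ p := by gcongr
        linarith
    _ = 4 * √(N * θ ^ k) := by
        rw [hl, show N * (4 * θ ^ k) = 2 ^ 2 * (N * θ ^ k) by ring, Real.sqrt_mul (by norm_num),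
          Real.sqrt_sq (by norm_num)]
        ring

/-- The coset `w * stab {v}` consists of all permutations with `v ↦ w v`, so it depends on `w v`
only; the swap is another representative. -/
theorem expect_stab_singleton (v : Ω) (w : Equiv.Perm Ω) (f : Equiv.Perm Ω → ℝ) :
    𝔼 ρ ∈ stab {v}, f (w * ρ) = 𝔼 ρ ∈ stab {v}, f (Equiv.swap v (w v) * ρ) := by
  refine expect_nbij' (fun ρ => Equiv.swap v (w v) * (w * ρ))
    (fun ρ => w⁻¹ * (Equiv.swap v (w v) * ρ)) ?_ ?_ ?_ ?_ ?_
  · intro ρ hρ; simp only [mem_stab, mem_singleton, forall_eq] at *; simp [hρ]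
  · intro ρ hρ; simp only [mem_stab, mem_singleton, forall_eq] at *; simp [hρ]
  · intro ρ _; simp [← mul_assoc]
  · intro ρ _; simp [← mul_assoc]
  · intro ρ _; simp [← mul_assoc]

theorem expect_perm_eq_expect_swap (v : Ω) (f : Equiv.Perm Ω → ℝ) :
    𝔼 σ : Equiv.Perm Ω, f σ = 𝔼 z, 𝔼 ρ ∈ stab {v}, f (Equiv.swap v z * ρ) := by
  rw [← expect_product' univ (stab {v}) fun z ρ => f (Equiv.swap v z * ρ)]
  symm
  refine expect_nbij' (fun x => Equiv.swap v x.1 * x.2)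
    (fun σ => (σ v, Equiv.swap v (σ v) * σ)) ?_ ?_ ?_ ?_ ?_
  · simp
  · intro σ _; simp [mem_stab]
  · rintro ⟨z, ρ⟩ h
    simp only [mem_product, mem_univ, true_and, mem_stab, mem_singleton, forall_eq] at h
    simp [h, ← mul_assoc]
  · intro σ _; simp [← mul_assoc]
  · simp

/-- Blurred by `stab {v}`, the word retains only the image of `v`. So `single_walker` applies to the
averages of `ψ` over cosets. -/
theorem single_walker_stab {Λ : Type} [Fintype Λ] (p : ℕ) (hp : 1 ≤ p)
    (hΛ : Fintype.card Λ ≤ 2 ^ p) (hn : 2 ≤ Fintype.card Ω) (k : ℕ) (v : Ω)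
    (M : (Fin (k + 1) → Equiv.Perm Ω) → Λ)
    (ψ : Λ → (Fin k → Equiv.Perm Ω) → Equiv.Perm Ω → ℝ)
    (hψ : ∀ μ β σ, 0 ≤ ψ μ β σ ∧ ψ μ β σ ≤ 1) :
    |𝔼 α, 𝔼 β, 𝔼 ρ ∈ stab {v}, ψ (M α) β (oddWord k α β * ρ)
        - 𝔼 α, 𝔼 β, 𝔼 ρ : Equiv.Perm Ω, ψ (M α) β (oddWord k α β * ρ)|
      ≤ 4 * √(Fintype.card Ω * (4 * p / (Fintype.card Ω - 1 : ℝ)) ^ k) := by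
  have h := single_walker p hp hΛ hn k v M
    (fun μ β z => 𝔼 ρ ∈ stab {v}, ψ μ β (Equiv.swap v z * ρ))
    fun μ β z => expect_mem_Icc _ fun ρ _ => hψ _ _ _
  simp only [expect_sub_distrib] at h
  have e1 : ∀ α β, 𝔼 ρ ∈ stab {v}, ψ (M α) β (oddWord k α β * ρ)
      = 𝔼 ρ ∈ stab {v}, ψ (M α) β (Equiv.swap v (oddWord k α β v) * ρ) := fun α β =>
    expect_stab_singleton v (oddWord k α β) (ψ (M α) β)
  have e2 : ∀ α β, 𝔼 ρ : Equiv.Perm Ω, ψ (M α) β (oddWord k α β * ρ)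
      = 𝔼 z, 𝔼 ρ ∈ stab {v}, ψ (M α) β (Equiv.swap v z * ρ) := fun α β => by
    rw [← expect_perm_eq_expect_swap v]
    exact Fintype.expect_equiv (Equiv.mulLeft (oddWord k α β)) _ _ fun ρ => by simp
  simp only [e1, e2]
  exact h

theorem expect_stab_eq (T : Finset Ω) (f : Equiv.Perm Ω → ℝ) :
    𝔼 ρ ∈ stab T, f ρ = 𝔼 ρ : Equiv.Perm {x // x ∉ T}, f (Equiv.Perm.ofSubtype ρ) := by
  symm
  refine expect_nbij (fun ρ => Equiv.Perm.ofSubtype ρ) ?_ ?_ ?_ ?_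
  · intro ρ _
    rw [mem_stab]
    intro x hx
    exact Equiv.Perm.ofSubtype_apply_of_not_mem _ (by simpa using hx)
  · intro ρ _; rfl
  · exact Equiv.Perm.ofSubtype_injective.injOn
  · intro σ hσ
    have hσ := mem_stab.1 hσ
    have h1 : ∀ x, σ x ∉ T ↔ x ∉ T := by
      intro x
      refine not_congr ⟨fun h => ?_, fun h => by rwa [hσ x h]⟩
      have := hσ _ h
      rwa [σ.injective this] at h
    refine ⟨σ.subtypePerm h1, by simp, Equiv.Perm.ofSubtype_subtypePerm h1 ?_⟩
    intro x hx hT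
    exact hx (hσ x hT)

theorem expect_stab_insert_eq (T : Finset Ω) (v : Ω) (hv : v ∉ T) (f : Equiv.Perm Ω → ℝ) :
    𝔼 ρ ∈ stab (insert v T), f ρ
      = 𝔼 ρ ∈ stab ({⟨v, hv⟩} : Finset {x // x ∉ T}), f (Equiv.Perm.ofSubtype ρ) := by
  symm
  refine expect_nbij (fun ρ => Equiv.Perm.ofSubtype ρ) ?_ ?_ ?_ ?_
  · intro ρ hρ
    rw [mem_stab] at *
    intro x hx
    rcases mem_insert.1 hx with rfl | hx
    · rw [Equiv.Perm.ofSubtype_apply_of_mem (p := fun x => x ∉ T) _ hv,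
        hρ _ (mem_singleton_self _)]
    · exact Equiv.Perm.ofSubtype_apply_of_not_mem _ (by simpa using hx)
  · intro ρ _; rfl
  · exact Equiv.Perm.ofSubtype_injective.injOn
  · intro σ hσ
    have hσ := mem_stab.1 hσ
    have h1 : ∀ x, σ x ∉ T ↔ x ∉ T := by
      intro x
      refine not_congr ⟨fun h => ?_, fun h => by rwa [hσ x (mem_insert_of_mem h)]⟩
      have := hσ _ (mem_insert_of_mem h)
      rwa [σ.injective this] at h
    refine ⟨σ.subtypePerm h1, ?_, Equiv.Perm.ofSubtype_subtypePerm h1 ?_⟩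
    · simp only [coe_filter, stab, mem_univ, true_and, Set.mem_ofPred_eq, mem_singleton, forall_eq]
      exact Subtype.ext (hσ v (mem_insert_self _ _))
    · intro x hx hT
      exact hx (hσ x (mem_insert_of_mem hT))

/-- Letters that fix `T` pointwise are planted in `α` and `β`. Once `P` and `Q` are frozen, a
message about `α` is a message about these planted letters, and the claim is the one-point case on
the complement of `T`, which has at least `g + 1` points. -/
theorem hiding_insert {Λ : Type} [Fintype Λ] (p : ℕ) (hp : 1 ≤ p)
    (hΛ : Fintype.card Λ ≤ 2 ^ p) (k g : ℕ) (hg : 1 ≤ g) (T : Finset Ω) (v : Ω) (hv : v ∉ T)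
    (hT : T.card + g + 1 ≤ Fintype.card Ω) (M : (Fin (k + 1) → Equiv.Perm Ω) → Λ)
    (ψ : Λ → (Fin k → Equiv.Perm Ω) → Equiv.Perm Ω → ℝ)
    (hψ : ∀ μ β σ, 0 ≤ ψ μ β σ ∧ ψ μ β σ ≤ 1) :
    |𝔼 α, 𝔼 β, 𝔼 ρ ∈ stab (insert v T), ψ (M α) β (oddWord k α β * ρ)
        - 𝔼 α, 𝔼 β, 𝔼 ρ ∈ stab T, ψ (M α) β (oddWord k α β * ρ)|
      ≤ 4 * √(Fintype.card Ω * (4 * p / (g : ℝ)) ^ k) := by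
  have hcard : Fintype.card {x // x ∉ T} = Fintype.card Ω - T.card := by
    rw [Fintype.card_subtype_compl, Fintype.card_coe]
  have hc1 : (g : ℝ) ≤ Fintype.card {x // x ∉ T} - 1 := by
    have : g + 1 ≤ Fintype.card {x // x ∉ T} := by omega
    have : (g : ℝ) + 1 ≤ Fintype.card {x // x ∉ T} := by exact_mod_cast this
    linarith
  have hg0 : (0 : ℝ) < g := by exact_mod_cast hg
  let e : Equiv.Perm {x // x ∉ T} →* Equiv.Perm Ω := Equiv.Perm.ofSubtype
  have key : ∀ s : Finset (Equiv.Perm Ω),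
      𝔼 α, 𝔼 β, 𝔼 ρ ∈ s, ψ (M α) β (oddWord k α β * ρ)
      = 𝔼 P, 𝔼 Q, 𝔼 a : Fin (k + 1) → Equiv.Perm {x // x ∉ T},
        𝔼 b : Fin k → Equiv.Perm {x // x ∉ T}, 𝔼 ρ ∈ s,
        ψ (M (twistα P Q fun j => e (a j))) (twistβ P Q fun j => e (b j))
          (P (Fin.last k) * (e (oddWord k a b) * ρ)) := by
    intro s
    have h1 : ∀ (a : Fin (k + 1) → Equiv.Perm {x // x ∉ T})
        (b : Fin k → Equiv.Perm {x // x ∉ T}),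
        𝔼 α, 𝔼 β, 𝔼 ρ ∈ s, ψ (M α) β (oddWord k α β * ρ) = 𝔼 P, 𝔼 Q, 𝔼 ρ ∈ s,
        ψ (M (twistα P Q fun j => e (a j))) (twistβ P Q fun j => e (b j))
          (P (Fin.last k) * (e (oddWord k a b) * ρ)) := by
      intro a b
      rw [expect_twist (fun j => e (a j)) (fun j => e (b j))]
      simp only [oddWord_twist, ← map_oddWord, mul_assoc]
    calc _ = 𝔼 a : Fin (k + 1) → Equiv.Perm {x // x ∉ T},
        𝔼 b : Fin k → Equiv.Perm {x // x ∉ T}, 𝔼 P, 𝔼 Q, 𝔼 ρ ∈ s,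
        ψ (M (twistα P Q fun j => e (a j))) (twistβ P Q fun j => e (b j))
          (P (Fin.last k) * (e (oddWord k a b) * ρ)) := by
          simp only [← h1, Fintype.expect_const]
      _ = _ := by
          rw [expect_congr rfl fun a _ => expect_comm _ _ _, expect_comm]
          refine expect_congr rfl fun P _ => ?_
          rw [expect_congr rfl fun a _ => expect_comm _ _ _, expect_comm]
  rw [key, key]
  simp only [← expect_sub_distrib]
  refine abs_expect_le_of_forall _ (by positivity) fun P _ =>
    abs_expect_le_of_forall _ (by positivity) fun Q _ => ?_
  simp only [expect_sub_distrib]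
  have h := single_walker_stab p hp hΛ (by omega) k (⟨v, hv⟩ : {x // x ∉ T})
    (fun a => M (twistα P Q fun j => e (a j)))
    (fun μ b σ => ψ μ (twistβ P Q fun j => e (b j)) (P (Fin.last k) * e σ))
    fun _ _ _ => hψ _ _ _
  have e1 : ∀ (a : Fin (k + 1) → Equiv.Perm {x // x ∉ T}) b,
      𝔼 ρ ∈ stab (insert v T), ψ (M (twistα P Q fun j => e (a j)))
        (twistβ P Q fun j => e (b j)) (P (Fin.last k) * (e (oddWord k a b) * ρ))
      = 𝔼 ρ ∈ stab ({⟨v, hv⟩} : Finset {x // x ∉ T}), ψ (M (twistα P Q fun j => e (a j)))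
        (twistβ P Q fun j => e (b j)) (P (Fin.last k) * e (oddWord k a b * ρ)) := fun a b => by
    rw [expect_stab_insert_eq T v hv]
    simp only [e, map_mul]
  have e2 : ∀ (a : Fin (k + 1) → Equiv.Perm {x // x ∉ T}) b,
      𝔼 ρ ∈ stab T, ψ (M (twistα P Q fun j => e (a j)))
        (twistβ P Q fun j => e (b j)) (P (Fin.last k) * (e (oddWord k a b) * ρ))
      = 𝔼 ρ, ψ (M (twistα P Q fun j => e (a j)))
        (twistβ P Q fun j => e (b j)) (P (Fin.last k) * e (oddWord k a b * ρ)) := fun a b => by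
    rw [expect_stab_eq T]
    simp only [e, map_mul]
  simp only [e1, e2]
  refine h.trans ?_
  have h3 : (Fintype.card {x // x ∉ T} : ℝ) ≤ Fintype.card Ω := by
    exact_mod_cast Fintype.card_subtype_le fun x => x ∉ T
  have h4 : (0 : ℝ) ≤ 4 * p / (Fintype.card {x // x ∉ T} - 1 : ℝ) :=
    div_nonneg (by positivity) (hg0.le.trans hc1)
  exact mul_le_mul_of_nonneg_left (Real.sqrt_le_sqrt (mul_le_mul h3 (pow_le_pow_left₀ h4
    (div_le_div_of_nonneg_left (by positivity) hg0 hc1) k) (pow_nonneg h4 k) (by positivity)))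
    (by norm_num)

/-- The alternating word is hidden on any set of points whose complement is large. -/
theorem hiding_word {Λ : Type} [Fintype Λ] (p : ℕ) (hp : 1 ≤ p)
    (hΛ : Fintype.card Λ ≤ 2 ^ p) (k g : ℕ) (hg : 1 ≤ g) (T : Finset Ω)
    (hT : T.card + g ≤ Fintype.card Ω) (M : (Fin (k + 1) → Equiv.Perm Ω) → Λ)
    (ψ : Λ → (Fin k → Equiv.Perm Ω) → Equiv.Perm Ω → ℝ)
    (hψ : ∀ μ β σ, 0 ≤ ψ μ β σ ∧ ψ μ β σ ≤ 1) :
    |𝔼 α, 𝔼 β, 𝔼 ρ ∈ stab T, ψ (M α) β (oddWord k α β * ρ)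
        - 𝔼 α, 𝔼 β, 𝔼 σ, ψ (M α) β σ|
      ≤ T.card * (4 * √(Fintype.card Ω * (4 * p / (g : ℝ)) ^ k)) := by
  induction T using Finset.induction_on with
  | empty =>
    have : ∀ α β, 𝔼 ρ ∈ stab (∅ : Finset Ω), ψ (M α) β (oddWord k α β * ρ)
        = 𝔼 σ, ψ (M α) β σ := fun α β => by
      have hs : stab (∅ : Finset Ω) = univ := by ext; simp [mem_stab]
      rw [hs]
      exact Fintype.expect_equiv (Equiv.mulLeft (oddWord k α β)) _ _ fun ρ => by simp
    simp [this]
  | insert v T hv ih =>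
    rw [card_insert_of_notMem hv] at hT ⊢
    have h1 := ih (by omega)
    have h2 := hiding_insert p hp hΛ k g hg T v hv (by omega) M ψ hψ
    refine (abs_sub_le _ _ _).trans ((add_le_add h2 h1).trans (le_of_eq ?_))
    push_cast
    ring

end Hiding

/-! ### Blocks with prescribed product on a set of points -/

section Block

variable {Ω : Type} [Fintype Ω] [DecidableEq Ω]

/-- The uniform law on the pairs `(α, β)` whose alternating word agrees with `η` on `T`. -/
noncomputable def blockKer (c : ℕ) (T : Finset Ω) (η : Equiv.Perm Ω)
    (α β : Fin c → Equiv.Perm Ω) : ℝ :=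
  if ∀ x ∈ T, altWord c α β x = η x then
    ((Fintype.card (Equiv.Perm Ω) : ℝ) ^ (2 * c - 1) * (stab T).card)⁻¹ else 0

theorem blockKer_nonneg (c : ℕ) (T : Finset Ω) (η : Equiv.Perm Ω) (α β : Fin c → Equiv.Perm Ω) :
    0 ≤ blockKer c T η α β := by
  unfold blockKer; split_ifs <;> positivity

theorem card_stab_pos (T : Finset Ω) : 0 < (stab T).card := card_pos.2 ⟨1, one_mem_stab T⟩

theorem sum_fin_succ {Y : Type} [Fintype Y] {k : ℕ} (F : (Fin (k + 1) → Y) → ℝ) :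
    ∑ β, F β = ∑ β : Fin k → Y, ∑ b : Y, F (Fin.snoc (α := fun _ => Y) β b) := by
  rw [Fintype.sum_equiv (Fin.snocEquiv fun _ : Fin (k + 1) => Y).symm F
    (fun x => F (Fin.snoc (α := fun _ => Y) x.2 x.1)) (fun β => by simp [Fin.snocEquiv]),
    ← univ_product_univ, sum_product, sum_comm]

/-- All letters but the last `β` are free, and that one is `η * (word * ρ)⁻¹` with `ρ` uniform in
`stab T`. This reduces the hiding property of a block to `hiding_word`. -/
theorem sum_blockKer_mul (k : ℕ) (T : Finset Ω) (η : Equiv.Perm Ω)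
    (α : Fin (k + 1) → Equiv.Perm Ω) (F : (Fin (k + 1) → Equiv.Perm Ω) → ℝ) :
    ∑ β, blockKer (k + 1) T η α β * F β
      = (Fintype.card (Fin (k + 1) → Equiv.Perm Ω) : ℝ)⁻¹ *
        𝔼 β : Fin k → Equiv.Perm Ω, 𝔼 ρ ∈ stab T,
          F (Fin.snoc (α := fun _ => Equiv.Perm Ω) β (η * (oddWord k α β * ρ)⁻¹)) := by
  rw [sum_fin_succ, Fintype.expect_eq_sum_div_card, ← mul_div_assoc, mul_sum, sum_div]
  refine sum_congr rfl fun β _ => ?_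
  rw [expect_eq_sum_div_card, ← mul_div_assoc, mul_sum, sum_div, sum_div]
  have hs := card_stab_pos T
  simp only [blockKer, altWord_succ, Fin.snoc_last, Fin.snoc_castSucc, ite_mul, zero_mul]
  rw [← sum_filter]
  symm
  refine sum_nbij' (fun ρ => η * (oddWord k α β * ρ)⁻¹) (fun b => (oddWord k α β)⁻¹ * (b⁻¹ * η))
    ?_ ?_ ?_ ?_ ?_
  · intro ρ hρ
    rw [mem_stab] at hρ
    simp only [mem_filter, mem_univ, true_and]
    intro x hx
    have h2 : ρ.symm x = x := by rw [Equiv.symm_apply_eq, hρ x hx]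
    simp [mul_inv_rev, h2]
  · intro b hb
    simp only [mem_filter, mem_univ, true_and] at hb
    rw [mem_stab]
    intro x hx
    have := hb x hx
    simp [← this]
  · intro ρ _; group
  · intro b _; group
  · intro ρ _
    rw [Fintype.card_fun, Fintype.card_fun, Fintype.card_fin, Fintype.card_fin]
    push_cast
    rw [show 2 * (k + 1) - 1 = (k + 1) + k by omega, pow_add]
    have h1 : (Fintype.card (Equiv.Perm Ω) : ℝ) ≠ 0 := by simp
    have h2 : ((stab T).card : ℝ) ≠ 0 := by exact_mod_cast hs.ne'
    field_simp
    ring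

theorem sum_blockKer_right (k : ℕ) (T : Finset Ω) (η : Equiv.Perm Ω)
    (α : Fin (k + 1) → Equiv.Perm Ω) :
    ∑ β, blockKer (k + 1) T η α β = (Fintype.card (Fin (k + 1) → Equiv.Perm Ω) : ℝ)⁻¹ := by
  have h := sum_blockKer_mul k T η α fun _ => 1
  simp only [mul_one] at h
  rw [h, expect_congr rfl fun β _ => expect_const ⟨1, one_mem_stab T⟩ (1 : ℝ)]
  simp

theorem abs_blockKer_sub_le {Λ : Type} [Fintype Λ] (p : ℕ) (hp : 1 ≤ p)
    (hΛ : Fintype.card Λ ≤ 2 ^ p) (k g : ℕ) (hg : 1 ≤ g) (T : Finset Ω)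
    (hT : T.card + g ≤ Fintype.card Ω) (η : Equiv.Perm Ω)
    (M : (Fin (k + 1) → Equiv.Perm Ω) → Λ) (φ : Λ → (Fin (k + 1) → Equiv.Perm Ω) → ℝ)
    (hφ : ∀ μ β, 0 ≤ φ μ β ∧ φ μ β ≤ 1) :
    |∑ α, ∑ β, blockKer (k + 1) T η α β * φ (M α) β - 𝔼 α, 𝔼 β, φ (M α) β|
      ≤ T.card * (4 * √(Fintype.card Ω * (4 * p / (g : ℝ)) ^ k)) := by
  have h := hiding_word p hp hΛ k g hg T hT M
    (fun μ β σ => φ μ (Fin.snoc (α := fun _ => Equiv.Perm Ω) β (η * σ⁻¹))) fun _ _ _ => hφ _ _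
  have e1 : ∑ α, ∑ β, blockKer (k + 1) T η α β * φ (M α) β
      = 𝔼 α, 𝔼 β : Fin k → Equiv.Perm Ω, 𝔼 ρ ∈ stab T,
          φ (M α) (Fin.snoc (α := fun _ => Equiv.Perm Ω) β (η * (oddWord k α β * ρ)⁻¹)) := by
    rw [Fintype.expect_eq_sum_div_card, sum_div]
    refine sum_congr rfl fun α _ => ?_
    rw [sum_blockKer_mul, div_eq_inv_mul]
  have e2 : 𝔼 α, 𝔼 β, φ (M α) β = 𝔼 α, 𝔼 β : Fin k → Equiv.Perm Ω, 𝔼 σ : Equiv.Perm Ω,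
          φ (M α) (Fin.snoc (α := fun _ => Equiv.Perm Ω) β (η * σ⁻¹)) := by
    refine expect_congr rfl fun α _ => ?_
    rw [expect_fin_succ]
    refine expect_congr rfl fun β _ => ?_
    symm
    exact Fintype.expect_equiv ((Equiv.inv _).trans (Equiv.mulLeft η)) _ _ fun σ => by simp
  rw [e1, e2]
  exact h

/-- The reversal of a tuple of group elements, with inverses. -/
def revInv {G : Type} [Group G] (c : ℕ) : (Fin c → G) ≃ (Fin c → G) where
  toFun α j := (α j.rev)⁻¹
  invFun α j := (α j.rev)⁻¹
  left_inv α := by funext j; simp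
  right_inv α := by funext j; simp

/-- Reading a block backwards inverts its product, exchanges the roles of `α` and `β` and moves the
constraints to the images. Results on messages about `α` thus carry over to messages about `β`. -/
theorem blockKer_revInv (c : ℕ) (T : Finset Ω) (η : Equiv.Perm Ω) (α β : Fin c → Equiv.Perm Ω) :
    blockKer c T η α β = blockKer c (T.map η.toEmbedding) η⁻¹ (revInv c β) (revInv c α) := by
  have e1 : altWord c (revInv c β) (revInv c α) = (altWord c α β)⁻¹ := (inv_altWord c α β).symm
  have e2 : (stab (T.map η.toEmbedding)).card = (stab T).card := by
    rw [card_stab, card_stab, card_map]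
  unfold blockKer
  rw [e1, e2]
  refine if_congr ?_ rfl rfl
  simp only [mem_map_equiv, Equiv.Perm.inv_eq_iff_eq]
  constructor
  · intro h x hx
    have := h _ hx
    simp only [Equiv.apply_symm_apply] at this
    exact this.symm
  · intro h x hx
    have := h (η x) (by simpa using hx)
    simpa using this.symm

theorem sum_blockKer_left (k : ℕ) (T : Finset Ω) (η : Equiv.Perm Ω)
    (β : Fin (k + 1) → Equiv.Perm Ω) :
    ∑ α, blockKer (k + 1) T η α β = (Fintype.card (Fin (k + 1) → Equiv.Perm Ω) : ℝ)⁻¹ := by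
  rw [sum_congr rfl fun α _ => blockKer_revInv (k + 1) T η α β, (revInv (k + 1)).sum_comp]
  exact sum_blockKer_right _ _ _ _

theorem abs_blockKer_sub_le' {Λ : Type} [Fintype Λ] (p : ℕ) (hp : 1 ≤ p)
    (hΛ : Fintype.card Λ ≤ 2 ^ p) (k g : ℕ) (hg : 1 ≤ g) (T : Finset Ω)
    (hT : T.card + g ≤ Fintype.card Ω) (η : Equiv.Perm Ω)
    (M : (Fin (k + 1) → Equiv.Perm Ω) → Λ) (φ : Λ → (Fin (k + 1) → Equiv.Perm Ω) → ℝ)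
    (hφ : ∀ μ α, 0 ≤ φ μ α ∧ φ μ α ≤ 1) :
    |∑ β, ∑ α, blockKer (k + 1) T η α β * φ (M β) α - 𝔼 β, 𝔼 α, φ (M β) α|
      ≤ T.card * (4 * √(Fintype.card Ω * (4 * p / (g : ℝ)) ^ k)) := by
  have h := abs_blockKer_sub_le p hp hΛ k g hg (T.map η.toEmbedding) (by rwa [card_map]) η⁻¹
    (fun β => M ((revInv (k + 1)).symm β)) (fun μ α => φ μ ((revInv (k + 1)).symm α))
    fun _ _ => hφ _ _
  rw [card_map] at h
  have e1 : ∑ β, ∑ α, blockKer (k + 1) T η α β * φ (M β) α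
      = ∑ β, ∑ α, blockKer (k + 1) (T.map η.toEmbedding) η⁻¹ β α *
        φ (M ((revInv (k + 1)).symm β)) ((revInv (k + 1)).symm α) := by
    refine Fintype.sum_equiv (revInv (k + 1)) _ _ fun β => ?_
    refine Fintype.sum_equiv (revInv (k + 1)) _ _ fun α => ?_
    rw [blockKer_revInv]
    simp
  have e2 : 𝔼 β, 𝔼 α, φ (M β) α = 𝔼 β, 𝔼 α,
      φ (M ((revInv (k + 1)).symm β)) ((revInv (k + 1)).symm α) := by
    refine Fintype.expect_equiv (revInv (k + 1)) _ _ fun β => ?_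
    exact Fintype.expect_equiv (revInv (k + 1)) _ _ fun α => by simp
  rw [e1, e2]
  exact h

end Block

/-- A constant message leaves only the marginal of `y`, which is uniform. -/
theorem hides_of_subsingleton {Λ A X Y : Type} [Subsingleton Λ] [Fintype X] [Fintype Y]
    [Nonempty X] (K : A → X → Y → ℝ)
    (hK : ∀ h y, ∑ x, K h x y = (Fintype.card Y : ℝ)⁻¹) : Hides Λ K 0 := by
  intro h M φ _
  obtain ⟨x₀⟩ := ‹Nonempty X›
  have hM : ∀ x, M x = M x₀ := fun x => Subsingleton.elim _ _
  simp only [hM]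
  rw [sum_comm]
  simp only [← sum_mul, hK]
  have : Nonempty X := ⟨x₀⟩
  rw [Fintype.expect_const, Fintype.expect_eq_sum_div_card, ← mul_sum, div_eq_inv_mul, sub_self,
    abs_zero]

/-! ### Levels of nested block graphs -/

/-- The number of edge layers after `k` nestings. -/
def numEdges (c k : ℕ) : ℕ := (2 * c) ^ k

/-- An edge layer of level `k + 1` is the `j`-th one of a player in the block of an edge layer of
level `k`; Bob is `false` and Alice is `true`. -/
def edgeEquiv (c k : ℕ) : (Fin (numEdges c k) × Fin c) × Bool ≃ Fin (numEdges c (k + 1)) :=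
  ((finProdFinEquiv.prodCongr finTwoEquiv.symm).trans finProdFinEquiv).trans
    (finCongr (by rw [numEdges, numEdges, pow_succ]; ring))

theorem edgeEquiv_val (c k : ℕ) (i : Fin (numEdges c k)) (j : Fin c) (b : Bool) :
    (edgeEquiv c k ((i, j), b) : ℕ) = 2 * c * i + 2 * j + b.toNat := by
  cases b <;> simp [edgeEquiv, finTwoEquiv] <;> ring

/-- The sizes of the vertex layers after `k` nestings. -/
def layerSize (c : ℕ) (S : ℕ → ℕ) : ℕ → ℕ → ℕ
  | 0, _ => S 0
  | k + 1, e => if 2 * c ∣ e then layerSize c S k (e / (2 * c)) else S (k + 1)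

/-- The points of layer size `a` that `h` maps to a layer of size `b`. -/
def constrained {s s' : ℕ} (hs : s' ≤ s) (a b : ℕ) (h : Equiv.Perm (Fin s')) : Finset (Fin s) :=
  (univ.filter fun u : Fin s' => (u : ℕ) < a ∧ (h u : ℕ) < b).map (Fin.castLEEmb hs)

/-- The extension of a permutation by the identity. -/
def extendPerm {s s' : ℕ} (hs : s' ≤ s) (h : Equiv.Perm (Fin s')) : Equiv.Perm (Fin s) :=
  h.viaFintypeEmbedding (Fin.castLEEmb hs)

theorem extendPerm_castLE {s s' : ℕ} (hs : s' ≤ s) (h : Equiv.Perm (Fin s')) (u : Fin s') :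
    extendPerm hs h (Fin.castLE hs u) = Fin.castLE hs (h u) :=
  h.viaFintypeEmbedding_apply_image (Fin.castLEEmb hs) u

/-- The law of the block that replaces an edge layer `h` between layers of sizes `a` and `b`. -/
noncomputable def edgeKer (c : ℕ) {s s' : ℕ} (hs : s' ≤ s) (a b : ℕ) (h : Equiv.Perm (Fin s'))
    (α β : Fin c → Equiv.Perm (Fin s)) : ℝ :=
  blockKer c (constrained hs a b h) (extendPerm hs h) α β

/-- The law of the permutations along a nested block graph with final matching `Z`. -/
noncomputable def levelDist (c : ℕ) {S : ℕ → ℕ} (hS : Monotone S) (Z : Equiv.Perm (Fin (S 0))) :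
    (k : ℕ) → (Fin (numEdges c k) → Equiv.Perm (Fin (S k))) → ℝ
  | 0, g => if g ⟨0, by simp [numEdges]⟩ = Z then 1 else 0
  | k + 1, g => ∑ h : Fin (numEdges c k) → Equiv.Perm (Fin (S k)), levelDist c hS Z k h *
      ∏ i : Fin (numEdges c k), edgeKer c (hS k.le_succ) (layerSize c S k i)
        (layerSize c S k (i + 1)) (h i) (fun j => g (edgeEquiv c k ((i, j), false)))
        (fun j => g (edgeEquiv c k ((i, j), true)))

/-- The graph in which player `p` holds `x` and the other player holds `y`. -/
def joinEquiv (c k : ℕ) (P : Type) (p : Bool) :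
    (Fin (numEdges c k) × Fin c → P) × (Fin (numEdges c k) × Fin c → P) ≃
      (Fin (numEdges c (k + 1)) → P) where
  toFun xy e := if ((edgeEquiv c k).symm e).2 = p then xy.1 ((edgeEquiv c k).symm e).1
    else xy.2 ((edgeEquiv c k).symm e).1
  invFun g := (fun q => g (edgeEquiv c k (q, p)), fun q => g (edgeEquiv c k (q, !p)))
  left_inv xy := by ext q <;> simp
  right_inv g := by
    funext e
    obtain ⟨⟨q, b⟩, rfl⟩ := (edgeEquiv c k).surjective e
    simp only [Equiv.symm_apply_apply]
    split_ifs with h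
    · rw [h]
    · rw [Bool.eq_not_of_ne h]

theorem joinEquiv_apply {c k : ℕ} {P : Type} (p : Bool)
    (x y : Fin (numEdges c k) × Fin c → P) (q : Fin (numEdges c k) × Fin c) (b : Bool) :
    joinEquiv c k P p (x, y) (edgeEquiv c k (q, b)) = if b = p then x q else y q := by
  simp [joinEquiv]

theorem joinEquiv_not {c k : ℕ} {P : Type} (p : Bool)
    (x y : Fin (numEdges c k) × Fin c → P) :
    joinEquiv c k P (!p) (x, y) = joinEquiv c k P p (y, x) := by
  funext e
  obtain ⟨⟨q, b⟩, rfl⟩ := (edgeEquiv c k).surjective e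
  rw [joinEquiv_apply, joinEquiv_apply]
  cases b <;> cases p <;> rfl

/-- `edgeKer` with the part of player `p` first. -/
noncomputable def playerKer (p : Bool) (c : ℕ) {s s' : ℕ} (hs : s' ≤ s) (a b : ℕ)
    (h : Equiv.Perm (Fin s')) (x y : Fin c → Equiv.Perm (Fin s)) : ℝ :=
  if p then edgeKer c hs a b h y x else edgeKer c hs a b h x y

theorem playerKer_nonneg (p : Bool) (c : ℕ) {s s' : ℕ} (hs : s' ≤ s) (a b : ℕ)
    (h : Equiv.Perm (Fin s')) (x y : Fin c → Equiv.Perm (Fin s)) :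
    0 ≤ playerKer p c hs a b h x y := by
  unfold playerKer edgeKer; split_ifs <;> exact blockKer_nonneg _ _ _ _ _

theorem sum_playerKer_right (p : Bool) {c : ℕ} (hc : 0 < c) {s s' : ℕ} (hs : s' ≤ s) (a b : ℕ)
    (h : Equiv.Perm (Fin s')) (x : Fin c → Equiv.Perm (Fin s)) :
    ∑ y, playerKer p c hs a b h x y = (Fintype.card (Fin c → Equiv.Perm (Fin s)) : ℝ)⁻¹ := by
  obtain ⟨k, rfl⟩ : ∃ k, c = k + 1 := ⟨c - 1, by omega⟩
  cases p
  · exact sum_blockKer_right _ _ _ _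
  · exact sum_blockKer_left _ _ _ _

theorem sum_playerKer_left (p : Bool) {c : ℕ} (hc : 0 < c) {s s' : ℕ} (hs : s' ≤ s) (a b : ℕ)
    (h : Equiv.Perm (Fin s')) (y : Fin c → Equiv.Perm (Fin s)) :
    ∑ x, playerKer p c hs a b h x y = (Fintype.card (Fin c → Equiv.Perm (Fin s)) : ℝ)⁻¹ := by
  obtain ⟨k, rfl⟩ : ∃ k, c = k + 1 := ⟨c - 1, by omega⟩
  cases p
  · exact sum_blockKer_left _ _ _ _
  · exact sum_blockKer_right _ _ _ _

theorem sum_sum_playerKer (p : Bool) {c : ℕ} (hc : 0 < c) {s s' : ℕ} (hs : s' ≤ s) (a b : ℕ)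
    (h : Equiv.Perm (Fin s')) : ∑ x, ∑ y, playerKer p c hs a b h x y = 1 := by
  simp only [sum_playerKer_right p hc]
  simp

theorem sum_sumElim {ι ι₁ ι₂ P : Type} [Fintype ι] [Fintype ι₁] [Fintype ι₂] [DecidableEq ι]
    [DecidableEq ι₁] [DecidableEq ι₂] [Fintype P] (e : ι₁ ⊕ ι₂ ≃ ι) (f : (ι → P) → ℝ) :
    ∑ x, f x = ∑ x₁ : ι₁ → P, ∑ x₂ : ι₂ → P, f fun i => Sum.elim x₁ x₂ (e.symm i) := by
  rw [← Fintype.sum_prod_type']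
  symm
  exact Fintype.sum_equiv ((Equiv.sumArrowEquivProdArrow ι₁ ι₂ P).symm.trans
    (e.arrowCongr (Equiv.refl P))) _ _ fun x => rfl

theorem sum_blocks {ι ι₁ ι₂ A X Y : Type} [Fintype ι] [Fintype ι₁] [Fintype ι₂] [DecidableEq ι]
    [DecidableEq ι₁] [DecidableEq ι₂] [Fintype X] [Fintype Y] (e : ι₁ ⊕ ι₂ ≃ ι)
    (ker : ι → A → X → Y → ℝ) (h : ι₁ → A) (h' : ι₂ → A) (F : (ι → X) → (ι → Y) → ℝ) :
    ∑ x, ∑ y, (∏ i, ker i (Sum.elim h h' (e.symm i)) (x i) (y i)) * F x y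
      = ∑ x₁ : ι₁ → X, ∑ y₁ : ι₁ → Y, (∏ i, ker (e (Sum.inl i)) (h i) (x₁ i) (y₁ i)) *
        ∑ x₂ : ι₂ → X, ∑ y₂ : ι₂ → Y, (∏ i, ker (e (Sum.inr i)) (h' i) (x₂ i) (y₂ i)) *
          F (fun i => Sum.elim x₁ x₂ (e.symm i)) (fun i => Sum.elim y₁ y₂ (e.symm i)) := by
  rw [sum_sumElim e]
  refine sum_congr rfl fun x₁ _ => ?_
  simp only [mul_sum]
  rw [sum_comm (s := (univ : Finset (ι₁ → Y)))]
  refine sum_congr rfl fun x₂ _ => ?_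
  rw [sum_sumElim e]
  refine sum_congr rfl fun y₁ _ => sum_congr rfl fun y₂ _ => ?_
  rw [← e.prod_comp, Fintype.prod_sum_type]
  simp [mul_assoc]

/-- `ι₁` stands for the layers of the speaker, the only ones whose hiding error is charged. For the
layers `ι₂` of the listener, the uniform marginal of `x` suffices. -/
theorem indist_blocks {Λ ι ι₁ ι₂ A X Y : Type} [Fintype ι] [Fintype ι₁] [Fintype ι₂]
    [DecidableEq ι] [DecidableEq ι₁] [DecidableEq ι₂] [Fintype A] [Fintype X] [Fintype Y]
    [Nonempty X] [Nonempty Y] {ρ : ℕ} {W W' : (ι → A) → ℝ} {δ δ' : ℝ}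
    {ker : ι → A → X → Y → ℝ} (e : ι₁ ⊕ ι₂ ≃ ι)
    (hW0 : ∀ h, 0 ≤ W h) (hW1 : ∑ h, W h = 1) (hW0' : ∀ h, 0 ≤ W' h) (hW1' : ∑ h, W' h = 1)
    (hk0 : ∀ i h x y, 0 ≤ ker i h x y)
    (hk1 : ∀ i h x, ∑ y, ker i h x y = (Fintype.card X : ℝ)⁻¹) (hide : ∀ i, Hides Λ (ker i) δ)
    (hI : Indist Λ ρ (fun (h' : ι₂ → A) (h : ι₁ → A) =>
      W (fun i => Sum.elim h h' (e.symm i)) - W' (fun i => Sum.elim h h' (e.symm i))) δ')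
    (F : (ι → X) → (ι → Y) → ℝ) (hF : Prot Λ (ρ + 1) F) :
    ∑ h, (W h - W' h) * ∑ x, ∑ y, (∏ i, ker i (h i) (x i) (y i)) * F x y
      ≤ δ' + 2 * (Fintype.card ι₁ * δ) := by
  have hF' : Prot Λ (ρ + 1) (fun (x : (ι₁ → X) × (ι₂ → X)) (y : (ι₁ → Y) × (ι₂ → Y)) =>
      F (fun i => Sum.elim x.1 x.2 (e.symm i)) (fun i => Sum.elim y.1 y.2 (e.symm i))) :=
    hF.comp (fun (x : (ι₁ → X) × (ι₂ → X)) i => Sum.elim x.1 x.2 (e.symm i))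
      (fun (y : (ι₁ → Y) × (ι₂ → Y)) i => Sum.elim y.1 y.2 (e.symm i))
  have hW1s : ∑ h : ι₁ → A, ∑ h' : ι₂ → A, W (fun i => Sum.elim h h' (e.symm i)) = 1 := by
    rw [← hW1, sum_sumElim e]
  have hW1s' : ∑ h : ι₁ → A, ∑ h' : ι₂ → A, W' (fun i => Sum.elim h h' (e.symm i)) = 1 := by
    rw [← hW1', sum_sumElim e]
  let K₁ : (ι₁ → A) → (ι₁ → X) → (ι₁ → Y) → ℝ := fun h x y =>
    ∏ i, ker (e (Sum.inl i)) (h i) (x i) (y i)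
  let K₂ : (ι₂ → A) → (ι₂ → X) → (ι₂ → Y) → ℝ := fun h x y =>
    ∏ i, ker (e (Sum.inr i)) (h i) (x i) (y i)
  have hK₁ : Hides Λ K₁ (Fintype.card ι₁ * δ) :=
    hides_pi (fun i => ker (e (Sum.inl i))) (fun i h x y => hk0 _ _ _ _)
      (fun i h => by simp [hk1]) fun i => hide _
  have hK₂ : ∀ h x, ∑ y, K₂ h x y = (Fintype.card (ι₂ → X) : ℝ)⁻¹ := by
    intro h x
    have := sum_prod_pi fun i y => ker (e (Sum.inr i)) (h i) (x i) y
    simp only [K₂]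
    rw [this]
    simp [hk1]
  have key := indist_step (fun h h' => hW0 _) hW1s (fun h h' => hW0' _) hW1s'
    K₁ (fun h x y => prod_nonneg fun i _ => hk0 _ _ _ _) hK₁
    K₂ (fun h x y => prod_nonneg fun i _ => hk0 _ _ _ _) hK₂ hI _ hF'
  refine le_trans (le_of_eq ?_) key
  rw [sum_sumElim e]
  refine sum_congr rfl fun h _ => sum_congr rfl fun h' _ => ?_
  rw [sum_blocks]

/-! ### Round elimination down the levels -/

section Step

variable {c k : ℕ} {S : ℕ → ℕ} (hS : Monotone S)

theorem levelDist_join (Z : Equiv.Perm (Fin (S 0))) (p : Bool)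
    (x y : Fin (numEdges c k) × Fin c → Equiv.Perm (Fin (S (k + 1)))) :
    levelDist c hS Z (k + 1) (joinEquiv c k _ p (x, y))
      = ∑ h : Fin (numEdges c k) → Equiv.Perm (Fin (S k)), levelDist c hS Z k h *
        ∏ i : Fin (numEdges c k), playerKer p c (hS k.le_succ) (layerSize c S k i)
          (layerSize c S k (i + 1)) (h i) (fun j => x (i, j)) (fun j => y (i, j)) := by
  rw [levelDist]
  refine sum_congr rfl fun h _ => ?_
  congr 1
  refine prod_congr rfl fun i _ => ?_
  simp only [joinEquiv_apply]
  cases p <;> simp [playerKer]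

theorem levelDist_nonneg (Z : Equiv.Perm (Fin (S 0))) (k : ℕ)
    (g : Fin (numEdges c k) → Equiv.Perm (Fin (S k))) : 0 ≤ levelDist c hS Z k g := by
  induction k with
  | zero => unfold levelDist; split_ifs <;> simp
  | succ k ih =>
    rw [levelDist]
    exact sum_nonneg fun h _ => mul_nonneg (ih h) (prod_nonneg fun i _ => blockKer_nonneg _ _ _ _ _)

theorem sum_curry {ι P : Type} [Fintype ι] [DecidableEq ι] [Fintype P]
    (f : (ι × Fin c → P) → ℝ) :
    ∑ x, f x = ∑ x : ι → Fin c → P, f fun q => x q.1 q.2 :=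
  Fintype.sum_equiv (Equiv.curry _ _ _) _ _ fun _ => rfl

theorem sum_levelDist (hc : 0 < c) (Z : Equiv.Perm (Fin (S 0))) (k : ℕ) :
    ∑ g, levelDist c hS Z k g = 1 := by
  induction k with
  | zero =>
    have : Unique (Fin (numEdges c 0)) := inferInstanceAs (Unique (Fin 1))
    simp only [levelDist]
    rw [sum_eq_single fun _ => Z]
    · simp
    · intro g _ hg
      refine if_neg fun h => hg ?_
      funext i
      rw [← h]
      exact congrArg g (Subsingleton.elim _ _)
    · simp
  | succ k ih =>
    rw [← (joinEquiv c k _ false).sum_comp, Fintype.sum_prod_type]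
    simp only [levelDist_join]
    rw [sum_congr rfl fun x _ => sum_comm, sum_comm]
    simp only [← mul_sum]
    rw [← ih]
    refine sum_congr rfl fun h _ => ?_
    rw [sum_curry]
    rw [sum_congr rfl fun x _ => sum_curry _]
    rw [sum_sum_prod_pi fun (i : Fin (numEdges c k)) x y => playerKer false c (hS k.le_succ)
      (layerSize c S k i) (layerSize c S k (i + 1)) (h i) x y]
    simp [sum_sum_playerKer false hc]

/-- All edge layers of level `k` are hidden by their blocks. -/
def LevelHides (Λ : Type) (c : ℕ) {S : ℕ → ℕ} (hS : Monotone S) (k : ℕ) (δ : ℝ) : Prop :=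
  ∀ (p : Bool) (i : Fin (numEdges c k)), Hides Λ (playerKer p c (hS k.le_succ)
    (layerSize c S k i) (layerSize c S k (i + 1))) δ

theorem level_step {Λ : Type} (hc : 0 < c) {δ δ' : ℝ} (hide : LevelHides Λ c hS k δ)
    {ι₁ ι₂ : Type} [Fintype ι₁] [Fintype ι₂] [DecidableEq ι₁] [DecidableEq ι₂]
    (e : ι₁ ⊕ ι₂ ≃ Fin (numEdges c k)) (ρ : ℕ) (Y N : Equiv.Perm (Fin (S 0))) (p : Bool)
    (hI : Indist Λ ρ (fun (h' : ι₂ → Equiv.Perm (Fin (S k))) (h : ι₁ → Equiv.Perm (Fin (S k))) =>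
      levelDist c hS Y k (fun i => Sum.elim h h' (e.symm i)) -
        levelDist c hS N k (fun i => Sum.elim h h' (e.symm i))) δ') :
    Indist Λ (ρ + 1) (fun x y => levelDist c hS Y (k + 1) (joinEquiv c k _ p (x, y)) -
      levelDist c hS N (k + 1) (joinEquiv c k _ p (x, y)))
      (δ' + 2 * (Fintype.card ι₁ * δ)) := by
  intro F hF
  let ker : Fin (numEdges c k) → Equiv.Perm (Fin (S k)) → (Fin c → Equiv.Perm (Fin (S (k + 1)))) →
      (Fin c → Equiv.Perm (Fin (S (k + 1)))) → ℝ := fun i => playerKer p c (hS k.le_succ)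
    (layerSize c S k i) (layerSize c S k (i + 1))
  have hF' := hF.comp
    (fun (x : Fin (numEdges c k) → Fin c → Equiv.Perm (Fin (S (k + 1)))) q => x q.1 q.2)
    (fun (y : Fin (numEdges c k) → Fin c → Equiv.Perm (Fin (S (k + 1)))) q => y q.1 q.2)
  have key := indist_blocks (ker := ker) e
    (fun h => levelDist_nonneg hS Y k h) (sum_levelDist hS hc Y k)
    (fun h => levelDist_nonneg hS N k h) (sum_levelDist hS hc N k)
    (fun i h x y => playerKer_nonneg _ _ _ _ _ _ _ _)
    (fun i h x => sum_playerKer_right p hc _ _ _ _ _) (fun i => hide p i) hI _ hF'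
  refine le_trans (le_of_eq ?_) key
  calc ∑ x, ∑ y, (levelDist c hS Y (k + 1) (joinEquiv c k _ p (x, y)) -
        levelDist c hS N (k + 1) (joinEquiv c k _ p (x, y))) * F x y
      = ∑ h, ∑ x, ∑ y, (levelDist c hS Y k h - levelDist c hS N k h) *
          ((∏ i, ker i (h i) (fun j => x (i, j)) (fun j => y (i, j))) * F x y) := by
        simp only [levelDist_join, ← sum_sub_distrib, sum_mul]
        rw [sum_congr rfl fun x _ => sum_comm, sum_comm]
        refine sum_congr rfl fun h _ => sum_congr rfl fun x _ => sum_congr rfl fun y _ => ?_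
        simp only [ker]
        ring
    _ = _ := by
        refine sum_congr rfl fun h _ => ?_
        simp only [← mul_sum]
        congr 1
        rw [sum_curry]
        refine sum_congr rfl fun x _ => ?_
        rw [sum_curry]

theorem level_indist {Λ : Type} (hc : 0 < c) {δ : ℝ} (hδ : 0 ≤ δ) (r : ℕ)
    (hide : ∀ k < r, LevelHides Λ c hS k δ) (Y N : Equiv.Perm (Fin (S 0))) (k : ℕ) (hk : k < r)
    (p : Bool) :
    Indist Λ (k + 1) (fun x y => levelDist c hS Y (k + 1) (joinEquiv c k _ p (x, y)) -
      levelDist c hS N (k + 1) (joinEquiv c k _ p (x, y)))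
      (∑ i ∈ range (k + 1), 2 * (numEdges c i * δ)) := by
  induction k generalizing p with
  | zero =>
    -- The only layer of level 0 is given to the speaker. With no round left the other player
    -- answers from an empty input, and both distributions have mass 1.
    have h1 := level_step hS hc (hide 0 hk) (ι₁ := Fin (numEdges c 0)) (ι₂ := Empty)
      (Equiv.sumEmpty _ _) 0 Y N p (δ' := 0) (by
        rintro F ⟨φ, -, hφ⟩
        refine le_of_eq ?_
        simp only [hφ, ← sum_mul, sum_sub_distrib]
        refine sum_eq_zero fun h' _ => ?_
        have := sum_levelDist hS hc Y 0
        have := sum_levelDist hS hc N 0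
        simp_all)
    simpa using h1
  | succ k ih =>
    -- The layers of the speaker `p` come first, then those of `!p`.
    let e : (Fin (numEdges c k) × Fin c) ⊕ (Fin (numEdges c k) × Fin c) ≃
        Fin (numEdges c (k + 1)) :=
      (((Equiv.boolProdEquivSum _).symm.trans (Equiv.prodComm _ _)).trans
        ((Equiv.refl _).prodCongr (if p then Equiv.boolNot else Equiv.refl _))).trans
        (edgeEquiv c k)
    have he : ∀ {P : Type} (h h' : Fin (numEdges c k) × Fin c → P),
        (fun i => Sum.elim h h' (e.symm i)) = joinEquiv c k P p (h, h') := by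
      intro P h h'
      funext i
      obtain ⟨z, rfl⟩ := e.surjective i
      rw [Equiv.symm_apply_apply]
      rcases z with z | z
      · have : e (Sum.inl z) = edgeEquiv c k (z, p) := by cases p <;> rfl
        rw [this, joinEquiv_apply, if_pos rfl]; rfl
      · have : e (Sum.inr z) = edgeEquiv c k (z, !p) := by cases p <;> rfl
        rw [this, joinEquiv_apply, if_neg (by cases p <;> simp)]; rfl
    have h1 := level_step hS hc (hide (k + 1) hk) e (k + 1) Y N p
      (δ' := ∑ i ∈ range (k + 1), 2 * (numEdges c i * δ)) (by
        simp only [he, ← joinEquiv_not p]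
        exact ih (by omega) (!p))
    intro F hF
    refine (h1 F hF).trans ?_
    rw [sum_range_succ _ (k + 1)]
    have hcard : Fintype.card (Fin (numEdges c k) × Fin c) ≤ numEdges c (k + 1) := by
      rw [Fintype.card_prod, Fintype.card_fin, Fintype.card_fin, numEdges, numEdges, pow_succ]
      exact Nat.mul_le_mul_left _ (by omega)
    have : (Fintype.card (Fin (numEdges c k) × Fin c) : ℝ) ≤ numEdges c (k + 1) := by
      exact_mod_cast hcard
    gcongr

end Step

/-! ### Partial maps and their compositions -/

/-- The restriction of a permutation to arguments below `a` and values below `b`. -/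
def pmap {s : ℕ} (a b : ℕ) (σ : Equiv.Perm (Fin s)) (u : ℕ) : Option ℕ :=
  if h : u < s then (if u < a ∧ (σ ⟨u, h⟩ : ℕ) < b then some (σ ⟨u, h⟩ : ℕ) else none) else none

theorem pmap_eq_some {s a b : ℕ} {σ : Equiv.Perm (Fin s)} {u w : ℕ} :
    pmap a b σ u = some w ↔ ∃ h : u < s, u < a ∧ w < b ∧ (σ ⟨u, h⟩ : ℕ) = w := by
  unfold pmap
  split_ifs with h h'
  · simp only [Option.some.injEq]
    exact ⟨fun e => ⟨h, h'.1, e ▸ h'.2, e⟩, fun ⟨_, _, _, e⟩ => e⟩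
  · simp only [false_iff]
    rintro ⟨_, h1, h2, rfl⟩
    exact h' ⟨h1, h2⟩
  · simp only [false_iff]
    rintro ⟨h1, _⟩
    exact h h1

/-- `F` is a matching of size `min a b` between `{0, …, a - 1}` and `{0, …, b - 1}`. -/
structure IsMat (a b : ℕ) (F : ℕ → Option ℕ) : Prop where
  lt : ∀ {u w}, F u = some w → u < a ∧ w < b
  inj : ∀ {u u' w}, F u = some w → F u' = some w → u = u'
  total : a ≤ b → ∀ u < a, ∃ w, F u = some w
  surj : b ≤ a → ∀ w < b, ∃ u, F u = some w

/-- One of the two layers has to be full; otherwise the truncation could cost more edges than the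
smaller layer allows. -/
theorem isMat_pmap {s a b : ℕ} (σ : Equiv.Perm (Fin s)) (ha : a ≤ s) (hb : b ≤ s)
    (hab : a = s ∨ b = s) : IsMat a b (pmap a b σ) where
  lt h := by obtain ⟨_, h1, h2, _⟩ := pmap_eq_some.1 h; exact ⟨h1, h2⟩
  inj h h' := by
    obtain ⟨_, _, _, e⟩ := pmap_eq_some.1 h
    obtain ⟨_, _, _, e'⟩ := pmap_eq_some.1 h'
    have := σ.injective (Fin.ext (e.trans e'.symm))
    simpa using this
  total h u hu := by
    have hs : u < s := hu.trans_le ha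
    exact ⟨_, pmap_eq_some.2 ⟨hs, hu, by have := (σ ⟨u, hs⟩).2; omega, rfl⟩⟩
  surj h w hw := by
    have hs : w < s := hw.trans_le hb
    refine ⟨(σ.symm ⟨w, hs⟩ : Fin s), pmap_eq_some.2 ⟨(σ.symm ⟨w, hs⟩).2, ?_, hw, by simp⟩⟩
    have := (σ.symm ⟨w, hs⟩).2
    omega

/-- The partial injection is extended to a permutation. Truncating the permutation again creates no
new edge because `F` already covers the smaller layer. -/
theorem exists_pmap {s a b : ℕ} {F : ℕ → Option ℕ} (hF : IsMat a b F) (ha : a ≤ s) (hb : b ≤ s) :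
    ∃ σ : Equiv.Perm (Fin s), pmap a b σ = F := by
  classical
  let f : Fin s → Fin s := fun u => if h : ∃ w, F u = some w then
    ⟨h.choose, (hF.lt h.choose_spec).2.trans_le hb⟩ else u
  have hf : ∀ (u : Fin s) (w : ℕ), F u = some w → (f u : ℕ) = w := by
    intro u w h
    have hex : ∃ w, F u = some w := ⟨w, h⟩
    have h1 : f u = ⟨hex.choose, (hF.lt hex.choose_spec).2.trans_le hb⟩ := dif_pos hex
    rw [h1]
    exact (Option.some.inj (h.symm.trans hex.choose_spec)).symm
  obtain ⟨g, hg⟩ := Finset.exists_equiv_extend_of_card_eq (α := Fin s)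
    (t := (univ : Finset (Fin s))) rfl
    (s := univ.filter fun u : Fin s => ∃ w, F u = some w) (f := f) (subset_univ _) (by
      intro u hu v hv huv
      simp only [coe_filter, mem_univ, true_and, Set.mem_ofPred_eq] at hu hv
      obtain ⟨w, hw⟩ := hu
      obtain ⟨w', hw'⟩ := hv
      have : w = w' := by rw [← hf u w hw, ← hf v w' hw', huv]
      subst this
      exact Fin.ext (hF.inj hw hw'))
  let σ : Equiv.Perm (Fin s) := g.trans (Equiv.subtypeUnivEquiv (by simp))
  have hσ : ∀ (u : Fin s) (w : ℕ), F u = some w → (σ u : ℕ) = w := by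
    intro u w h
    rw [← hf u w h, ← hg u (by simp [h])]
    rfl
  refine ⟨σ, ?_⟩
  funext u
  refine Option.ext fun w => ?_
  rw [pmap_eq_some]
  constructor
  · rintro ⟨hs, hu, hw, e⟩
    rcases le_total a b with h | h
    · obtain ⟨w', hw'⟩ := hF.total h u hu
      rw [hw', ← e, hσ ⟨u, hs⟩ w' hw']
    · obtain ⟨u', hu'⟩ := hF.surj h w hw
      have hs' : u' < s := (hF.lt hu').1.trans_le ha
      have := σ.injective (Fin.ext ((hσ ⟨u', hs'⟩ w hu').trans e.symm))
      simp only [Fin.mk.injEq] at this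
      rwa [← this]
  · intro h
    obtain ⟨h1, h2⟩ := hF.lt h
    exact ⟨h1.trans_le ha, h1, h2, hσ ⟨u, _⟩ w h⟩

/-- The size of the domain of `F` below `a`. -/
def domCard (a : ℕ) (F : ℕ → Option ℕ) : ℕ := ((range a).filter fun u => (F u).isSome).card

theorem isMat_of_le_domCard {a b : ℕ} {F : ℕ → Option ℕ}
    (lt : ∀ {u w}, F u = some w → u < a ∧ w < b)
    (inj : ∀ {u u' w}, F u = some w → F u' = some w → u = u')
    (h : a ≤ domCard a F ∨ b ≤ domCard a F) : IsMat a b F where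
  lt := lt
  inj := inj
  total hab u hu := by
    have h1 : (range a).card ≤ domCard a F := by rw [card_range]; omega
    have h2 := eq_of_subset_of_card_le (filter_subset _ _) h1
    have h3 : u ∈ (range a).filter fun u => (F u).isSome := by rw [h2]; simpa
    exact Option.isSome_iff_exists.1 (mem_filter.1 h3).2
  surj hab w hw := by
    let D := (range a).filter fun u => (F u).isSome
    have h1 : D.image (fun u => (F u).getD 0) ⊆ range b := by
      intro w hw
      obtain ⟨u, hu, rfl⟩ := mem_image.1 hw
      obtain ⟨w, hw⟩ := Option.isSome_iff_exists.1 (mem_filter.1 hu).2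
      simpa [hw] using (lt hw).2
    have h2 : (D.image fun u => (F u).getD 0).card = D.card := by
      refine card_image_of_injOn fun u hu v hv huv => ?_
      obtain ⟨w, hw⟩ := Option.isSome_iff_exists.1 (mem_filter.1 hu).2
      obtain ⟨w', hw'⟩ := Option.isSome_iff_exists.1 (mem_filter.1 hv).2
      simp only [hw, hw', Option.getD_some] at huv
      subst huv
      exact inj hw hw'
    have h3 : (range b).card ≤ (D.image fun u => (F u).getD 0).card := by
      rw [h2, card_range]
      change b ≤ domCard a F
      omega
    have h4 : w ∈ D.image fun u => (F u).getD 0 := by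
      rw [eq_of_subset_of_card_le h1 h3]; simpa
    obtain ⟨u, hu, rfl⟩ := mem_image.1 h4
    obtain ⟨w, hw⟩ := Option.isSome_iff_exists.1 (mem_filter.1 hu).2
    exact ⟨u, by simp [hw]⟩

/-- The composition of `f i, …, f (i + d - 1)`. -/
def fpath (f : ℕ → ℕ → Option ℕ) (i : ℕ) : ℕ → ℕ → Option ℕ
  | 0, u => some u
  | d + 1, u => (fpath f i d u).bind (f (i + d))

theorem fpath_add (f : ℕ → ℕ → Option ℕ) (i d d' u : ℕ) :
    fpath f i (d + d') u = (fpath f i d u).bind (fpath f (i + d) d') := by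
  induction d' with
  | zero =>
    have : fpath f (i + d) 0 = some := rfl
    simp [this]
  | succ d' ih =>
    rw [← add_assoc, fpath, ih, Option.bind_assoc]
    refine congrArg _ (funext fun w => ?_)
    rw [fpath, add_assoc]

theorem fpath_one (f : ℕ → ℕ → Option ℕ) (i u : ℕ) : fpath f i 1 u = f i u := by
  simp [fpath]

theorem fpath_congr {f f' : ℕ → ℕ → Option ℕ} {i d : ℕ}
    (h : ∀ e, i ≤ e → e < i + d → f e = f' e) : fpath f i d = fpath f' i d := by
  induction d with
  | zero => rfl
  | succ d ih =>
    funext u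
    rw [fpath, fpath, ih fun e h1 h2 => h e h1 (by omega), h (i + d) (by omega) (by omega)]

theorem fpath_mul (f : ℕ → ℕ → Option ℕ) (n i d : ℕ) :
    fpath (fun i => fpath f (n * i) n) i d = fpath f (n * i) (n * d) := by
  induction d with
  | zero => rfl
  | succ d ih =>
    funext u
    rw [fpath, ih, show n * (d + 1) = n * d + n by ring, fpath_add, ← mul_add]

/-! ### Compositions of matchings along the layers -/

section Mats

variable {f : ℕ → ℕ → Option ℕ} {t : ℕ → ℕ} {ℓ : ℕ}

theorem fpath_inj (hf : ∀ e < ℓ, IsMat (t e) (t (e + 1)) (f e)) {i d : ℕ}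
    (h : i + d ≤ ℓ) {u u' w : ℕ} (h1 : fpath f i d u = some w)
    (h2 : fpath f i d u' = some w) : u = u' := by
  induction d generalizing w with
  | zero => exact Option.some.inj (h1.trans h2.symm)
  | succ d ih =>
    rw [fpath, Option.bind_eq_some_iff] at h1 h2
    obtain ⟨v, hv, hw⟩ := h1
    obtain ⟨v', hv', hw'⟩ := h2
    have := (hf (i + d) (by omega)).inj hw hw'
    subst this
    exact ih (by omega) hv hv'

theorem fpath_lt_right (hf : ∀ e < ℓ, IsMat (t e) (t (e + 1)) (f e)) {i d : ℕ}
    (h : i + d ≤ ℓ) {u w : ℕ} (hu : u < t i)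
    (h1 : fpath f i d u = some w) : w < t (i + d) := by
  cases d with
  | zero => simp only [fpath, Option.some.injEq] at h1; simpa [← h1]
  | succ d =>
    rw [fpath, Option.bind_eq_some_iff] at h1
    obtain ⟨v, hv, hw⟩ := h1
    exact ((hf (i + d) (by omega)).lt hw).2

theorem fpath_lt_left (hf : ∀ e < ℓ, IsMat (t e) (t (e + 1)) (f e)) {i d : ℕ}
    (hd : 0 < d) (h : i + d ≤ ℓ) {u w : ℕ}
    (h1 : fpath f i d u = some w) : u < t i := by
  obtain ⟨d, rfl⟩ : ∃ d', d = 1 + d' := ⟨d - 1, by omega⟩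
  rw [fpath_add, fpath_one, Option.bind_eq_some_iff] at h1
  obtain ⟨v, hv, _⟩ := h1
  exact ((hf i (by omega)).lt hv).1

theorem fpath_total (hf : ∀ e < ℓ, IsMat (t e) (t (e + 1)) (f e)) {i d : ℕ}
    (h : i + d ≤ ℓ) (ht : ∀ e, i ≤ e → e < i + d → t e ≤ t (e + 1))
    {u : ℕ} (hu : u < t i) : ∃ w, fpath f i d u = some w := by
  induction d with
  | zero => exact ⟨u, rfl⟩
  | succ d ih =>
    obtain ⟨v, hv⟩ := ih (by omega) fun e h1 h2 => ht e h1 (by omega)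
    obtain ⟨w, hw⟩ := (hf (i + d) (by omega)).total (ht _ (by omega) (by omega)) v
      (fpath_lt_right hf (by omega) hu hv)
    exact ⟨w, by rw [fpath, hv]; exact hw⟩

theorem fpath_surj (hf : ∀ e < ℓ, IsMat (t e) (t (e + 1)) (f e)) {i d : ℕ}
    (h : i + d ≤ ℓ) (ht : ∀ e, i ≤ e → e < i + d → t (e + 1) ≤ t e)
    {w : ℕ} (hw : w < t (i + d)) : ∃ u < t i, fpath f i d u = some w := by
  induction d generalizing w with
  | zero => exact ⟨w, by simpa using hw, rfl⟩
  | succ d ih =>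
    obtain ⟨v, hv⟩ := (hf (i + d) (by omega)).surj (ht _ (by omega) (by omega)) w hw
    obtain ⟨u, hu, hu'⟩ := ih (by omega) (fun e h1 h2 => ht e h1 (by omega))
      ((hf (i + d) (by omega)).lt hv).1
    exact ⟨u, hu, by rw [fpath, hu']; exact hv⟩

theorem domCard_fpath_le (hf : ∀ e < ℓ, IsMat (t e) (t (e + 1)) (f e)) {i d m : ℕ}
    (h : i + d ≤ ℓ) (hm : i ≤ m) (hm' : m ≤ i + d) :
    domCard (t i) (fpath f i d) ≤ t m := by
  obtain ⟨d₁, rfl⟩ := Nat.exists_eq_add_of_le hm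
  obtain ⟨d₂, rfl⟩ : ∃ d₂, d = d₁ + d₂ := ⟨d - d₁, by omega⟩
  have key : ∀ u ∈ (range (t i)).filter fun u => (fpath f i (d₁ + d₂) u).isSome,
      ∃ w, fpath f i d₁ u = some w ∧ w < t (i + d₁) := by
    intro u hu
    obtain ⟨hu, hu'⟩ := mem_filter.1 hu
    obtain ⟨w, hw⟩ := Option.isSome_iff_exists.1 hu'
    rw [fpath_add, Option.bind_eq_some_iff] at hw
    obtain ⟨v, hv, _⟩ := hw
    exact ⟨v, hv, fpath_lt_right hf (by omega) (by simpa using hu) hv⟩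
  rw [domCard, ← card_range (t (i + d₁))]
  refine card_le_card_of_injOn (fun u => (fpath f i d₁ u).getD 0) ?_ ?_
  · intro u hu
    obtain ⟨w, hw, hw'⟩ := key u hu
    simpa [hw] using hw'
  · intro u hu v hv huv
    obtain ⟨w, hw, _⟩ := key u hu
    obtain ⟨w', hw', _⟩ := key v hv
    simp only [hw, hw', Option.getD_some] at huv
    subst huv
    exact fpath_inj hf (by omega) hw hw'

end Mats

/-- Every composition has the largest size that the layer sizes allow. -/
def NiceMaps (t : ℕ → ℕ) (ℓ : ℕ) (f : ℕ → ℕ → Option ℕ) : Prop :=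
  ∀ i d, 0 < d → i + d ≤ ℓ → ∃ m, i ≤ m ∧ m ≤ i + d ∧ t m ≤ domCard (t i) (fpath f i d)

theorem NiceMaps.congr {t : ℕ → ℕ} {ℓ : ℕ} {f f' : ℕ → ℕ → Option ℕ}
    (h : ∀ e < ℓ, f e = f' e) : NiceMaps t ℓ f ↔ NiceMaps t ℓ f' := by
  refine forall₂_congr fun i d => forall₂_congr fun _ hl => ?_
  rw [fpath_congr fun e _ h2 => h e (by omega)]

/-- Contraction of blocks of `n` consecutive layers, all inner ones having the same large size. -/
theorem niceMaps_contract {t t' : ℕ → ℕ} {n ℓ s : ℕ} {f : ℕ → ℕ → Option ℕ} (hn : 0 < n)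
    (hf : ∀ e < n * ℓ, IsMat (t' e) (t' (e + 1)) (f e))
    (ht : ∀ i, t' (n * i) = t i) (hts : ∀ e, ¬ n ∣ e → t' e = s) (hs : ∀ i, t i ≤ s) :
    NiceMaps t' (n * ℓ) f ↔
      (∀ i < ℓ, IsMat (t i) (t (i + 1)) (fpath f (n * i) n)) ∧
        NiceMaps t ℓ fun i => fpath f (n * i) n := by
  have hs' : ∀ e, t' e ≤ s := by
    intro e
    by_cases h : n ∣ e
    · obtain ⟨i, rfl⟩ := h; rw [ht]; exact hs i
    · exact (hts e h).le
  have hmul : ∀ i < ℓ, n * i + n ≤ n * ℓ := fun i hi => by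
    calc n * i + n = n * (i + 1) := by ring
      _ ≤ n * ℓ := Nat.mul_le_mul_left _ hi
  constructor
  · intro h
    have h1 : NiceMaps t ℓ fun i => fpath f (n * i) n := by
      intro i d hd hl
      rw [fpath_mul]
      obtain ⟨m, hm1, hm2, hm⟩ := h (n * i) (n * d) (Nat.mul_pos hn hd)
        (by rw [← mul_add]; exact Nat.mul_le_mul_left _ hl)
      rw [ht] at hm
      by_cases hnm : n ∣ m
      · obtain ⟨m', rfl⟩ := hnm
        rw [← mul_add] at hm2
        refine ⟨m', Nat.le_of_mul_le_mul_left hm1 hn, Nat.le_of_mul_le_mul_left hm2 hn, ?_⟩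
        rwa [ht] at hm
      -- Inner layers have the largest size, so a bound by an inner layer implies the one by the
      -- endpoint `i`.
      · rw [hts m hnm] at hm
        exact ⟨i, le_rfl, by omega, (hs i).trans hm⟩
    refine ⟨fun i hi => isMat_of_le_domCard ?_ ?_ ?_, h1⟩
    · intro u w hw
      have h2 := fpath_lt_left hf hn (hmul i hi) hw
      have h3 := fpath_lt_right hf (hmul i hi) h2 hw
      rw [ht] at h2
      rw [show n * i + n = n * (i + 1) by ring, ht] at h3
      exact ⟨h2, h3⟩
    · exact fun h2 h3 => fpath_inj hf (hmul i hi) h2 h3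
    · obtain ⟨m, hm1, hm2, hm⟩ := h1 i 1 one_pos (by omega)
      have e1 : fpath (fun i => fpath f (n * i) n) i 1 = fpath f (n * i) n := by
        funext u; rw [fpath_one]
      rw [e1] at hm
      obtain rfl | rfl : m = i ∨ m = i + 1 := by omega
      · exact Or.inl hm
      · exact Or.inr hm
  · rintro ⟨-, h⟩ i d hd hl
    -- the first and the last block boundary in the interval
    let i' := (i + n - 1) / n
    let j' := (i + d) / n
    have hi1 : i ≤ n * i' := by
      have h1 := Nat.div_add_mod (i + n - 1) n
      have h2 := Nat.mod_lt (i + n - 1) hn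
      change n * i' + _ = _ at h1
      omega
    have hi2 : n * i' < i + n := by
      have := Nat.mul_div_le (i + n - 1) n
      change n * i' ≤ _ at this
      omega
    have hj1 : n * j' ≤ i + d := Nat.mul_div_le _ _
    have hj2 : i + d < n * j' + n := by
      have h1 := Nat.div_add_mod (i + d) n
      have h2 := Nat.mod_lt (i + d) hn
      change n * j' + _ = _ at h1
      omega
    have hndvd : ∀ q e, n * q < e → e < n * q + n → ¬ n ∣ e := by
      rintro q e h1 h2 ⟨x, rfl⟩
      have h3 := Nat.lt_of_mul_lt_mul_left h1
      rw [show n * q + n = n * (q + 1) by ring] at h2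
      have h4 := Nat.lt_of_mul_lt_mul_left h2
      omega
    by_cases hij : i' ≤ j'
    · obtain ⟨D, hD⟩ := Nat.exists_eq_add_of_le hij
      obtain ⟨d₁, hd₁⟩ := Nat.exists_eq_add_of_le hi1
      obtain ⟨d₃, hd₃⟩ := Nat.exists_eq_add_of_le hj1
      have hnD : n * j' = n * i' + n * D := by rw [hD]; ring
      have hdd : d = d₁ + (n * D + d₃) := by omega
      have hjl : n * j' ≤ n * ℓ := hj1.trans hl
      have hjl' : j' ≤ ℓ := Nat.le_of_mul_le_mul_left hjl hn
      have hmid : ∃ m', i' ≤ m' ∧ m' ≤ j' ∧ t m' ≤ domCard (t i') (fpath f (n * i') (n * D)) := by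
        rcases Nat.eq_zero_or_pos D with h0 | h0
        · refine ⟨i', le_rfl, hij, ?_⟩
          subst h0
          simp [domCard, fpath]
        · have h2 := h i' D h0 (by omega)
          rw [fpath_mul, ← hD] at h2
          exact h2
      obtain ⟨m', hm1, hm2, hm⟩ := hmid
      refine ⟨n * m', ?_, ?_, ?_⟩
      · exact hi1.trans (Nat.mul_le_mul_left _ hm1)
      · exact (Nat.mul_le_mul_left _ hm2).trans hj1
      · rw [ht]
        refine hm.trans ?_
        -- Before the first boundary all layers have size `s`, so every boundary vertex is reached
        -- from layer `i`. Symmetrically, no vertex is lost after the last boundary.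
        have hsurj : ∀ v < t i', ∃ u < t' i, fpath f i d₁ u = some v := by
          intro v hv
          refine fpath_surj hf (by omega) (fun e h1 h2 => ?_) (by rw [← hd₁, ht]; exact hv)
          rw [hts e (fun hdv => ?_)]
          · exact hs' _
          · refine hndvd (i' - 1) e ?_ ?_ hdv
            · have : n * (i' - 1) = n * i' - n := by rw [Nat.mul_sub, mul_one]
              have : i' ≠ 0 := by rintro h0; rw [h0] at hd₁; omega
              have : n ≤ n * i' := Nat.le_mul_of_pos_right _ (Nat.pos_of_ne_zero this)
              omega
            · have : n * (i' - 1) = n * i' - n := by rw [Nat.mul_sub, mul_one]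
              have : i' ≠ 0 := by rintro h0; rw [h0] at hd₁; omega
              have : n ≤ n * i' := Nat.le_mul_of_pos_right _ (Nat.pos_of_ne_zero this)
              omega
        choose! g hg1 hg2 using hsurj
        rw [domCard, domCard]
        refine card_le_card_of_injOn g ?_ ?_
        · intro v hv
          obtain ⟨hv, hv'⟩ := mem_filter.1 hv
          have hv := mem_range.1 hv
          obtain ⟨w, hw⟩ := Option.isSome_iff_exists.1 hv'
          have hw' : w < t' (n * i' + n * D) :=
            fpath_lt_right hf (by omega) (by rwa [ht]) hw
          obtain ⟨z, hz⟩ := fpath_total hf (i := n * i' + n * D) (d := d₃) (by omega)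
            (fun e h1 h2 => by
              by_cases he : e = n * j'
              · have hlt : n * j' < e + 1 := by omega
                rw [hts (e + 1) (hndvd j' _ hlt (by omega))]
                exact hs' _
              · rw [hts (e + 1) (hndvd j' _ (by omega) (by omega))]
                exact hs' _) hw'
          refine mem_coe.2 (mem_filter.2 ⟨mem_range.2 (hg1 v hv), ?_⟩)
          rw [hdd, fpath_add, hg2 v hv, ← hd₁, Option.bind_some, fpath_add, hw, Option.bind_some,
            hz]
          rfl
        · intro v hv v' hv' hvv
          have h1 := hg2 v (mem_range.1 (mem_filter.1 hv).1)
          have h2 := hg2 v' (mem_range.1 (mem_filter.1 hv').1)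
          rw [hvv, h2] at h1
          exact (Option.some.inj h1).symm
    -- No boundary lies in the interval: all its layers have size `s`, and the composition is total.
    · have hij' : n * j' + n ≤ n * i' := by
        calc n * j' + n = n * (j' + 1) := by ring
          _ ≤ _ := Nat.mul_le_mul_left _ (by omega)
      have hinner : ∀ e, i ≤ e → e ≤ i + d → t' e = s := fun e h1 h2 =>
        hts e (hndvd j' e (by omega) (by omega))
      refine ⟨i, le_rfl, by omega, ?_⟩
      have : (range (t' i)).filter (fun u => (fpath f i d u).isSome) = range (t' i) := by
        refine filter_true_of_mem fun u hu => ?_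
        obtain ⟨w, hw⟩ := fpath_total hf hl (fun e h1 h2 => by
          rw [hinner e h1 (by omega), hinner (e + 1) (by omega) (by omega)]) (mem_range.1 hu)
        rw [hw]
        rfl
      rw [domCard, this, card_range]

/-! ### The law of the levels is uniform on nice graphs -/

theorem mem_constrained {s s' : ℕ} (hs : s' ≤ s) (a b : ℕ) (h : Equiv.Perm (Fin s')) (x : Fin s) :
    x ∈ constrained hs a b h ↔
      ∃ u : Fin s', ((u : ℕ) < a ∧ (h u : ℕ) < b) ∧ Fin.castLE hs u = x := by
  simp [constrained]

theorem card_constrained {s s' : ℕ} (hs : s' ≤ s) {a b : ℕ} (h : Equiv.Perm (Fin s'))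
    (ha : a ≤ s') (hb : b ≤ s') (hab : a = s' ∨ b = s') :
    (constrained hs a b h).card = min a b := by
  have hlt : ∀ {n d : ℕ}, d ≤ n → (univ.filter fun u : Fin n => (u : ℕ) < d).card = d := by
    intro n d hd
    rw [Fin.card_filter_val_lt, min_eq_right hd]
  rw [constrained, card_map]
  rcases hab with rfl | rfl
  · rw [min_eq_right hb]
    refine Eq.trans ?_ (hlt hb)
    exact card_equiv h (by simp)
  · rw [min_eq_left ha]
    refine Eq.trans ?_ (hlt ha)
    exact congrArg _ (filter_congr (by simp))

/-- Since one of the layers is full, the edges of `h` cover the smaller layer, so a permutation that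
agrees with `h` on them has no room for further edges. -/
theorem constrained_iff {s s' : ℕ} (hs : s' ≤ s) {a b : ℕ} (h : Equiv.Perm (Fin s'))
    (ha : a ≤ s') (hb : b ≤ s') (hab : a = s' ∨ b = s') (σ : Equiv.Perm (Fin s)) :
    (∀ x ∈ constrained hs a b h, σ x = extendPerm hs h x) ↔ pmap a b h = pmap a b σ := by
  constructor
  · intro H
    have H' : ∀ u : Fin s', (u : ℕ) < a → (h u : ℕ) < b → (σ (Fin.castLE hs u) : ℕ) = h u := by
      intro u h1 h2
      rw [H _ ((mem_constrained _ _ _ _ _).2 ⟨u, ⟨h1, h2⟩, rfl⟩), extendPerm_castLE]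
      rfl
    funext u
    refine Option.ext fun w => ?_
    rw [pmap_eq_some, pmap_eq_some]
    constructor
    · rintro ⟨h1, h2, h3, h4⟩
      exact ⟨h1.trans_le hs, h2, h3, h4 ▸ H' ⟨u, h1⟩ h2 (h4 ▸ h3)⟩
    · rintro ⟨h1, h2, h3, h4⟩
      have hu := h2.trans_le ha
      rcases hab with rfl | rfl
      · have hw := h3.trans_le hb
        have h5 := H' (h.symm ⟨w, hw⟩) (h.symm ⟨w, hw⟩).2 (by simpa using h3)
        rw [Equiv.apply_symm_apply] at h5
        have h6 := σ.injective (Fin.ext (h4.trans h5.symm))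
        have h8 := Fin.val_eq_of_eq h6
        have h7 : (⟨u, hu⟩ : Fin _) = h.symm ⟨w, hw⟩ := Fin.ext h8
        exact ⟨hu, h2, h3, by rw [h7, Equiv.apply_symm_apply]⟩
      · refine ⟨hu, h2, h3, ?_⟩
        rw [← H' ⟨u, hu⟩ h2 (Fin.is_lt _)]
        exact h4
  · intro H x hx
    obtain ⟨u, ⟨h1, h2⟩, rfl⟩ := (mem_constrained _ _ _ _ _).1 hx
    rw [extendPerm_castLE]
    have h3 : pmap a b h u = some (h u : ℕ) := pmap_eq_some.2 ⟨u.2, h1, h2, rfl⟩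
    rw [H, pmap_eq_some] at h3
    obtain ⟨_, _, _, h4⟩ := h3
    exact Fin.ext h4

-- These permutations form a left coset of the stabiliser of the constrained points.
open Classical in
theorem card_pmap_eq {s a b : ℕ} (h : Equiv.Perm (Fin s)) (ha : a ≤ s) (hb : b ≤ s)
    (hab : a = s ∨ b = s) :
    (univ.filter fun h' : Equiv.Perm (Fin s) => pmap a b h' = pmap a b h).card
      = (s - min a b).factorial := by
  have h1 := card_stab (constrained le_rfl a b h)
  rw [card_constrained _ _ ha hb hab, Fintype.card_fin] at h1
  rw [← h1]
  refine (card_equiv (Equiv.mulLeft h) fun σ => ?_).symm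
  rw [mem_stab, mem_filter, eq_comm, ← constrained_iff le_rfl h ha hb hab]
  simp only [mem_univ, true_and, Equiv.coe_mulLeft, Equiv.Perm.mul_apply]
  refine forall_congr' fun x => forall_congr' fun _ => ?_
  have : extendPerm le_rfl h x = h x := extendPerm_castLE le_rfl h x
  rw [this, h.injective.eq_iff]

theorem bind_pmap {s : ℕ} (a b : ℕ) (α β : Equiv.Perm (Fin s)) (u : ℕ) :
    (pmap a s α u).bind (pmap s b β) = pmap a b (β * α) u := by
  refine Option.ext fun w => ?_
  rw [Option.bind_eq_some_iff, pmap_eq_some]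
  constructor
  · rintro ⟨v, hv, hw⟩
    obtain ⟨h1, h2, h3, rfl⟩ := pmap_eq_some.1 hv
    obtain ⟨_, _, h4, h5⟩ := pmap_eq_some.1 hw
    exact ⟨h1, h2, h4, h5⟩
  · rintro ⟨h1, h2, h3, h4⟩
    exact ⟨α ⟨u, h1⟩, pmap_eq_some.2 ⟨h1, h2, Fin.is_lt _, rfl⟩,
      pmap_eq_some.2 ⟨Fin.is_lt _, Fin.is_lt _, h3, h4⟩⟩

/-- The inner layers of a block are full, so by `bind_pmap` truncation takes place at its two ends
only. -/
theorem fpath_altWord {s : ℕ} (k i : ℕ) (t : ℕ → ℕ) (f : ℕ → ℕ → Option ℕ)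
    (α β : Fin (k + 1) → Equiv.Perm (Fin s)) (ht : ∀ e, 0 < e → e < 2 * (k + 1) → t (i + e) = s)
    (hα : ∀ j : Fin (k + 1), f (i + 2 * j) = pmap (t (i + 2 * j)) (t (i + 2 * j + 1)) (α j))
    (hβ : ∀ j : Fin (k + 1),
      f (i + 2 * j + 1) = pmap (t (i + 2 * j + 1)) (t (i + 2 * j + 2)) (β j)) :
    fpath f i (2 * (k + 1)) = pmap (t i) (t (i + 2 * (k + 1))) (altWord (k + 1) α β) := by
  induction k with
  | zero =>
    funext u
    have h1 := hα 0
    have h2 := hβ 0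
    simp only [Fin.val_zero, mul_zero, add_zero] at h1 h2
    rw [ht 1 one_pos (by norm_num)] at h1 h2
    simp only [zero_add, mul_one, fpath, Option.bind_some, altWord, add_zero]
    rw [h1, h2, bind_pmap]
    rfl
  | succ k ih =>
    funext u
    have h0 := ih (fun j => α j.castSucc) (fun j => β j.castSucc)
      (fun e h1 h2 => ht e h1 (by omega)) (fun j => hα j.castSucc) (fun j => hβ j.castSucc)
    have h1 := hα (Fin.last _)
    have h2 := hβ (Fin.last _)
    rw [Fin.val_last] at h1 h2
    rw [ht (2 * (k + 1)) (by omega) (by omega)] at h0 h1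
    rw [show i + 2 * (k + 1) + 1 = i + (2 * (k + 1) + 1) by ring,
      ht (2 * (k + 1) + 1) (by omega) (by omega)] at h1 h2
    rw [show 2 * (k + 1 + 1) = 2 * (k + 1) + 1 + 1 by ring, fpath, fpath, h0, h1, bind_pmap, h2,
      bind_pmap]
    rw [altWord, mul_assoc]
    rfl

theorem layerSize_le {S : ℕ → ℕ} (hS : Monotone S) (c k e : ℕ) : layerSize c S k e ≤ S k := by
  induction k generalizing e with
  | zero => exact le_rfl
  | succ k ih =>
    rw [layerSize]
    split_ifs
    · exact (ih _).trans (hS k.le_succ)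
    · exact le_rfl

theorem layerSize_eq_or {S : ℕ → ℕ} {c : ℕ} (k e : ℕ) :
    layerSize c S k e = S k ∨ layerSize c S k (e + 1) = S k := by
  cases k with
  | zero => exact Or.inl rfl
  | succ k =>
    rw [layerSize, layerSize]
    by_cases h : 2 * c ∣ e
    · right
      rw [if_neg fun h' => ?_]
      have := (Nat.dvd_add_right h).1 h'
      rw [Nat.dvd_one] at this
      omega
    · exact Or.inl (if_neg h)

theorem layerSize_mul {S : ℕ → ℕ} {c : ℕ} (hc : 0 < c) (k i : ℕ) :
    layerSize c S (k + 1) (2 * c * i) = layerSize c S k i := by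
  rw [layerSize, if_pos (dvd_mul_right _ _), Nat.mul_div_cancel_left _ (by omega)]

/-- The matchings of the edge layers. -/
def edgeMaps (c : ℕ) (S : ℕ → ℕ) (k : ℕ) (g : Fin (numEdges c k) → Equiv.Perm (Fin (S k)))
    (e : ℕ) : ℕ → Option ℕ :=
  if h : e < numEdges c k then pmap (layerSize c S k e) (layerSize c S k (e + 1)) (g ⟨e, h⟩)
  else fun _ => none

theorem edgeMaps_coe (c : ℕ) (S : ℕ → ℕ) (k : ℕ) (g : Fin (numEdges c k) → Equiv.Perm (Fin (S k)))
    (e : Fin (numEdges c k)) :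
    edgeMaps c S k g e = pmap (layerSize c S k e) (layerSize c S k (e + 1)) (g e) :=
  dif_pos e.2

theorem isMat_edgeMaps {c : ℕ} {S : ℕ → ℕ} (hS : Monotone S) (k : ℕ)
    (g : Fin (numEdges c k) → Equiv.Perm (Fin (S k))) (e : ℕ) (he : e < numEdges c k) :
    IsMat (layerSize c S k e) (layerSize c S k (e + 1)) (edgeMaps c S k g e) := by
  rw [edgeMaps_coe c S k g ⟨e, he⟩]
  exact isMat_pmap _ (layerSize_le hS _ _ _) (layerSize_le hS _ _ _) (layerSize_eq_or _ _)

/-- The permutations `g` represent a nice graph with final matching `Z`. -/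
def Good (c : ℕ) (S : ℕ → ℕ) (Z : Equiv.Perm (Fin (S 0))) (k : ℕ)
    (g : Fin (numEdges c k) → Equiv.Perm (Fin (S k))) : Prop :=
  NiceMaps (layerSize c S k) (numEdges c k) (edgeMaps c S k g) ∧
    ∀ u : Fin (S 0), fpath (edgeMaps c S k g) 0 (numEdges c k) u = some (Z u : ℕ)

theorem Good.congr {c : ℕ} {S : ℕ → ℕ} {Z : Equiv.Perm (Fin (S 0))} {k : ℕ}
    {g g' : Fin (numEdges c k) → Equiv.Perm (Fin (S k))}
    (h : ∀ e < numEdges c k, edgeMaps c S k g e = edgeMaps c S k g' e) :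
    Good c S Z k g ↔ Good c S Z k g' := by
  rw [Good, Good, NiceMaps.congr h, fpath_congr fun e _ h2 => h e (by omega)]

theorem good_zero {c : ℕ} {S : ℕ → ℕ} {Z : Equiv.Perm (Fin (S 0))}
    (g : Fin (numEdges c 0) → Equiv.Perm (Fin (S 0))) :
    Good c S Z 0 g ↔ g ⟨0, by simp [numEdges]⟩ = Z := by
  have h1 : edgeMaps c S 0 g 0 = pmap (S 0) (S 0) (g ⟨0, by simp [numEdges]⟩) :=
    edgeMaps_coe c S 0 g ⟨0, by simp [numEdges]⟩
  have h2 : ∀ u : Fin (S 0), fpath (edgeMaps c S 0 g) 0 1 u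
      = some (g ⟨0, by simp [numEdges]⟩ u : ℕ) := by
    intro u
    rw [fpath_one, h1]
    exact pmap_eq_some.2 ⟨u.2, u.2, Fin.is_lt _, rfl⟩
  have h4 : (∀ u : Fin (S 0), fpath (edgeMaps c S 0 g) 0 (numEdges c 0) u = some (Z u : ℕ)) ↔
      g ⟨0, by simp [numEdges]⟩ = Z := by
    change (∀ u : Fin (S 0), fpath (edgeMaps c S 0 g) 0 1 u = _) ↔ _
    simp only [h2, Option.some.injEq, ← Fin.ext_iff]
    exact ⟨fun h => Equiv.ext h, fun h u => by rw [h]⟩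
  refine ⟨fun h => h4.1 h.2, fun h => ⟨?_, h4.2 h⟩⟩
  intro i d hd hl
  obtain ⟨rfl, rfl⟩ : i = 0 ∧ d = 1 := by
    change i + d ≤ 1 at hl
    omega
  refine ⟨0, le_rfl, by omega, ?_⟩
  rw [domCard, filter_true_of_mem, card_range]
  intro u hu
  have := h2 ⟨u, mem_range.1 hu⟩
  simp only at this
  rw [this]
  rfl

theorem fpath_edgeMaps {c : ℕ} (hc : 0 < c) {S : ℕ → ℕ} (k : ℕ)
    (g : Fin (numEdges c (k + 1)) → Equiv.Perm (Fin (S (k + 1)))) (i : Fin (numEdges c k)) :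
    fpath (edgeMaps c S (k + 1) g) (2 * c * i) (2 * c)
      = pmap (layerSize c S k i) (layerSize c S k (i + 1))
        (altWord c (fun j => g (edgeEquiv c k ((i, j), false)))
          (fun j => g (edgeEquiv c k ((i, j), true)))) := by
  obtain ⟨c, rfl⟩ : ∃ c', c = c' + 1 := ⟨c - 1, by omega⟩
  have hv : ∀ (j : Fin (c + 1)) (b : Bool),
      (edgeEquiv (c + 1) k ((i, j), b) : ℕ) = 2 * (c + 1) * i + 2 * j + b.toNat :=
    fun j b => edgeEquiv_val _ _ _ _ _
  rw [fpath_altWord c (2 * (c + 1) * i) (layerSize (c + 1) S (k + 1)) (edgeMaps (c + 1) S (k + 1) g)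
    (fun j => g (edgeEquiv (c + 1) k ((i, j), false)))
    (fun j => g (edgeEquiv (c + 1) k ((i, j), true)))]
  · rw [layerSize_mul hc, show 2 * (c + 1) * (i : ℕ) + 2 * (c + 1) = 2 * (c + 1) * (i + 1) by ring,
      layerSize_mul hc]
  · intro e h1 h2
    rw [layerSize, if_neg fun h => ?_]
    have := Nat.le_of_dvd h1 ((Nat.dvd_add_right (dvd_mul_right _ _)).1 h)
    omega
  · intro j
    have h := hv j false
    rw [Bool.toNat_false, add_zero] at h
    rw [← h, edgeMaps_coe]
  · intro j
    have h := hv j true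
    rw [Bool.toNat_true] at h
    rw [show 2 * (c + 1) * (i : ℕ) + 2 * j + 2 = 2 * (c + 1) * (i : ℕ) + 2 * j + 1 + 1 by ring,
      ← h, edgeMaps_coe]

theorem numEdges_succ (c k : ℕ) : numEdges c (k + 1) = 2 * c * numEdges c k := by
  rw [numEdges, pow_succ', numEdges]

/-- By `niceMaps_contract`, niceness is equivalent to niceness after contracting every block,
provided that the contracted blocks are matchings of full size; `exists_pmap` represents these by
permutations `h`. -/
theorem good_succ {c : ℕ} (hc : 0 < c) {S : ℕ → ℕ} (hS : Monotone S) {Z : Equiv.Perm (Fin (S 0))}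
    (k : ℕ) (g : Fin (numEdges c (k + 1)) → Equiv.Perm (Fin (S (k + 1)))) :
    Good c S Z (k + 1) g ↔ ∃ h, Good c S Z k h ∧ ∀ i : Fin (numEdges c k),
      pmap (layerSize c S k i) (layerSize c S k (i + 1)) (h i)
        = pmap (layerSize c S k i) (layerSize c S k (i + 1))
          (altWord c (fun j => g (edgeEquiv c k ((i, j), false)))
            (fun j => g (edgeEquiv c k ((i, j), true)))) := by
  have hcon := niceMaps_contract (t := layerSize c S k) (t' := layerSize c S (k + 1)) (n := 2 * c)
    (ℓ := numEdges c k) (s := S (k + 1)) (f := edgeMaps c S (k + 1) g) (by omega)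
    (fun e he => isMat_edgeMaps hS _ _ _ (by rwa [numEdges_succ])) (layerSize_mul hc k)
    (fun e he => by rw [layerSize, if_neg he])
    (fun i => (layerSize_le hS _ _ _).trans (hS k.le_succ))
  have hfin : fpath (edgeMaps c S (k + 1) g) 0 (numEdges c (k + 1))
      = fpath (fun i => fpath (edgeMaps c S (k + 1) g) (2 * c * i) (2 * c)) 0 (numEdges c k) := by
    rw [fpath_mul, mul_zero, numEdges_succ]
  simp only [← fpath_edgeMaps hc, ← edgeMaps_coe]
  rw [Good, hfin, numEdges_succ, hcon]
  have hg : ∀ h : Fin (numEdges c k) → Equiv.Perm (Fin (S k)),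
      (∀ i : Fin (numEdges c k), edgeMaps c S k h i
        = fpath (edgeMaps c S (k + 1) g) (2 * c * i) (2 * c)) →
      (Good c S Z k h ↔
        NiceMaps (layerSize c S k) (numEdges c k)
          (fun i => fpath (edgeMaps c S (k + 1) g) (2 * c * i) (2 * c)) ∧
        ∀ u : Fin (S 0), fpath (fun i => fpath (edgeMaps c S (k + 1) g) (2 * c * i) (2 * c)) 0
          (numEdges c k) u = some (Z u : ℕ)) := by
    intro h hh
    have hh' : ∀ e < numEdges c k, edgeMaps c S k h e
        = fpath (edgeMaps c S (k + 1) g) (2 * c * e) (2 * c) := fun e he => hh ⟨e, he⟩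
    rw [Good, NiceMaps.congr hh', fpath_congr fun e _ he => hh' e (by omega)]
  constructor
  · rintro ⟨⟨h1, h2⟩, h3⟩
    choose h hh using fun i : Fin (numEdges c k) =>
      exists_pmap (s := S k) (h1 i i.2) (layerSize_le hS _ _ _) (layerSize_le hS _ _ _)
    have hh' : ∀ i : Fin (numEdges c k), edgeMaps c S k h i
        = fpath (edgeMaps c S (k + 1) g) (2 * c * i) (2 * c) := by
      intro i
      rw [edgeMaps_coe, hh]
    exact ⟨h, (hg h hh').2 ⟨h2, h3⟩, hh'⟩
  · rintro ⟨h, h1, hh⟩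
    obtain ⟨h2, h3⟩ := (hg h hh).1 h1
    refine ⟨⟨fun i hi => ?_, h2⟩, h3⟩
    have := isMat_edgeMaps hS k h i hi
    rwa [hh ⟨i, hi⟩] at this

-- Every block kernel is constant on its support, and the number of `h` that represent the
-- contracted matchings is a product of factorials of layer sizes. Neither depends on `g` or `Z`.
open Classical in
theorem exists_levelDist_eq {c : ℕ} (hc : 0 < c) {S : ℕ → ℕ} (hS : Monotone S)
    (k : ℕ) : ∃ C : ℝ, ∀ (Z : Equiv.Perm (Fin (S 0))) g,
      levelDist c hS Z k g = if Good c S Z k g then C else 0 := by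
  induction k with
  | zero =>
    refine ⟨1, fun Z g => ?_⟩
    rw [levelDist]
    simp only [good_zero]
  | succ k ih =>
    obtain ⟨C, hC⟩ := ih
    let a : Fin (numEdges c k) → ℕ := fun i => layerSize c S k i
    let b : Fin (numEdges c k) → ℕ := fun i => layerSize c S k (i + 1)
    have ha : ∀ i, a i ≤ S k := fun i => layerSize_le hS _ _ _
    have hb : ∀ i, b i ≤ S k := fun i => layerSize_le hS _ _ _
    have hab : ∀ i, a i = S k ∨ b i = S k := fun i => layerSize_eq_or _ _
    let w : Fin (numEdges c k) → ℝ := fun i =>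
      ((Fintype.card (Equiv.Perm (Fin (S (k + 1)))) : ℝ) ^ (2 * c - 1) *
        ((S (k + 1) - min (a i) (b i)).factorial : ℕ))⁻¹
    refine ⟨C * (∏ i, w i) * ∏ i, ((S k - min (a i) (b i)).factorial : ℝ), fun Z g => ?_⟩
    let A : Fin (numEdges c k) → Equiv.Perm (Fin (S (k + 1))) := fun i =>
      altWord c (fun j => g (edgeEquiv c k ((i, j), false)))
        (fun j => g (edgeEquiv c k ((i, j), true)))
    have hker : ∀ (h : Fin (numEdges c k) → Equiv.Perm (Fin (S k))) (i : Fin (numEdges c k)),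
        edgeKer c (hS k.le_succ) (layerSize c S k i)
          (layerSize c S k (i + 1)) (h i) (fun j => g (edgeEquiv c k ((i, j), false)))
          (fun j => g (edgeEquiv c k ((i, j), true)))
        = if pmap (a i) (b i) (h i) = pmap (a i) (b i) (A i) then w i else 0 := by
      intro h i
      rw [edgeKer, blockKer, card_stab, card_constrained _ _ (ha i) (hb i) (hab i),
        Fintype.card_fin]
      have := constrained_iff (hS k.le_succ) (h i) (ha i) (hb i) (hab i) (A i)
      split_ifs with h1 h2 h2
      · rfl
      · exact absurd (this.1 h1) h2
      · exact absurd (this.2 h2) h1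
      · rfl
    rw [levelDist]
    have hterm : ∀ h, levelDist c hS Z k h * ∏ i : Fin (numEdges c k),
        edgeKer c (hS k.le_succ) (layerSize c S k i)
          (layerSize c S k (i + 1)) (h i) (fun j => g (edgeEquiv c k ((i, j), false)))
          (fun j => g (edgeEquiv c k ((i, j), true)))
        = if Good c S Z k h ∧ ∀ i, pmap (a i) (b i) (h i) = pmap (a i) (b i) (A i) then
          C * ∏ i, w i else 0 := by
      intro h
      simp only [hker]
      rw [hC]
      by_cases h1 : ∀ i, pmap (a i) (b i) (h i) = pmap (a i) (b i) (A i)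
      · simp [h1]
      · obtain ⟨i, hi⟩ := not_forall.1 h1
        rw [prod_eq_zero (mem_univ i) (if_neg hi), mul_zero]
        exact (if_neg fun h2 => h1 h2.2).symm
    rw [sum_congr rfl fun h _ => hterm h, good_succ hc hS]
    by_cases hex : ∃ h, Good c S Z k h ∧ ∀ i, pmap (a i) (b i) (h i) = pmap (a i) (b i) (A i)
    · obtain ⟨h₀, hg₀, hh₀⟩ := hex
      rw [if_pos ⟨h₀, hg₀, hh₀⟩, sum_ite, sum_const_zero, add_zero, sum_const, nsmul_eq_mul,
        mul_comm]
      congr 1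
      have hset : (univ.filter fun h : Fin (numEdges c k) → Equiv.Perm (Fin (S k)) =>
          Good c S Z k h ∧ ∀ i, pmap (a i) (b i) (h i) = pmap (a i) (b i) (A i))
          = Fintype.piFinset fun i => univ.filter fun h' : Equiv.Perm (Fin (S k)) =>
            pmap (a i) (b i) h' = pmap (a i) (b i) (h₀ i) := by
        ext h
        rw [mem_filter, Fintype.mem_piFinset]
        simp only [mem_univ, true_and, mem_filter, hh₀]
        refine ⟨fun h1 => h1.2, fun h1 => ⟨(Good.congr fun e he => ?_).1 hg₀, h1⟩⟩
        have h2 := edgeMaps_coe c S k h₀ ⟨e, he⟩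
        have h3 := edgeMaps_coe c S k h ⟨e, he⟩
        simp only at h2 h3
        rw [h2, h3]
        exact (hh₀ ⟨e, he⟩).trans (h1 ⟨e, he⟩).symm
      rw [hset, Fintype.card_piFinset]
      push_cast
      exact prod_congr rfl fun i _ => by rw [card_pmap_eq _ (ha i) (hb i) (hab i)]
    · rw [if_neg hex]
      push Not at hex
      refine sum_eq_zero fun h _ => if_neg fun h1 => ?_
      obtain ⟨i, hi⟩ := hex h h1.1
      exact hi (h1.2 i)

/-! ### Layered graphs as sequences of partial maps -/

/-- A matching as a partial map on the natural numbers. -/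
def toMap {a b : ℕ} (f : Fin a ≃. Fin b) (u : ℕ) : Option ℕ :=
  if h : u < a then (f ⟨u, h⟩).map Fin.val else none

theorem toMap_coe {a b : ℕ} (f : Fin a ≃. Fin b) (u : Fin a) :
    toMap f u = (f u).map Fin.val := dif_pos u.2

theorem toMap_eq_some {a b : ℕ} {f : Fin a ≃. Fin b} {u w : ℕ} :
    toMap f u = some w ↔ ∃ (hu : u < a) (hw : w < b), f ⟨u, hu⟩ = some ⟨w, hw⟩ := by
  unfold toMap
  split_ifs with h
  · rw [Option.map_eq_some_iff]
    constructor
    · rintro ⟨w, hw, rfl⟩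
      exact ⟨h, w.2, hw⟩
    · rintro ⟨_, hw, h'⟩
      exact ⟨_, h', rfl⟩
  · exact ⟨fun h' => by simp at h', fun ⟨h', _⟩ => absurd h' h⟩

theorem toMap_injective {a b : ℕ} : Function.Injective (toMap (a := a) (b := b)) := by
  intro f f' h
  refine PEquiv.ext fun u => ?_
  have := congrFun h u
  rw [toMap_coe, toMap_coe] at this
  exact Option.map_injective Fin.val_injective this

theorem matchingSize_eq_domCard {a b : ℕ} (f : Fin a ≃. Fin b) {F : ℕ → Option ℕ}
    (h : ∀ u < a, toMap f u = F u) : matchingSize f = domCard a F := by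
  rw [matchingSize, domCard]
  refine card_bij (fun u _ => (u : ℕ)) ?_ ?_ ?_
  · intro u hu
    refine mem_filter.2 ⟨mem_range.2 u.2, ?_⟩
    rw [← h u u.2, toMap_coe, Option.isSome_map]
    exact (mem_filter.1 hu).2
  · exact fun u _ v _ h => Fin.ext h
  · intro u hu
    obtain ⟨h1, h2⟩ := mem_filter.1 hu
    have h1 := mem_range.1 h1
    refine ⟨⟨u, h1⟩, mem_filter.2 ⟨mem_univ _, ?_⟩, rfl⟩
    rw [← h u h1, toMap, dif_pos h1, Option.isSome_map] at h2
    exact h2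

theorem isMat_toMap {a b : ℕ} (f : Matching a b) : IsMat a b (toMap f.1) := by
  refine isMat_of_le_domCard (fun h => ?_) (fun h h' => ?_) ?_
  · obtain ⟨h1, h2, _⟩ := toMap_eq_some.1 h
    exact ⟨h1, h2⟩
  · obtain ⟨h1, h2, h3⟩ := toMap_eq_some.1 h
    obtain ⟨h1', h2', h3'⟩ := toMap_eq_some.1 h'
    have := f.1.inj h3 h3'
    simpa using this
  · rw [← matchingSize_eq_domCard f.1 fun u _ => rfl, f.2]
    omega

theorem toMap_trans {a b d : ℕ} (f : Fin a ≃. Fin b) (f' : Fin b ≃. Fin d) (u : ℕ) :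
    toMap (f.trans f') u = (toMap f u).bind (toMap f') := by
  refine Option.ext fun w => ?_
  rw [Option.bind_eq_some_iff, toMap_eq_some]
  constructor
  · rintro ⟨h1, h2, h3⟩
    obtain ⟨v, hv, hw⟩ := (PEquiv.mem_trans f f' _ _).1 h3
    exact ⟨v, toMap_eq_some.2 ⟨h1, v.2, hv⟩, toMap_eq_some.2 ⟨v.2, h2, hw⟩⟩
  · rintro ⟨v, hv, hw⟩
    obtain ⟨h1, h2, h3⟩ := toMap_eq_some.1 hv
    obtain ⟨_, h5, h6⟩ := toMap_eq_some.1 hw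
    exact ⟨h1, h5, (PEquiv.mem_trans f f' _ _).2 ⟨_, h3, h6⟩⟩

theorem IsMat.domCard_eq {a b : ℕ} {F : ℕ → Option ℕ} (hF : IsMat a b F) :
    domCard a F = min a b := by
  have h : ∀ m, 0 ≤ m → m ≤ 0 + 1 → _ := fun m =>
    domCard_fpath_le (f := fun _ => F) (t := fun i => if i = 0 then a else b) (ℓ := 1)
      (i := 0) (d := 1) (m := m) (by
        intro e he
        obtain rfl : e = 0 := by omega
        exact hF) (by omega)
  have h1 : domCard a (fpath (fun _ => F) 0 1) = domCard a F :=
    congrArg _ (funext fun u => fpath_one _ _ _)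
  have ha := h 0 (by omega) (by omega)
  have hb := h 1 (by omega) (by omega)
  simp only [if_true, one_ne_zero, if_false, h1] at ha hb
  refine le_antisymm (le_min ha hb) ?_
  rcases le_total a b with hab | hab
  · rw [min_eq_left hab, domCard, filter_true_of_mem, card_range]
    intro u hu
    obtain ⟨w, hw⟩ := hF.total hab u (mem_range.1 hu)
    rw [hw]; rfl
  · rw [min_eq_right hab]
    choose! g hg using hF.surj hab
    conv_lhs => rw [← card_range b]
    refine card_le_card_of_injOn g (fun w hw => ?_) fun w hw w' hw' h => ?_
    · have := hg w (mem_range.1 hw)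
      exact mem_coe.2 (mem_filter.2 ⟨mem_range.2 (hF.lt this).1, by rw [this]; rfl⟩)
    · have h1 := hg w (mem_range.1 hw)
      have h2 := hg w' (mem_range.1 hw')
      rw [h, h2] at h1
      exact (Option.some.inj h1).symm

/-- The restriction of a permutation to a partial bijection. -/
def restrict {s : ℕ} (a b : ℕ) (σ : Equiv.Perm (Fin s)) : Fin a ≃. Fin b where
  toFun u := if h : (u : ℕ) < s then
    (if h' : (σ ⟨u, h⟩ : ℕ) < b then some ⟨σ ⟨u, h⟩, h'⟩ else none) else none
  invFun w := if h : (w : ℕ) < s then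
    (if h' : (σ.symm ⟨w, h⟩ : ℕ) < a then some ⟨σ.symm ⟨w, h⟩, h'⟩ else none) else none
  inv u w := by
    simp only [Option.dite_none_right_eq_some, Option.some.injEq, Fin.ext_iff]
    constructor
    · rintro ⟨h1, h2, h3⟩
      have hu : (u : ℕ) < s := h3 ▸ Fin.is_lt _
      have h4 : σ.symm ⟨w, h1⟩ = ⟨u, hu⟩ := Fin.ext h3
      rw [Equiv.symm_apply_eq] at h4
      exact ⟨hu, by rw [← h4]; exact w.2, by rw [← h4]⟩
    · rintro ⟨h1, h2, h3⟩
      have hw : (w : ℕ) < s := h3 ▸ Fin.is_lt _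
      have h4 : σ ⟨u, h1⟩ = ⟨w, hw⟩ := Fin.ext h3
      rw [← Equiv.eq_symm_apply] at h4
      exact ⟨hw, by rw [← h4]; exact u.2, by rw [← h4]⟩

theorem toMap_restrict {s : ℕ} (a b : ℕ) (σ : Equiv.Perm (Fin s)) :
    toMap (restrict a b σ) = pmap a b σ := by
  funext u
  refine Option.ext fun w => ?_
  rw [toMap_eq_some, pmap_eq_some]
  constructor
  · rintro ⟨h1, h2, h3⟩
    change (if h : u < s then _ else none) = _ at h3
    split_ifs at h3 with h4 h5
    exact ⟨h4, h1, h2, Fin.ext_iff.1 (Option.some.inj h3)⟩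
  · rintro ⟨h1, h2, h3, h4⟩
    refine ⟨h2, h3, ?_⟩
    change (if h : u < s then _ else none) = _
    rw [dif_pos h1, dif_pos (h4 ▸ h3)]
    simp [h4]

/-- The partial maps of a layered graph. -/
def graphMaps {T : List ℕ} (G : LayeredGraph T) (e : ℕ) : ℕ → Option ℕ :=
  if h : e < T.length - 1 then toMap (G ⟨e, h⟩).1 else fun _ => none

theorem isMat_graphMaps {T : List ℕ} (G : LayeredGraph T) (e : ℕ) (he : e < T.length - 1) :
    IsMat (layer T e) (layer T (e + 1)) (graphMaps G e) := by
  rw [graphMaps, dif_pos he]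
  exact isMat_toMap _

theorem path_self {T : List ℕ} (G : LayeredGraph T) (i : ℕ) :
    G.path i i = PEquiv.refl _ := by
  cases i with
  | zero =>
    rw [LayeredGraph.path, dif_pos rfl]
    rfl
  | succ i =>
    rw [LayeredGraph.path, dif_pos rfl]
    rfl

theorem toMap_path {T : List ℕ} (G : LayeredGraph T) (i d : ℕ) (h : i + d ≤ T.length - 1)
    (u : ℕ) (hu : u < layer T i) :
    toMap (G.path i (i + d)) u = fpath (graphMaps G) i d u := by
  induction d with
  | zero =>
    change toMap (G.path i i) u = some u
    rw [path_self]
    exact toMap_eq_some.2 ⟨hu, hu, rfl⟩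
  | succ d ih =>
    change toMap (G.path i ((i + d) + 1)) u = _
    rw [LayeredGraph.path, dif_neg (by omega), dif_pos (by omega), toMap_trans, ih (by omega),
      fpath, graphMaps, dif_pos (by omega)]

/-- `NiceMaps` only records the lower bound on the sizes; the upper bound by every intermediate
layer is automatic (`domCard_fpath_le`). -/
theorem nice_iff {T : List ℕ} (G : LayeredGraph T) :
    G.Nice ↔ NiceMaps (layer T) (T.length - 1) (graphMaps G) := by
  constructor
  · intro h i d hd hl
    have h1 := h i (i + d) (by omega) hl
    rw [matchingSize_eq_domCard _ (toMap_path G i d hl)] at h1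
    obtain ⟨m, hm, hm'⟩ := exists_mem_eq_inf' (s := Icc i (i + d)) ⟨i, by simp⟩ (layer T)
    rw [mem_Icc] at hm
    exact ⟨m, hm.1, hm.2, by rw [h1, hm']⟩
  · intro h i j hij hj
    obtain ⟨d, rfl⟩ := Nat.exists_eq_add_of_le hij.le
    rw [matchingSize_eq_domCard _ (toMap_path G i d hj)]
    refine le_antisymm ?_ ?_
    · refine le_inf' _ _ fun m hm => ?_
      rw [mem_Icc] at hm
      exact domCard_fpath_le (isMat_graphMaps G) hj hm.1 hm.2
    · obtain ⟨m, hm1, hm2, hm⟩ := h i d (by omega) hj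
      exact (inf'_le _ (mem_Icc.2 ⟨hm1, hm2⟩)).trans hm

theorem finalMatching_eq_iff {c k n : ℕ} {S : Fin (k + 1) → ℕ} (h : S 0 = n)
    (G : LayeredGraph (nest c S)) (Z : Equiv.Perm (Fin n)) :
    finalMatching h G = Z.toPEquiv ↔
      ∀ u : Fin n, fpath (graphMaps G) 0 (lastLayer c S) u = some (Z u : ℕ) := by
  have key : ∀ u : Fin n, (finalMatching h G u).map Fin.val
      = fpath (graphMaps G) 0 (lastLayer c S) u := by
    intro u
    have h0 := layer_nest_zero c S
    have h1 := toMap_path G 0 (lastLayer c S) (by rw [zero_add]; exact le_rfl) u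
      (by rw [h0, h]; exact u.2)
    rw [zero_add] at h1
    rw [← h1, ← toMap_coe, finalMatching, toMap_trans]
    have h2 : toMap (finCongr ((layer_nest_zero c S).trans h)).symm.toPEquiv (u : ℕ)
        = some (u : ℕ) := toMap_eq_some.2 ⟨u.2, by rw [h0, h]; exact u.2, rfl⟩
    rw [h2, Option.bind_some, toMap_trans]
    refine Option.ext fun w => ?_
    rw [Option.bind_eq_some_iff]
    constructor
    · rintro ⟨v, hv, hw⟩
      obtain ⟨h3, h4, h5⟩ := toMap_eq_some.1 hw
      have : v = w := Fin.ext_iff.1 (Option.some.inj h5)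
      rwa [← this]
    · intro hw
      obtain ⟨h3, h4, h5⟩ := toMap_eq_some.1 hw
      exact ⟨w, hw, toMap_eq_some.2 ⟨h4, by
        rw [← (layer_nest_last c S).trans h]; exact h4, rfl⟩⟩
  constructor
  · intro hG u
    rw [← key u, hG]
    rfl
  · intro hG
    refine PEquiv.ext fun u => Option.map_injective Fin.val_injective ?_
    rw [key u, hG u]
    rfl

/-! ### The layers of a nested block graph -/

theorem length_plug (t : ℕ) (T : List ℕ) (d s : ℕ) :
    (plug (t :: T) d s).length = (d + 1) * T.length + 1 := by
  induction T generalizing t with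
  | nil => rfl
  | cons t' T ih =>
    rw [plug, List.length_cons, List.length_append, List.length_replicate, ih, List.length_cons]
    ring

theorem layer_plug (t : ℕ) (T : List ℕ) (d s e : ℕ) (he : e ≤ (d + 1) * T.length) :
    layer (plug (t :: T) d s) e
      = if d + 1 ∣ e then layer (t :: T) (e / (d + 1)) else s := by
  induction T generalizing t e with
  | nil =>
    obtain rfl : e = 0 := by simpa using he
    simp [plug]
  | cons t' T ih =>
    rw [plug]
    rcases Nat.eq_zero_or_pos e with rfl | h0
    · simp [layer]
    obtain ⟨e, rfl⟩ : ∃ e', e = e' + 1 := ⟨e - 1, by omega⟩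
    rw [layer, List.getD_cons_succ]
    by_cases hlt : e < d
    · rw [List.getD_append _ _ _ _ (by simpa), if_neg (fun h => by
        have := Nat.le_of_dvd (by omega) h; omega)]
      simp [List.getD_eq_getElem?_getD, hlt]
    · obtain ⟨e, rfl⟩ := Nat.exists_eq_add_of_le (not_lt.1 hlt)
      rw [List.getD_append_right _ _ _ _ (by simp), List.length_replicate, Nat.add_sub_cancel_left]
      have h1 := ih t' e (by rw [List.length_cons] at he; linarith)
      rw [layer] at h1
      rw [h1, show d + e + 1 = e + (d + 1) by ring, Nat.add_div_right _ (by omega)]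
      exact if_congr Nat.dvd_add_self_right.symm rfl rfl

theorem nest_spec {c : ℕ} (hc : 0 < c) (S : ℕ → ℕ) (k : ℕ) :
    (nest c fun i : Fin (k + 1) => S i).length = numEdges c k + 1 ∧
      ∀ e ≤ numEdges c k, layer (nest c fun i : Fin (k + 1) => S i) e = layerSize c S k e := by
  induction k with
  | zero =>
    refine ⟨rfl, fun e he => ?_⟩
    change e ≤ 1 at he
    interval_cases e <;> rfl
  | succ k ih =>
    obtain ⟨h1, h2⟩ := ih
    rw [nest]
    change (plug (nest c fun i : Fin (k + 1) => S i) (2 * c - 1) (S (k + 1))).length = _ ∧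
      ∀ e ≤ _, layer (plug (nest c fun i : Fin (k + 1) => S i) (2 * c - 1) (S (k + 1))) e = _
    generalize (nest c fun i : Fin (k + 1) => S i) = T at h1 h2 ⊢
    obtain ⟨t, T, rfl⟩ := List.exists_cons_of_length_eq_add_one h1
    have h3 : T.length = numEdges c k := by simpa using h1
    have h4 : 2 * c - 1 + 1 = 2 * c := by omega
    refine ⟨by rw [length_plug, h3, h4, numEdges_succ], fun e he => ?_⟩
    rw [numEdges_succ] at he
    rw [layer_plug _ _ _ _ _ (by rwa [h3, h4]), h4, layerSize]
    refine if_congr Iff.rfl (h2 _ ?_) rfl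
    exact Nat.div_le_of_le_mul he

/-! ### The distribution of nested block graphs -/

instance (T : List ℕ) : Finite (LayeredGraph T) := by
  have : ∀ a b, Finite (Fin a ≃. Fin b) := fun a b => Finite.of_injective _ DFunLike.coe_injective
  have : ∀ a b, Finite (Matching a b) := fun a b => inferInstanceAs (Finite {f // _})
  exact inferInstanceAs (Finite (∀ i : Fin (T.length - 1), Matching _ _))

noncomputable instance (T : List ℕ) : Fintype (LayeredGraph T) := Fintype.ofFinite _

instance (T : List ℕ) : MeasurableSingletonClass (LayeredGraph T) := ⟨fun _ => trivial⟩

/-- The sequence `nest(c, (S 0, …, S k))`. -/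
abbrev nestSeq (c : ℕ) (S : ℕ → ℕ) (k : ℕ) : List ℕ := nest c fun i : Fin (k + 1) => S i

theorem seq_zero (S : ℕ → ℕ) (k : ℕ) : (fun i : Fin (k + 1) => S i) 0 = S 0 := rfl

section Graph

variable {c : ℕ} (hc : 0 < c) {S : ℕ → ℕ} (hS : Monotone S) {k : ℕ}

theorem length_nestSeq_sub {c : ℕ} (hc : 0 < c) (S : ℕ → ℕ) (k : ℕ) :
    (nestSeq c S k).length - 1 = numEdges c k := by
  rw [(nest_spec hc S k).1, Nat.add_sub_cancel]

theorem isMat_pmap_layer {c : ℕ} (hc : 0 < c) {S : ℕ → ℕ} (hS : Monotone S) {k : ℕ} {e : ℕ}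
    (he : e < (nestSeq c S k).length - 1) (σ : Equiv.Perm (Fin (S k))) :
    IsMat (layer (nestSeq c S k) e) (layer (nestSeq c S k) (e + 1))
      (pmap (layer (nestSeq c S k) e) (layer (nestSeq c S k) (e + 1)) σ) := by
  rw [length_nestSeq_sub hc] at he
  rw [(nest_spec hc S k).2 e he.le, (nest_spec hc S k).2 (e + 1) he]
  exact isMat_pmap _ (layerSize_le hS _ _ _) (layerSize_le hS _ _ _) (layerSize_eq_or _ _)

/-- The layered graph represented by permutations. -/
def ofPerms (g : Fin (numEdges c k) → Equiv.Perm (Fin (S k))) : LayeredGraph (nestSeq c S k) :=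
  fun i => ⟨restrict _ _ (g (Fin.cast (length_nestSeq_sub hc S k) i)), by
    rw [matchingSize_eq_domCard _ fun u _ => rfl, toMap_restrict]
    exact (isMat_pmap_layer hc hS i.2 _).domCard_eq⟩

theorem toMap_ofPerms (g : Fin (numEdges c k) → Equiv.Perm (Fin (S k)))
    (i : Fin ((nestSeq c S k).length - 1)) :
    toMap (ofPerms hc hS g i).1 = pmap (layer (nestSeq c S k) i) (layer (nestSeq c S k) (i + 1))
      (g (Fin.cast (length_nestSeq_sub hc S k) i)) :=
  toMap_restrict _ _ _

theorem graphMaps_ofPerms (g : Fin (numEdges c k) → Equiv.Perm (Fin (S k))) (e : ℕ)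
    (he : e < numEdges c k) : graphMaps (ofPerms hc hS g) e = edgeMaps c S k g e := by
  have he' : e < (nestSeq c S k).length - 1 := by rwa [length_nestSeq_sub hc]
  rw [graphMaps, dif_pos he', toMap_ofPerms, edgeMaps, dif_pos he]
  change pmap (layer (nestSeq c S k) e) (layer (nestSeq c S k) (e + 1)) _ = _
  rw [(nest_spec hc S k).2 e he.le, (nest_spec hc S k).2 (e + 1) he]
  rfl

theorem good_iff (Z : Equiv.Perm (Fin (S 0))) (g : Fin (numEdges c k) → Equiv.Perm (Fin (S k))) :
    Good c S Z k g ↔ (ofPerms hc hS g).Nice ∧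
      finalMatching (seq_zero S k) (ofPerms hc hS g) = Z.toPEquiv := by
  have hl : lastLayer c (fun i : Fin (k + 1) => S i) = numEdges c k := length_nestSeq_sub hc S k
  rw [nice_iff, finalMatching_eq_iff, hl, length_nestSeq_sub hc, Good,
    NiceMaps.congr (graphMaps_ofPerms hc hS g),
    fpath_congr fun e _ h => graphMaps_ofPerms hc hS g e (by omega)]
  refine and_congr ?_ Iff.rfl
  refine forall₂_congr fun i d => forall₂_congr fun _ h => ?_
  refine exists_congr fun m => and_congr_right fun _ => and_congr_right fun h2 => ?_
  rw [(nest_spec hc S k).2 m (h2.trans h), (nest_spec hc S k).2 i (by omega)]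

/-- Each layer is completed to a permutation independently, in a number of ways that depends on the
layer sizes only. -/
theorem exists_card_fiber : ∃ M : ℕ, ∀ G : LayeredGraph (nestSeq c S k),
    Nat.card {g : Fin (numEdges c k) → Equiv.Perm (Fin (S k)) // ofPerms hc hS g = G} = M := by
  classical
  let a : Fin (numEdges c k) → ℕ := fun i => layerSize c S k i
  let b : Fin (numEdges c k) → ℕ := fun i => layerSize c S k (i + 1)
  have ha : ∀ i, a i ≤ S k := fun i => layerSize_le hS _ _ _
  have hb : ∀ i, b i ≤ S k := fun i => layerSize_le hS _ _ _
  have hab : ∀ i, a i = S k ∨ b i = S k := fun i => layerSize_eq_or _ _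
  refine ⟨∏ i, (S k - min (a i) (b i)).factorial, fun G => ?_⟩
  have hmat : ∀ i : Fin (numEdges c k), IsMat (a i) (b i) (graphMaps G i) := by
    intro i
    have := isMat_graphMaps G i (by rw [length_nestSeq_sub hc]; exact i.2)
    rwa [(nest_spec hc S k).2 i i.2.le, (nest_spec hc S k).2 (i + 1) i.2] at this
  choose h hh using fun i => exists_pmap (s := S k) (hmat i) (ha i) (hb i)
  have key : ∀ g, ofPerms hc hS g = G ↔ ∀ i, pmap (a i) (b i) (g i) = pmap (a i) (b i) (h i) := by
    intro g
    have h1 : ∀ i : Fin (numEdges c k),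
        graphMaps (ofPerms hc hS g) i = pmap (a i) (b i) (g i) := fun i => by
      rw [graphMaps_ofPerms hc hS g i i.2, edgeMaps_coe]
    constructor
    · rintro rfl i
      rw [hh, h1]
    · intro H
      funext i
      refine Subtype.ext (toMap_injective ?_)
      have h2 := (h1 (Fin.cast (length_nestSeq_sub hc S k) i)).trans ((H _).trans (hh _))
      rw [Fin.val_cast, graphMaps, graphMaps, dif_pos i.2, dif_pos i.2] at h2
      exact h2
  rw [Nat.card_eq_fintype_card, Fintype.card_subtype]
  have hset : (univ.filter fun g => ofPerms hc hS g = G)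
      = Fintype.piFinset fun i => univ.filter fun h' : Equiv.Perm (Fin (S k)) =>
        pmap (a i) (b i) h' = pmap (a i) (b i) (h i) := by
    ext g
    rw [mem_filter, Fintype.mem_piFinset, key]
    simp
  rw [hset, Fintype.card_piFinset]
  exact prod_congr rfl fun i _ => card_pmap_eq _ (ha i) (hb i) (hab i)

theorem nestedDistCond_eq {k n : ℕ} (S : Fin (k + 1) → ℕ) (h : S 0 = n)
    (Z : Equiv.Perm (Fin n)) :
    nestedDistCond c S h Z = uniformOn {G | G.Nice ∧ finalMatching h G = Z.toPEquiv} := by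
  rw [nestedDistCond, nestedDist, uniformOn,
    cond_cond_eq_cond_inter' (Set.toFinite _).measurableSet (Set.toFinite _).measurableSet
      (Measure.count_apply_lt_top.2 (Set.toFinite _)).ne]
  rfl

open Classical in
theorem uniformOn_real_singleton {α : Type} [Fintype α] [MeasurableSpace α]
    [MeasurableSingletonClass α] (p : α → Prop) (x : α) :
    (uniformOn {x | p x}).real {x} = if p x then ((univ.filter p).card : ℝ)⁻¹ else 0 := by
  have h1 : {x | p x} = ((univ.filter p : Finset α) : Set α) := by ext; simp
  have h2 : ({x} : Set α) = (({x} : Finset α) : Set α) := by simp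
  rw [Measure.real, h1, h2, uniformOn_apply_finset, ENNReal.toReal_div]
  split_ifs with h
  · rw [inter_singleton_of_mem (by simpa)]
    simp
  · rw [inter_singleton_of_notMem (by simpa)]
    simp

/-- Constant weight and fibres of constant size give the uniform law. That `levelDist` has mass 1
also shows that nice graphs with final matching `Z` exist, so that the conditioning is not void. -/
theorem nestedDistCond_spec (Z : Equiv.Perm (Fin (S 0))) :
    IsProbabilityMeasure (nestedDistCond c (fun i : Fin (k + 1) => S i) (seq_zero S k) Z) ∧
    ∀ F : LayeredGraph (nestSeq c S k) → ℝ, ∑ g, levelDist c hS Z k g * F (ofPerms hc hS g)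
      = ∑ G, (nestedDistCond c (fun i : Fin (k + 1) => S i) (seq_zero S k) Z).real {G} * F G := by
  classical
  obtain ⟨C, hC⟩ := exists_levelDist_eq hc hS k
  obtain ⟨M, hM⟩ := exists_card_fiber (k := k) hc hS
  let p : LayeredGraph (nestSeq c S k) → Prop := fun G => G.Nice ∧
    finalMatching (seq_zero S k) G = Z.toPEquiv
  have key : ∀ F : LayeredGraph (nestSeq c S k) → ℝ,
      ∑ g, levelDist c hS Z k g * F (ofPerms hc hS g)
        = ∑ G, (if p G then M * C else 0) * F G := by
    intro F
    rw [← sum_fiberwise univ (ofPerms hc hS)]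
    refine sum_congr rfl fun G _ => ?_
    have h1 : ∀ g ∈ univ.filter (fun g => ofPerms hc hS g = G),
        levelDist c hS Z k g * F (ofPerms hc hS g) = (if p G then C else 0) * F G := by
      intro g hg
      rw [hC, (mem_filter.1 hg).2]
      congr 1
      refine if_congr ?_ rfl rfl
      rw [good_iff hc hS, (mem_filter.1 hg).2]
    rw [sum_congr rfl h1, sum_const, nsmul_eq_mul, ← Fintype.card_subtype,
      ← Nat.card_eq_fintype_card, hM]
    split_ifs <;> ring
  have h1 := key fun _ => 1
  simp only [mul_one, sum_levelDist hS hc] at h1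
  rw [← sum_filter, sum_const, nsmul_eq_mul] at h1
  have h2 : ((univ.filter p).card : ℝ) ≠ 0 := by
    intro h0
    rw [h0, zero_mul] at h1
    exact one_ne_zero h1
  have h3 : (M : ℝ) * C = ((univ.filter p).card : ℝ)⁻¹ := by
    rw [eq_inv_of_mul_eq_one_right h1.symm]
  rw [nestedDistCond_eq]
  refine ⟨isProbabilityMeasure_uniformOn (Set.toFinite _) ?_, fun F => ?_⟩
  · obtain ⟨G, hG⟩ : (univ.filter p).Nonempty := card_ne_zero.1 (by exact_mod_cast h2)
    exact ⟨G, (mem_filter.1 hG).2⟩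
  · rw [key]
    refine sum_congr rfl fun G _ => ?_
    change _ = (uniformOn {G | p G}).real {G} * F G
    rw [uniformOn_real_singleton p, h3]
    congr!

theorem view_ofPerms {P : Player} {b : Bool} (hP : P = if b then .alice else .bob)
    {x x' y y' : Fin (numEdges c k) × Fin c → Equiv.Perm (Fin (S (k + 1)))}
    (h : if b then x = x' else y = y') :
    (ofPerms hc hS (joinEquiv c k _ true (x, y))).view P
      = (ofPerms hc hS (joinEquiv c k _ true (x', y'))).view P := by
  subst hP
  funext ⟨i, hi⟩
  have key : joinEquiv c k _ true (x, y) (Fin.cast (length_nestSeq_sub hc S (k + 1)) i)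
      = joinEquiv c k _ true (x', y') (Fin.cast (length_nestSeq_sub hc S (k + 1)) i) := by
    obtain ⟨⟨q, b'⟩, hq⟩ := (edgeEquiv c k).surjective
      (Fin.cast (length_nestSeq_sub hc S (k + 1)) i)
    -- The layer with index `2c·i + 2j + b'` is the matching whose number is larger by one, so `b' =
    -- true` means an even number, that is, Alice.
    have hb : b' = b := by
      have h1 := congrArg Fin.val hq
      rw [Fin.val_cast, edgeEquiv_val] at h1
      rw [← h1] at hi
      have h2 : 2 * c * (q.1 : ℕ) + 2 * q.2 + b'.toNat + 1
          = 2 * (c * q.1 + q.2) + (b'.toNat + 1) := by ring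
      have h3 : ¬ Even (2 * (c * (q.1 : ℕ) + q.2) + 1) := by simp
      have h4 : Even (2 * (c * (q.1 : ℕ) + q.2) + 2) := by simp [Nat.even_add]
      rw [edgeOwner, h2] at hi
      cases b <;> cases b' <;> simp_all
    subst hb
    rw [← hq, joinEquiv_apply, joinEquiv_apply]
    cases b' <;> simp_all
  refine Subtype.ext ?_
  change restrict _ _ _ = restrict _ _ _
  rw [key]

end Graph

/-! ### Protocols with bounded messages -/

/-- Bit strings of length at most `L`. -/
abbrev Message (L : ℕ) : Type := Σ i : Fin (L + 1), List.Vector Bool i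

theorem card_message (L : ℕ) : Fintype.card (Message L) + 1 = 2 ^ (L + 1) := by
  rw [Fintype.card_sigma]
  simp only [card_vector, Fintype.card_bool]
  rw [Fin.sum_univ_eq_sum_range fun i => 2 ^ i, Nat.geomSum_eq le_rfl]
  have := Nat.one_le_two_pow (n := L + 1)
  omega

/-- A bit string cut off after `L` bits. -/
def cutoff (L : ℕ) (l : List Bool) : Message L :=
  ⟨⟨(l.take L).length, by rw [List.length_take]; omega⟩, ⟨l.take L, rfl⟩⟩

theorem cutoff_val {L : ℕ} {l : List Bool} (h : l.length ≤ L) : (cutoff L l).2.1 = l :=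
  List.take_of_length_le h

/-- The inputs of both players. -/
def inputs {T : List ℕ} (a : Input T .alice) (b : Input T .bob) : ∀ p, Input T p
  | .alice => a
  | .bob => b

theorem inputs_view {T : List ℕ} (G : LayeredGraph T) :
    inputs (G.view .alice) (G.view .bob) = G.view := by
  funext p; cases p <;> rfl

theorem inputs_of_eq_alice {T : List ℕ} {p : Player} (h : p = .alice) (a : Input T .alice)
    (b : Input T .bob) : inputs a b p = h ▸ a := by
  subst h; rfl

theorem inputs_of_eq_bob {T : List ℕ} {p : Player} (h : p = .bob) (a : Input T .alice)
    (b : Input T .bob) : inputs a b p = h ▸ b := by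
  subst h; rfl

namespace Protocol

variable {T : List ℕ} {r : ℕ} {O : Type*}

/-- The output after `n` further rounds if `j` rounds have led to the transcript `tr`, and if all
further messages are cut off after `L` bits. -/
def resume (P : Protocol T r O) (L : ℕ) (a : Input T .alice) (b : Input T .bob) :
    ℕ → ℕ → List (List Bool) → O
  | 0, _, tr => P.out (inputs a b _) tr
  | n + 1, j, tr => P.resume L a b n (j + 1)
      (tr ++ [(cutoff L (P.msg (speaker (j + 1)) (inputs a b _) tr)).2.1])

variable (P : Protocol T r O)

/-- The parity of `j` decides whose turn it is. Cutting off makes the message set finite even for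
transcripts that no input produces; genuine runs are unaffected (`resume_transcript`). -/
theorem prot_resume (L : ℕ) (φ : O → ℝ) (hφ : ∀ o, 0 ≤ φ o ∧ φ o ≤ 1) (n j : ℕ)
    (h : j + n = r) (tr : List (List Bool)) :
    (Even j → Prot (Message L) n fun a b => φ (P.resume L a b n j tr)) ∧
      (¬ Even j → Prot (Message L) n fun b a => φ (P.resume L a b n j tr)) := by
  induction n generalizing j tr with
  | zero =>
    obtain rfl : j = r := h
    constructor
    · intro hj
      have hp : outputPlayer j = .alice := if_pos hj
      exact ⟨fun a => φ (P.out (hp ▸ a) tr), fun a => hφ _, fun a b => by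
        simp only [resume, inputs_of_eq_alice hp]⟩
    · intro hj
      have hp : outputPlayer j = .bob := if_neg hj
      exact ⟨fun b => φ (P.out (hp ▸ b) tr), fun b => hφ _, fun b a => by
        simp only [resume, inputs_of_eq_bob hp]⟩
  | succ n ih =>
    constructor
    · intro hj
      have hp : speaker (j + 1) = .alice := if_pos hj.add_one
      refine ⟨fun a => cutoff L (P.msg _ (hp ▸ a) tr),
        fun μ b a => φ (P.resume L a b n (j + 1) (tr ++ [μ.2.1])), fun μ => ?_, fun a b => ?_⟩
      · exact (ih (j + 1) (by omega) _).2 (by rw [Nat.even_add_one]; simpa)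
      · simp only [resume]
        rw [inputs_of_eq_alice hp]
    · intro hj
      have hp : speaker (j + 1) = .bob :=
        if_neg (by rw [Nat.odd_add_one, not_not]; exact Nat.not_even_iff_odd.1 hj)
      refine ⟨fun b => cutoff L (P.msg _ (hp ▸ b) tr),
        fun μ a b => φ (P.resume L a b n (j + 1) (tr ++ [μ.2.1])), fun μ => ?_, fun b a => ?_⟩
      · exact (ih (j + 1) (by omega) _).1 (by rw [Nat.even_add_one]; exact hj)
      · simp only [resume]
        rw [inputs_of_eq_bob hp]

theorem sum_length_transcript_le (G : LayeredGraph T) {j n : ℕ} :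
    ((P.transcript G j).map List.length).sum ≤
      ((P.transcript G (j + n)).map List.length).sum := by
  induction n with
  | zero => exact le_rfl
  | succ n ih =>
    refine ih.trans ?_
    rw [← add_assoc, transcript, List.map_append, List.sum_append]
    exact Nat.le_add_right _ _

theorem resume_transcript {L : ℕ} (G : LayeredGraph T) (hL : P.bits G ≤ L) (n j : ℕ)
    (h : j + n = r) :
    P.resume L (G.view .alice) (G.view .bob) n j (P.transcript G j) = P.output G := by
  induction n generalizing j with
  | zero =>
    obtain rfl : j = r := h
    rw [resume, inputs_view]
    rfl
  | succ n ih =>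
    rw [resume, cutoff_val]
    · rw [inputs_view]
      exact ih (j + 1) (by omega)
    · refine le_trans ?_ hL
      have h1 := P.sum_length_transcript_le G (j := j + 1) (n := n)
      rw [show j + 1 + n = r by omega] at h1
      refine le_trans ?_ h1
      rw [transcript, List.map_append, List.sum_append, inputs_view]
      simp

theorem prot_output {L : ℕ} (hL : ∀ G, P.bits G ≤ L) (φ : O → ℝ)
    (hφ : ∀ o, 0 ≤ φ o ∧ φ o ≤ 1) {X Y : Type} [Nonempty X] [Nonempty Y]
    (G : X → Y → LayeredGraph T)
    (hA : ∀ x y y', (G x y).view .alice = (G x y').view .alice)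
    (hB : ∀ x x' y, (G x y).view .bob = (G x' y).view .bob) :
    Prot (Message L) r fun x y => φ (P.output (G x y)) := by
  obtain ⟨x₀⟩ := ‹Nonempty X›
  obtain ⟨y₀⟩ := ‹Nonempty Y›
  have h := ((P.prot_resume L φ hφ r 0 (zero_add r) []).1 (by simp)).comp
    (fun x => (G x y₀).view .alice) (fun y => (G x₀ y).view .bob)
  convert h using 3 with x y
  rw [hA x y₀ y, hB x₀ x y]
  exact congrArg φ (P.resume_transcript (G x y) (hL _) r 0 (zero_add r)).symm

end Protocol

theorem sum_output_sub_le {c : ℕ} (hc : 0 < c) {S : ℕ → ℕ} (hS : Monotone S) {k : ℕ}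
    {L : ℕ} {δ : ℝ} (hδ : 0 ≤ δ) (hide : ∀ i < k + 1, LevelHides (Message L) c hS i δ)
    (Y N : Equiv.Perm (Fin (S 0))) {O : Type*} (P : Protocol (nestSeq c S (k + 1)) (k + 1) O)
    (hL : ∀ G, P.bits G ≤ L) (φ : O → ℝ) (hφ : ∀ o, 0 ≤ φ o ∧ φ o ≤ 1) :
    ∑ G, (nestedDistCond c (fun i : Fin (k + 1 + 1) => S i) (seq_zero S (k + 1)) Y).real {G} *
        φ (P.output G)
      - ∑ G, (nestedDistCond c (fun i : Fin (k + 1 + 1) => S i) (seq_zero S (k + 1)) N).real {G} *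
        φ (P.output G)
      ≤ ∑ i ∈ range (k + 1), 2 * (numEdges c i * δ) := by
  rw [← (nestedDistCond_spec hc hS Y).2, ← (nestedDistCond_spec hc hS N).2, ← sum_sub_distrib]
  have h := level_indist hS hc hδ (k + 1) hide Y N k (by omega) true
    (fun x y => φ (P.output (ofPerms hc hS (joinEquiv c k _ true (x, y)))))
    (P.prot_output hL φ hφ _ (fun x y y' => view_ofPerms hc hS (b := true) rfl rfl)
      (fun x x' y => view_ofPerms hc hS (b := false) rfl rfl))
  refine le_trans (le_of_eq ?_) h
  rw [← (joinEquiv c k _ true).sum_comp, Fintype.sum_prod_type]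
  exact sum_congr rfl fun x _ => sum_congr rfl fun y _ => by ring

/-! ### Output distributions -/

theorem outputDist_real {T : List ℕ} {r : ℕ} {O Ω : Type*} [MeasurableSpace O]
    [MeasurableSpace Ω] (P : RandProtocol T r O Ω) (D : Measure (LayeredGraph T))
    [IsProbabilityMeasure D] {A : Set O} (hA : MeasurableSet A) :
    (P.outputDist D).real A
      = ∫ ω, ∑ G, D.real {G} * A.indicator (fun _ => (1 : ℝ)) ((P.det ω).output G) ∂P.coins := by
  have := P.isProb
  have hm : Measurable fun x : LayeredGraph T × Ω => (P.det x.2).output x.1 :=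
    measurable_from_prod_countable_right fun G => P.measurable_output G
  have hG : ∀ G, MeasurableSet ((fun ω => (P.det ω).output G) ⁻¹' A) := fun G =>
    P.measurable_output G hA
  have hind : ∀ G, (fun ω => A.indicator (fun _ => (1 : ℝ)) ((P.det ω).output G))
      = ((fun ω => (P.det ω).output G) ⁻¹' A).indicator (fun _ => (1 : ℝ)) := fun G => rfl
  rw [integral_finsetSum]
  · rw [RandProtocol.outputDist, Measure.real, Measure.map_apply hm hA, Measure.prod_apply (hm hA),
      lintegral_fintype, ENNReal.toReal_sum fun G _ => by finiteness]
    refine sum_congr rfl fun G _ => ?_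
    rw [integral_const_mul, hind, integral_indicator_const _ (hG G), smul_eq_mul, mul_one,
      ENNReal.toReal_mul, mul_comm]
    rfl
  · intro G _
    refine Integrable.const_mul ?_ _
    rw [hind]
    exact (integrable_const (1 : ℝ)).indicator (hG G)

/-- Each event is tested through its indicator, and the coins are averaged out, so deterministic
protocols suffice. -/
theorem tvDist_outputDist_le {T : List ℕ} {r : ℕ} {O Ω : Type*} [MeasurableSpace O]
    [MeasurableSpace Ω] (P : RandProtocol T r O Ω) (D D' : Measure (LayeredGraph T))
    [IsProbabilityMeasure D] [IsProbabilityMeasure D'] {ε : ℝ}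
    (h : ∀ ω, ∀ φ : O → ℝ, (∀ o, 0 ≤ φ o ∧ φ o ≤ 1) →
      ∑ G, D.real {G} * φ ((P.det ω).output G) - ∑ G, D'.real {G} * φ ((P.det ω).output G) ≤ ε) :
    tvDist (P.outputDist D) (P.outputDist D') ≤ ε := by
  have := P.isProb
  have : Nonempty {A : Set O // MeasurableSet A} := ⟨⟨∅, MeasurableSet.empty⟩⟩
  refine ciSup_le fun ⟨A, hA⟩ => ?_
  have hintg : ∀ E : Measure (LayeredGraph T), Integrable (fun ω => ∑ G, E.real {G} *
      A.indicator (fun _ => (1 : ℝ)) ((P.det ω).output G)) P.coins := by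
    intro E
    refine integrable_finsetSum _ fun G _ => Integrable.const_mul ?_ _
    exact (integrable_const (1 : ℝ)).indicator (P.measurable_output G hA)
  rw [outputDist_real P D hA, outputDist_real P D' hA, ← integral_sub (hintg D) (hintg D')]
  calc _ ≤ ∫ _, ε ∂P.coins := by
        refine integral_mono ((hintg D).sub (hintg D')) (integrable_const _)
          fun ω => h ω _ fun o => ?_
        by_cases ho : o ∈ A <;> simp [ho]
    _ = ε := by simp

/-! ### The error bound -/

theorem levelHides_of_subsingleton {Λ : Type} [Subsingleton Λ] {c : ℕ} (hc : 0 < c) {S : ℕ → ℕ}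
    (hS : Monotone S) (k : ℕ) : LevelHides Λ c hS k 0 := fun p _ =>
  hides_of_subsingleton _ fun _ _ => sum_playerKer_left p hc _ _ _ _ _

theorem card_constrained_le {s s' : ℕ} (hs : s' ≤ s) (a b : ℕ) (h : Equiv.Perm (Fin s')) :
    (constrained hs a b h).card ≤ s' := by
  rw [constrained, card_map]
  exact (card_filter_le _ _).trans (by simp)

/-- A permutation of `S k` points constrains at most `S k` of the `S (k + 1)` points, which leaves
`g` free ones. -/
theorem levelHides_of_gap {Λ : Type} [Fintype Λ] {p : ℕ} (hp : 1 ≤ p)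
    (hΛ : Fintype.card Λ ≤ 2 ^ p) (n : ℕ) {g : ℕ} (hg : 1 ≤ g) {S : ℕ → ℕ} (hS : Monotone S)
    {k : ℕ} (hgap : S k + g ≤ S (k + 1)) {s : ℕ} (hs : S (k + 1) ≤ s) :
    LevelHides Λ (n + 1) hS k (s * (4 * √(s * (4 * p / (g : ℝ)) ^ n))) := by
  intro b i h M φ hφ
  have hle := card_constrained_le (hS k.le_succ) (layerSize (n + 1) S k i)
    (layerSize (n + 1) S k (i + 1)) h
  have hT : (constrained (hS k.le_succ) (layerSize (n + 1) S k i)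
      (layerSize (n + 1) S k (i + 1)) h).card + g ≤ Fintype.card (Fin (S (k + 1))) := by
    rw [Fintype.card_fin]; omega
  have hle' : ((constrained (hS k.le_succ) (layerSize (n + 1) S k i)
      (layerSize (n + 1) S k (i + 1)) h).card : ℝ) ≤ s := by
    exact_mod_cast hle.trans (by omega)
  have hs' : (S (k + 1) : ℝ) ≤ s := by exact_mod_cast hs
  have hbound : ((constrained (hS k.le_succ) (layerSize (n + 1) S k i)
      (layerSize (n + 1) S k (i + 1)) h).card : ℝ) *
        (4 * √(Fintype.card (Fin (S (k + 1))) * (4 * p / (g : ℝ)) ^ n))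
      ≤ s * (4 * √(s * (4 * p / (g : ℝ)) ^ n)) := by
    rw [Fintype.card_fin]
    gcongr
  refine le_trans ?_ hbound
  cases b
  · exact abs_blockKer_sub_le p hp hΛ n g hg _ hT _ M φ hφ
  · exact abs_blockKer_sub_le' p hp hΛ n g hg _ hT _ M φ hφ

theorem tvDist_le_of_levelHides {c : ℕ} (hc : 0 < c) {S : ℕ → ℕ} (hS : Monotone S) {k n : ℕ}
    (hn : S 0 = n) (h : (fun i : Fin (k + 1 + 1) => S i) 0 = n) {L : ℕ} {δ : ℝ} (hδ : 0 ≤ δ)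
    (hide : ∀ i < k + 1, LevelHides (Message L) c hS i δ) (Y N : Equiv.Perm (Fin n))
    {O Ω : Type*} [MeasurableSpace O] [MeasurableSpace Ω]
    (P : RandProtocol (nestSeq c S (k + 1)) (k + 1) O Ω) (hL : ∀ ω G, (P.det ω).bits G ≤ L) :
    tvDist (P.outputDist (nestedDistCond c (fun i : Fin (k + 1 + 1) => S i) h Y))
        (P.outputDist (nestedDistCond c (fun i : Fin (k + 1 + 1) => S i) h N))
      ≤ ∑ i ∈ range (k + 1), 2 * (numEdges c i * δ) := by
  subst hn
  have := (nestedDistCond_spec (k := k + 1) hc hS Y).1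
  have := (nestedDistCond_spec (k := k + 1) hc hS N).1
  exact tvDist_outputDist_le P _ _ fun ω φ hφ =>
    sum_output_sub_le hc hS hδ hide Y N (P.det ω) (hL ω) φ hφ

/-- The factor `2 ^ (15 * r)` gained in each of `n = c - 1` steps pays for the number of layers. -/
theorem mul_sq_mul_pow_le {r n : ℕ} (hr : 1 ≤ r) (hn : 1 ≤ n) :
    512 * r ^ 2 * (2 * (n + 1)) ^ (2 * r) ≤ 2 ^ (15 * r * n) := by
  have h1 : 2 * (n + 1) ≤ 2 ^ (n + 1) := by
    rw [pow_succ']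
    exact Nat.mul_le_mul_left _ Nat.lt_two_pow_self
  have h2 : r ^ 2 ≤ 2 ^ (2 * r) := by
    rw [mul_comm, pow_mul]
    exact Nat.pow_le_pow_left Nat.lt_two_pow_self.le 2
  have h3 : 512 ≤ 2 ^ (9 * r) := by
    calc 512 = 2 ^ 9 := by norm_num
      _ ≤ _ := Nat.pow_le_pow_right (by norm_num) (by omega)
  calc 512 * r ^ 2 * (2 * (n + 1)) ^ (2 * r)
      ≤ 2 ^ (9 * r) * 2 ^ (2 * r) * (2 ^ (n + 1)) ^ (2 * r) := by gcongr
    _ = 2 ^ (9 * r + 2 * r + (n + 1) * (2 * r)) := by rw [← pow_mul, pow_add, pow_add]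
    _ ≤ 2 ^ (15 * r * n) := by
        refine Nat.pow_le_pow_right (by norm_num) ?_
        nlinarith

theorem two_pow_le_of_one_le {r m n : ℕ} (hr : 1 ≤ r) (hm : 1 ≤ m)
    (hB : 1 ≤ (2 : ℝ) ^ (-(20 * (r : ℝ))) * (m : ℝ) ^ (1 - 200 / ((n + 1 : ℕ) : ℝ))) :
    (2 : ℝ) ^ (20 * r) ≤ m ∧ 200 ≤ n := by
  have hm' : (1 : ℝ) ≤ m := by exact_mod_cast hm
  have h1 : (2 : ℝ) ^ (20 * r) ≤ (m : ℝ) ^ (1 - 200 / ((n + 1 : ℕ) : ℝ)) := by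
    rw [Real.rpow_neg (by norm_num), ← div_eq_inv_mul, one_le_div (by positivity)] at hB
    refine le_trans (le_of_eq ?_) hB
    rw [← Real.rpow_natCast]
    push_cast
    rfl
  constructor
  · refine h1.trans ?_
    conv_rhs => rw [← Real.rpow_one (m : ℝ)]
    refine Real.rpow_le_rpow_of_exponent_le hm' ?_
    have : (0 : ℝ) ≤ 200 / ((n + 1 : ℕ) : ℝ) := by positivity
    linarith
  · by_contra! hn
    have h2 : (m : ℝ) ^ (1 - 200 / ((n + 1 : ℕ) : ℝ)) ≤ 1 := by
      refine Real.rpow_le_one_of_one_le_of_nonpos hm' ?_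
      have h3 : ((n + 1 : ℕ) : ℝ) ≤ 200 := by exact_mod_cast hn
      rw [sub_nonpos, one_le_div (by positivity)]
      exact h3
    have h4 : (1 : ℝ) < 2 ^ (20 * r) := one_lt_pow₀ (by norm_num) (by omega)
    linarith

theorem four_mul_div_pow_le {r m n p : ℕ} (hr : 1 ≤ r) (hm : 1 ≤ m)
    (hB : 1 ≤ (2 : ℝ) ^ (-(20 * (r : ℝ))) * (m : ℝ) ^ (1 - 200 / ((n + 1 : ℕ) : ℝ)))
    (hp : (p : ℝ) ≤ 2 * ((2 : ℝ) ^ (-(20 * (r : ℝ))) * (m : ℝ) ^ (1 - 200 / ((n + 1 : ℕ) : ℝ)))) :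
    1 ≤ m / r ∧ (4 * p / ((m / r : ℕ) : ℝ)) ^ n ≤ ((2 : ℝ) ^ (15 * r * n))⁻¹ * ((m : ℝ) ^ 9)⁻¹ := by
  obtain ⟨h1, hn⟩ := two_pow_le_of_one_le hr hm hB
  have hm0 : (0 : ℝ) < m := by exact_mod_cast hm
  have hr0 : (0 : ℝ) < r := by exact_mod_cast hr
  have hm1 : (1 : ℝ) ≤ m := by exact_mod_cast hm
  have hrp : 16 * r ≤ 2 ^ (5 * r) := by
    calc 16 * r ≤ 2 ^ (4 * r) * 2 ^ r := by
          gcongr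
          · calc 16 = 2 ^ 4 := by norm_num
              _ ≤ _ := Nat.pow_le_pow_right (by norm_num) (by omega)
          · exact Nat.lt_two_pow_self.le
      _ = 2 ^ (5 * r) := by rw [← pow_add]; congr 1; ring
  have h2r : 2 * r ≤ m := by
    have h2 : 2 ^ (20 * r) ≤ m := by exact_mod_cast h1
    have h3 : 2 ^ (5 * r) ≤ 2 ^ (20 * r) := Nat.pow_le_pow_right (by norm_num) (by omega)
    omega
  have hg1 : 1 ≤ m / r := (Nat.one_le_div_iff (by omega)).2 (by omega)
  have hg : (m : ℝ) / (2 * r) ≤ ((m / r : ℕ) : ℝ) := by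
    have h4 : m < r * (m / r + 1) := by
      have := Nat.lt_div_mul_add (a := m) (b := r) (by omega)
      linarith
    have h5 : m ≤ m / r * (2 * r) := by nlinarith
    rw [div_le_iff₀ (by positivity)]
    exact_mod_cast h5
  refine ⟨hg1, ?_⟩
  -- The constants amount to `16 * r`: a 4 from the rate, a 2 from `hp` and `2 * r` from `hg`. They
  -- use up `2 ^ (5 * r)` of the available `2 ^ (20 * r)`.
  have hθ : 4 * p / ((m / r : ℕ) : ℝ)
      ≤ ((2 : ℝ) ^ (15 * r))⁻¹ * (m : ℝ) ^ (-(200 / ((n + 1 : ℕ) : ℝ))) := by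
    calc 4 * p / ((m / r : ℕ) : ℝ)
        ≤ 4 * (2 * ((2 : ℝ) ^ (-(20 * (r : ℝ))) * (m : ℝ) ^ (1 - 200 / ((n + 1 : ℕ) : ℝ)))) /
            (m / (2 * r)) := by gcongr
      _ = (16 * r) * (2 : ℝ) ^ (-(20 * (r : ℝ))) * (m : ℝ) ^ (-(200 / ((n + 1 : ℕ) : ℝ))) := by
          rw [sub_eq_add_neg, Real.rpow_add hm0, Real.rpow_one]
          field_simp
          ring
      _ ≤ 2 ^ (5 * r) * (2 : ℝ) ^ (-(20 * (r : ℝ))) * (m : ℝ) ^ (-(200 / ((n + 1 : ℕ) : ℝ))) := by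
          gcongr
          exact_mod_cast hrp
      _ = _ := by
          congr 1
          have : (2 : ℝ) ^ (20 * (r : ℝ)) = 2 ^ (5 * r) * 2 ^ (15 * r) := by
            rw [← pow_add, ← Real.rpow_natCast]
            congr 1
            push_cast
            ring
          rw [Real.rpow_neg (by norm_num), this]
          field_simp
  calc (4 * p / ((m / r : ℕ) : ℝ)) ^ n
      ≤ (((2 : ℝ) ^ (15 * r))⁻¹ * (m : ℝ) ^ (-(200 / ((n + 1 : ℕ) : ℝ)))) ^ n := by gcongr
    _ = ((2 : ℝ) ^ (15 * r * n))⁻¹ * (m : ℝ) ^ (-(200 / ((n + 1 : ℕ) : ℝ)) * n) := by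
        rw [mul_pow, inv_pow, ← pow_mul, ← Real.rpow_mul_natCast hm0.le]
    _ ≤ ((2 : ℝ) ^ (15 * r * n))⁻¹ * (m : ℝ) ^ (-(9 : ℝ)) := by
        gcongr
        have hn' : (200 : ℝ) ≤ n := by exact_mod_cast hn
        rw [neg_mul, neg_le_neg_iff, div_mul_eq_mul_div, le_div_iff₀ (by positivity)]
        push_cast
        linarith
    _ = _ := by
        rw [Real.rpow_neg hm0.le]
        norm_cast

theorem sum_error_le {r m n p : ℕ} (hr : 1 ≤ r) (hm : 1 ≤ m)
    (hB : 1 ≤ (2 : ℝ) ^ (-(20 * (r : ℝ))) * (m : ℝ) ^ (1 - 200 / ((n + 1 : ℕ) : ℝ)))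
    (hp : (p : ℝ) ≤ 2 * ((2 : ℝ) ^ (-(20 * (r : ℝ))) * (m : ℝ) ^ (1 - 200 / ((n + 1 : ℕ) : ℝ)))) :
    ∑ i ∈ range r, 2 * ((numEdges (n + 1) i : ℝ) * (((2 * m : ℕ) : ℝ) *
      (4 * √(((2 * m : ℕ) : ℝ) * (4 * p / ((m / r : ℕ) : ℝ)) ^ n)))) ≤ 1 / (m : ℝ) ^ 3 := by
  obtain ⟨h1, hn⟩ := two_pow_le_of_one_le hr hm hB
  obtain ⟨-, hθ⟩ := four_mul_div_pow_le hr hm hB hp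
  have hm0 : (0 : ℝ) < m := by exact_mod_cast hm
  have hr0 : (0 : ℝ) < r := by exact_mod_cast hr
  set E : ℝ := (2 * (n + 1 : ℝ)) ^ r with hE
  have hE0 : 0 < E := by positivity
  have hEi : ∀ i ∈ range r, (numEdges (n + 1) i : ℝ) ≤ E := by
    intro i hi
    rw [numEdges, hE]
    push_cast
    refine pow_le_pow_right₀ ?_ (mem_range.1 hi).le
    have : (0 : ℝ) ≤ n := by positivity
    linarith
  -- Of `m ^ 9`, one power cancels the factor `2 * m` under the root; the root leaves `m ^ 4`, and
  -- the outer factor `2 * m` reduces this to `m ^ 3`.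
  have hX : √(((2 * m : ℕ) : ℝ) * (4 * p / ((m / r : ℕ) : ℝ)) ^ n)
      ≤ (16 * r * E * (m : ℝ) ^ 4)⁻¹ := by
    rw [Real.sqrt_le_left (by positivity)]
    have h2 : 512 * (r : ℝ) ^ 2 * E ^ 2 ≤ 2 ^ (15 * r * n) := by
      have := mul_sq_mul_pow_le hr (show 1 ≤ n by omega)
      rw [hE, ← pow_mul, mul_comm r 2]
      exact_mod_cast this
    calc ((2 * m : ℕ) : ℝ) * (4 * p / ((m / r : ℕ) : ℝ)) ^ n
        ≤ ((2 * m : ℕ) : ℝ) * (((2 : ℝ) ^ (15 * r * n))⁻¹ * ((m : ℝ) ^ 9)⁻¹) := by gcongr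
      _ ≤ ((2 * m : ℕ) : ℝ) * ((512 * (r : ℝ) ^ 2 * E ^ 2)⁻¹ * ((m : ℝ) ^ 9)⁻¹) := by gcongr
      _ = _ := by
          push_cast
          field_simp
          norm_num
  calc _ ≤ ∑ i ∈ range r, 2 * (E * (((2 * m : ℕ) : ℝ) * (4 * (16 * r * E * (m : ℝ) ^ 4)⁻¹))) := by
        refine sum_le_sum fun i hi => ?_
        have := hEi i hi
        gcongr
    _ = 1 / (m : ℝ) ^ 3 := by
        rw [sum_const, card_range, nsmul_eq_mul]
        push_cast
        field_simp
        norm_num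

theorem monotone_seq (m r : ℕ) : Monotone fun i : ℕ => m + i * m / r := fun i j hij => by
  dsimp only
  gcongr

theorem seq_add_le (m r i : ℕ) : m + i * m / r + m / r ≤ m + (i + 1) * m / r := by
  rw [add_assoc, add_mul, one_mul]
  exact Nat.add_le_add_left Nat.div_add_div_le_add_div _

theorem seq_le {m r i : ℕ} (hi : i ≤ r) : m + i * m / r ≤ 2 * m := by
  have : i * m / r ≤ m := Nat.div_le_of_le_mul (Nat.mul_le_mul_right _ hi)
  omega

end NestedBlock

theorem mainTheorem2 :
    ∃ (K : ℝ) (m₀ : ℕ), ∀ (r m c : ℕ), 0 < r → 0 < c → Odd m → m₀ ≤ m →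
      ∀ (Y N : Equiv.Perm (Fin m))
        (O Ω : Type*) [MeasurableSpace O] [MeasurableSpace Ω]
        (P : RandProtocol (nest c (fmtSeq m r)) r O Ω),
        P.CostAtMost ((2 : ℝ) ^ (-(K * (r : ℝ))) * (m : ℝ) ^ (1 - 200 / (c : ℝ))) →
        tvDist (P.outputDist (nestedDistCond c (fmtSeq m r) (fmtSeq_zero m r) Y))
            (P.outputDist (nestedDistCond c (fmtSeq m r) (fmtSeq_zero m r) N))
          ≤ 1 / (m : ℝ) ^ 3 := by
  refine ⟨20, 1, fun r m c hr hc _ hm Y N O Ω _ _ P hP => ?_⟩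
  obtain ⟨k, rfl⟩ : ∃ k, r = k + 1 := ⟨r - 1, by omega⟩
  obtain ⟨n, rfl⟩ : ∃ n, c = n + 1 := ⟨c - 1, by omega⟩
  set B : ℝ := (2 : ℝ) ^ (-(20 * ((k + 1 : ℕ) : ℝ))) * (m : ℝ) ^ (1 - 200 / ((n + 1 : ℕ) : ℝ))
    with hBdef
  have hL : ∀ ω G, (P.det ω).bits G ≤ ⌊B⌋₊ := fun ω G => Nat.le_floor (hP ω G)
  have key := fun (δ : ℝ) (hδ : 0 ≤ δ) hide => tvDist_le_of_levelHides hc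
    (monotone_seq m (k + 1)) (by simp) (fmtSeq_zero m (k + 1)) (L := ⌊B⌋₊) (δ := δ) hδ hide Y N P hL
  have hcard := card_message ⌊B⌋₊
  -- A budget below one bit allows only empty messages, and then hiding is exact for every `c`.
  rcases lt_or_ge B 1 with hB | hB
  · rw [Nat.floor_eq_zero.2 hB] at hcard key
    have : Subsingleton (Message 0) := Fintype.card_le_one_iff_subsingleton.1 (by omega)
    refine (key 0 le_rfl fun i _ => levelHides_of_subsingleton hc _ _).trans ?_
    simp
  -- There are fewer than `2 ^ (⌊B⌋₊ + 1)` bit strings of length at most `⌊B⌋₊`, hence this choice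
  -- of `p`.
  · have hp : ((⌊B⌋₊ + 1 : ℕ) : ℝ) ≤ 2 * B := by
      have := Nat.floor_le (zero_le_one.trans hB)
      push_cast
      linarith
    obtain ⟨hg, -⟩ := four_mul_div_pow_le hr hm hB hp
    refine (key _ (by positivity) fun i hi => levelHides_of_gap (p := ⌊B⌋₊ + 1)
      (by omega) (by omega) n hg _ (seq_add_le m (k + 1) i) (seq_le (by omega))).trans ?_
    exact sum_error_le hr hm hB hp
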